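/- Let $M$ be a connected smooth manifold of dimension $n\ge 1$ with a smooth metric $g_{ij}$ (positive definite, or more generally nondegenerate), let $V$ be a smooth function on $M$, and let $I,J\subseteq\mathbb R$ be nonempty open intervals. Consider the Schrödinger equation $$\Delta u-u_{,t}=V(x)\,u,\qquad \Delta u=g^{ij}u_{,ij}-\Gamma^i u_{,i},\qquad \Gamma^i=g^{jk}\Gamma^i_{jk},$$ for a function $u(t,x)$. A smooth vector field $$X=\xi^t(t,x,u)\,\partial_t+\xi^i(t,x,u)\,\partial_i+\eta(t,x,u)\,\partial_u$$ on $I\times M\times J$ is a Lie point symmetry of the equation if, in all local coordinates of the atlas, its second prolongation applied to $g^{ij}u_{ij}-\Gamma^iu_i-u_t-Vu$ vanishes at all second jets over $I\times M\times J$ at which this expression vanishes. A smooth vector field $Y$ on $M$ is a homothetic vector (HV) with factor $\psi\in\mathbb R$ if $L_Yg=2\psi g$, and a Killing vector (KV) if moreover $\psi=0$; it is gradient if $Y^i=S^{,i}$ for some smooth function $S$ on $M$. Below, $b$ always denotes a smooth solution of the Schrödinger equation on $I\times M$. The Lie point symmetries are generated by the homothetic algebra of $g$: $X$ is a Lie point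 symmetry if and only if $$X=\tau(t)\,\partial_t+Z^i(t,x)\,\partial_i+\bigl(a(t,x)u+b(t,x)\bigr)\partial_u$$ with $\tau,Z,a$ smooth and $b$ a solution, where for each $t\in I$ the field $Z(t,\cdot)$ is a KV/HV with factor $\tfrac12\tau_{,t}(t)$, and $$\partial_tZ^i=-2a^{,i},\qquad a_{,t}+\tfrac n4\tau_{,tt}+L_ZV+\tau_{,t}V=0 .$$ The symmetries that come from one KV/HV $Y$ are as follows. (a) Let $Y$ be a non-gradient KV/HV with factor $\psi$. The Lie point symmetries $X$ with $\xi^i=T(t)Y^i$ for some function $T$ are exactly the vector fields $$X=(2c\psi t+c_1)\,\partial_t+cY^i\,\partial_i+\bigl((a_0t+a_1)u+b(t,x)\bigr)\partial_u$$ with constants $c,c_1,a_0,a_1$ and a solution $b$, such that $$c\,L_YV+2\psi cV+a_0=0 .$$ (b) Let $Y^i=S^{,i}$ be a gradient KV/HV with factor $\psi$, not identically zero. The Lie point symmetries $X$ with $\xi^i=T(t)Y^i$ for some function $T$ that is not identically zero on $I$ are exactly the vector fields $$X=\Bigl(2\psi\int T\,dt+c_1\Bigr)\partial_t+T\,S^{,i}\,\partial_i+\Bigl(\bigl(-\tfrac12T_{,t}S+F(t)\bigr)u+b(t,x)\Bigr)\partial_u$$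 with a constant $c_1$, a solution $b$, and functions $T\not\equiv0$ (smooth) and $F$ (differentiable) on $I$, for which there are real constants $c^2$ (of either sign, i.e. $c$ real or imaginary) and $d$ such that $$L_YV+2\psi V-\tfrac12c^2S+d=0,\qquad T_{,tt}=c^2T,\qquad \tfrac n2\,\psi\,T_{,t}+F_{,t}=T\,d .$$ -/

import Mathlib

open Set Filter Topology Manifold
open scoped ContDiff BigOperators

namespace LieSym

noncomputable section

/-! ### Second order jets in `ι`-indexed coordinates and prolongation of point vector fields -/

section Jets

variable {ι : Type*} [Fintype ι] [DecidableEq ι]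

/-- Coordinates `(z, u)` on the space of independent variables and the dependent variable. -/
abbrev Jet0 (ι : Type*) := (ι → ℝ) × ℝ

/-- Coordinates `(z, u, u_i)` on the first jet space. -/
abbrev Jet1 (ι : Type*) := (ι → ℝ) × ℝ × (ι → ℝ)

/-- Coordinates `(z, u, u_i, u_ij)` on the second jet space. The genuine second jets are those with
`u_ij = u_ji`; this symmetry is imposed where jets are quantified over. -/
abbrev Jet2 (ι : Type*) := (ι → ℝ) × ℝ × (ι → ℝ) × (ι → ι → ℝ)

/-- The underlying point `(z, u)` of a second jet. -/
def Jet2.base (j : Jet2 ι) : Jet0 ι := (j.1, j.2.1)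

/-- The underlying first jet of a second jet. -/
def Jet2.toJet1 (j : Jet2 ι) : Jet1 ι := (j.1, j.2.1, j.2.2.1)

/-- Total derivative of a function of `(z, u)`: `D_i f = ∂_i f + u_i ∂_u f`. -/
def totalDeriv0 (f : Jet0 ι → ℝ) (i : ι) (j : Jet1 ι) : ℝ :=
  fderiv ℝ f (j.1, j.2.1) (Pi.single i 1, j.2.2 i)

/-- Total derivative of a function of `(z, u, u_k)`:
`D_i f = ∂_i f + u_i ∂_u f + ∑ k, u_ik ∂_{u_k} f`. -/
def totalDeriv1 (f : Jet1 ι → ℝ) (i : ι) (j : Jet2 ι) : ℝ :=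
  fderiv ℝ f j.toJet1 (Pi.single i 1, j.2.2.1 i, j.2.2.2 i)

/-- `η_[i] = D_i η - ∑ k, u_k D_i ξ^k`. -/
def prolong1 (ξ : Jet0 ι → ι → ℝ) (η : Jet0 ι → ℝ) (i : ι) (j : Jet1 ι) : ℝ :=
  totalDeriv0 η i j - ∑ k, j.2.2 k * totalDeriv0 (fun w => ξ w k) i j

/-- `η_[il] = D_l η_[i] - ∑ k, u_ik D_l ξ^k`. -/
def prolong2 (ξ : Jet0 ι → ι → ℝ) (η : Jet0 ι → ℝ) (i l : ι) (j : Jet2 ι) : ℝ :=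
  totalDeriv1 (prolong1 ξ η i) l j
    - ∑ k, j.2.2.2 i k * totalDeriv0 (fun w => ξ w k) l j.toJet1

/-- `X^[2] H`, the second prolongation of `X = ∑ i, ξ^i ∂_i + η ∂_u` applied to `H`. -/
def prolongApply (ξ : Jet0 ι → ι → ℝ) (η : Jet0 ι → ℝ) (H : Jet2 ι → ℝ) (j : Jet2 ι) : ℝ :=
  fderiv ℝ H j
    (ξ j.base, η j.base, fun i => prolong1 ξ η i j.toJet1, fun i l => prolong2 ξ η i l j)

/-- The infinitesimal symmetry criterion over a region `D` of `(z, u)`-space: `X^[2] H = 0`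
at every second jet over `D` with `H = 0`. -/
def SymmetryCriterion (ξ : Jet0 ι → ι → ℝ) (η : Jet0 ι → ℝ) (H : Jet2 ι → ℝ)
    (D : Set (Jet0 ι)) : Prop :=
  ∀ j : Jet2 ι, j.base ∈ D → (∀ i l, j.2.2.2 i l = j.2.2.2 l i) → H j = 0 →
    prolongApply ξ η H j = 0

/-- The second jet of a function `f` at `z`. -/
def jetOf (f : (ι → ℝ) → ℝ) (z : ι → ℝ) : Jet2 ι :=
  (z, f z, fun i => fderiv ℝ f z (Pi.single i 1),
    fun i l => fderiv ℝ (fun y => fderiv ℝ f y (Pi.single i 1)) z (Pi.single l 1))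

end Jets

/-! ### Metrics, vector fields and functions on a manifold, in the charts of the atlas -/

section Geometry

/-- The model space. -/
abbrev E (n : ℕ) := EuclideanSpace ℝ (Fin n)

variable {n : ℕ} {M : Type*} [TopologicalSpace M] [ChartedSpace (E n) M]

/-- Vector fields (no regularity). -/
abbrev VField (n : ℕ) (M : Type*) [TopologicalSpace M] [ChartedSpace (E n) M] :=
  (x : M) → TangentSpace (𝓡 n) x

/-- The coordinate vector `∂_i` of the chart `e` at the point with coordinates `y`. -/
def coordVec (e : OpenPartialHomeomorph M (E n)) (y : E n) (i : Fin n) :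
    TangentSpace (𝓡 n) (e.symm y) :=
  mfderiv (𝓡 n) (𝓡 n) e.symm y (EuclideanSpace.single i (1 : ℝ) : E n)

/-- The components of a tangent vector at `x` in the chart `e`. -/
def vecComp (e : OpenPartialHomeomorph M (E n)) (x : M) (v : TangentSpace (𝓡 n) x)
    (i : Fin n) : ℝ :=
  (show E n from mfderiv (𝓡 n) (𝓡 n) e x v) i

/-- The derivative of a function `f` at `x` along a tangent vector `v`. -/
def dirDeriv (f : M → ℝ) (x : M) (v : TangentSpace (𝓡 n) x) : ℝ :=
  mfderiv (𝓡 n) 𝓘(ℝ, ℝ) f x v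

/-- Partial derivative in a chart. -/
def pd (k : Fin n) (f : E n → ℝ) (y : E n) : ℝ :=
  fderiv ℝ f y (EuclideanSpace.single k (1 : ℝ))

variable (n M) in
/-- A smooth metric: a smooth field of symmetric nondegenerate bilinear forms. Riemannian metrics
are the positive definite ones; indefinite signatures are allowed as well. -/
structure Metric where
  /-- the bilinear form at `x` -/
  val : ∀ x : M, TangentSpace (𝓡 n) x →L[ℝ] TangentSpace (𝓡 n) x →L[ℝ] ℝ
  symm : ∀ x v w, val x v w = val x w v
  nondegenerate : ∀ x v, (∀ w, val x v w = 0) → v = 0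
  smooth : ∀ e ∈ atlas (E n) M, ∀ i j,
    ContDiffOn ℝ ∞ (fun y => val (e.symm y) (coordVec e y i) (coordVec e y j)) e.target

namespace Metric

variable (g : Metric n M) (e : OpenPartialHomeomorph M (E n))

/-- The matrix `g_ij` of the metric in a chart. -/
def comp (y : E n) : Matrix (Fin n) (Fin n) ℝ :=
  Matrix.of fun i j => g.val (e.symm y) (coordVec e y i) (coordVec e y j)

/-- The inverse matrix `g^ij`. -/
def inv (y : E n) : Matrix (Fin n) (Fin n) ℝ := (g.comp e y)⁻¹

/-- The Christoffel symbols `Γ^i_jk`. -/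
def christoffel (y : E n) (i j k : Fin n) : ℝ :=
  ∑ l, (1 / 2) * g.inv e y i l *
    (pd j (fun y => g.comp e y l k) y + pd k (fun y => g.comp e y l j) y
      - pd l (fun y => g.comp e y j k) y)

/-- `Γ^i = ∑ j k, g^jk Γ^i_jk`. -/
def contractedChristoffel (y : E n) (i : Fin n) : ℝ :=
  ∑ j, ∑ k, g.inv e y j k * g.christoffel e y i j k

/-- The Lie derivative `(L_Y g)_ij = ∑ k, (Y^k ∂_k g_ij + g_kj ∂_i Y^k + g_ik ∂_j Y^k)`. -/
def lieDeriv (Y : VField n M) (y : E n) (i j : Fin n) : ℝ :=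
  ∑ k, (vecComp e (e.symm y) (Y (e.symm y)) k * pd k (fun y => g.comp e y i j) y
    + g.comp e y k j * pd i (fun y => vecComp e (e.symm y) (Y (e.symm y)) k) y
    + g.comp e y i k * pd j (fun y => vecComp e (e.symm y) (Y (e.symm y)) k) y)

/-- `Y` is a smooth vector field with `L_Y g = 2 ψ g`, `ψ` constant: a homothetic vector (HV) with
homothetic factor `ψ`, and a Killing vector (KV) if `ψ = 0`. -/
def IsHomothetic (Y : VField n M) (ψ : ℝ) : Prop :=
  (∀ e ∈ atlas (E n) M, ∀ i,
    ContDiffOn ℝ ∞ (fun y => vecComp e (e.symm y) (Y (e.symm y)) i) e.target) ∧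
  ∀ e ∈ atlas (E n) M, ∀ y ∈ e.target, ∀ i j,
    g.lieDeriv e Y y i j = 2 * ψ * g.comp e y i j

/-- `Y` is the gradient of the smooth function `S`, i.e. `Y^i = S^{,i}`. -/
def IsGradientOf (Y : VField n M) (S : M → ℝ) : Prop :=
  ContMDiff (𝓡 n) 𝓘(ℝ, ℝ) ∞ S ∧ ∀ x v, dirDeriv S x v = g.val x (Y x) v

end Metric

/-! ### The Schrödinger equation `Δ u - u_t = V u` and its Lie point symmetries

The independent variables are indexed by `Option (Fin n)`: `none` is the time `t`, and `some i` is
the spatial coordinate `x^i`. -/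

/-- The spatial coordinates of a point `(t, x)`. -/
def spacePart (z : Option (Fin n) → ℝ) : E n := WithLp.toLp 2 fun i => z (some i)

/-- The part of the `(t, x)`-space that the chart `e` and the time interval `I` give. -/
def chartDomain (I : Set ℝ) (e : OpenPartialHomeomorph M (E n)) : Set (Option (Fin n) → ℝ) :=
  {z | z none ∈ I ∧ spacePart z ∈ e.target}

/-- A time-dependent function in coordinates. -/
def inChart (e : OpenPartialHomeomorph M (E n)) (f : ℝ → M → ℝ)
    (z : Option (Fin n) → ℝ) : ℝ :=
  f (z none) (e.symm (spacePart z))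

/-- Smoothness of a time-dependent function on `I × M`. -/
def SmoothFun (n : ℕ) {M : Type*} [TopologicalSpace M] [ChartedSpace (E n) M]
    (I : Set ℝ) (f : ℝ → M → ℝ) : Prop :=
  ∀ e ∈ atlas (E n) M, ContDiffOn ℝ ∞ (inChart e f) (chartDomain I e)

/-- Smoothness of a time-dependent vector field on `I × M`. -/
def SmoothVField (I : Set ℝ) (Z : ℝ → VField n M) : Prop :=
  ∀ e ∈ atlas (E n) M, ∀ i,
    ContDiffOn ℝ ∞ (inChart e fun t x => vecComp e x (Z t x) i) (chartDomain I e)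

/-- The function `H = g^ij u_ij - Γ^i u_i - u_t - V u` on the second jets in the chart `e`, whose
vanishing is the Schrödinger equation `Δ u - u_t = V u`. -/
def schrodinger (g : Metric n M) (V : M → ℝ) (e : OpenPartialHomeomorph M (E n))
    (j : Jet2 (Option (Fin n))) : ℝ :=
  let y := spacePart j.1
  (∑ i, ∑ k, g.inv e y i k * j.2.2.2 (some i) (some k))
    - (∑ i, g.contractedChristoffel e y i * j.2.2.1 (some i))
    - j.2.2.1 none - V (e.symm y) * j.2.1

/-- `b` is a smooth solution of the Schrödinger equation on `I × M`. -/
def IsSolution (g : Metric n M) (V : M → ℝ) (I : Set ℝ) (b : ℝ → M → ℝ) : Prop :=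
  SmoothFun n I b ∧
  ∀ e ∈ atlas (E n) M, ∀ z ∈ chartDomain I e, schrodinger g V e (jetOf (inChart e b) z) = 0

variable (n M) in
/-- A vector field `ξt ∂_t + ξ^i ∂_i + η ∂_u`, with coefficients depending on `(t, x, u)`. -/
structure PointField where
  /-- the `∂_t` coefficient -/
  ξt : ℝ → M → ℝ → ℝ
  /-- the spatial part `ξ^i ∂_i` -/
  ξ : ℝ → (x : M) → ℝ → TangentSpace (𝓡 n) x
  /-- the `∂_u` coefficient -/
  η : ℝ → M → ℝ → ℝ

namespace PointField

variable (X : PointField n M) (e : OpenPartialHomeomorph M (E n))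

/-- The components along the independent variables, in a chart. -/
def baseComp (w : Jet0 (Option (Fin n))) : Option (Fin n) → ℝ
  | none => X.ξt (w.1 none) (e.symm (spacePart w.1)) w.2
  | some i => vecComp e (e.symm (spacePart w.1)) (X.ξ (w.1 none) (e.symm (spacePart w.1)) w.2) i

/-- The component along the dependent variable, in a chart. -/
def fibreComp (w : Jet0 (Option (Fin n))) : ℝ :=
  X.η (w.1 none) (e.symm (spacePart w.1)) w.2

/-- `X` is a smooth vector field on `I × M × J` that generates a Lie point symmetry of the
Schrödinger equation `Δ u - u_t = V u`. -/
def IsLieSymmetry (g : Metric n M) (V : M → ℝ) (I J : Set ℝ) : Prop :=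
  ∀ e ∈ atlas (E n) M,
    ContDiffOn ℝ ∞ (X.baseComp e) (chartDomain I e ×ˢ J) ∧
    ContDiffOn ℝ ∞ (X.fibreComp e) (chartDomain I e ×ˢ J) ∧
    SymmetryCriterion (X.baseComp e) (X.fibreComp e) (schrodinger g V e) (chartDomain I e ×ˢ J)

/-- On `I × M × J`, `X = τ(t) ∂_t + Z^i(t, x) ∂_i + (a(t, x) u + b(t, x)) ∂_u`. -/
def HasForm (I J : Set ℝ) (τ : ℝ → ℝ) (Z : ℝ → VField n M) (a b : ℝ → M → ℝ) : Prop :=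
  ∀ t ∈ I, ∀ x : M, ∀ u ∈ J,
    X.ξt t x u = τ t ∧ X.ξ t x u = Z t x ∧ X.η t x u = a t x * u + b t x

end PointField

end Geometry

end

end LieSym

/-! The proof is the classical computation of determining equations. A second jet on which H = g^ij
u_ij - Γ^i u_i - u_t - V u vanishes is given by freely chosen values of t, x, u, u_i, u_ti, u_tt and
symmetric u_ik, while u_t is solved from the equation. On such jets X^[2] H is a polynomial in the
derivative coordinates, so its coefficients vanish separately.

The coefficient of u_ti gives D_i ξ^t = 0, hence ξ^t depends on t alone
(`time_component_of_criterion`). The coefficient of u_ik gives ∂_u ξ^i = 0 and L_Z g = τ_t g, the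
latter first as an equation for g^ij (`space_component_of_criterion`, `Metric.lieForm_eq_iff`). What
remains is quadratic in u_i (`fibre_component_of_criterion`). Its top coefficient gives η_uu = 0, so
η = a u + b. Its linear coefficient contains many Christoffel terms, but a homothety preserves the
Levi-Civita connection (`Metric.lieDeriv_contractedChristoffel`), and only ∂_t Z^i + 2 a^{,i} = 0
survives. Its constant term is affine in u and splits into the equation for b and Δa - a_t - L_Z V -
τ_t V = 0.

The Laplacian of a is then eliminated. Differentiating L_Z g = τ_t g in t shows that ∂_t Z = -2 ∇a
satisfies L_{∂_t Z} g = τ_tt g, so -4 Hess a = τ_tt g, and the trace is Δa = -(n/4) τ_tt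
(`Metric.laplacian_of_gradient`). Connectedness of M and of J glues the chart statements into a
global form of X (`exists_hasForm_of_isLieSymmetry`).

For Z = T(t) Y the factor of a homothety being unique gives τ_t = 2ψT, and the gradient condition
becomes T_t Y = -2 ∇a. If Y is not a gradient, T_t must vanish, and a is an affine function of t. If
Y = ∇S, then a = -T_t S/2 + F(t), and the last equation is a relation -T_tt S/2 + F_t + (n/2)ψT_t +
T (L_Y V + 2ψV) = 0. At a time with T ≠ 0 it expresses L_Y V + 2ψV as an affine function of S;
substituting this back and using that S is not constant separates the variables. -/

namespace LieSym

noncomputable section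

/-! ### Prolongation formulas on jet spaces -/

section JetFormulas

variable {ι : Type*} [Fintype ι] [DecidableEq ι]

lemma differentiableAt_fderiv_of_contDiffAt {F G : Type*} [NormedAddCommGroup F] [NormedSpace ℝ F]
    [NormedAddCommGroup G] [NormedSpace ℝ G] {f : F → G} {x : F} (hf : ContDiffAt ℝ 2 f x) :
    DifferentiableAt ℝ (fderiv ℝ f) x :=
  (hf.fderiv_right (m := 1) (by norm_num)).differentiableAt (by norm_num)

/-- The derivative of a total derivative, as a function of the first jet. -/
lemma hasFDerivAt_totalDeriv0 {f : Jet0 ι → ℝ} {j : Jet1 ι} (hf : ContDiffAt ℝ 2 f (j.1, j.2.1))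
    (i : ι) :
    ∃ L : Jet1 ι →L[ℝ] ℝ, HasFDerivAt (totalDeriv0 f i) L j ∧ ∀ e a b, L (e, a, b) =
      fderiv ℝ (fderiv ℝ f) (j.1, j.2.1) (e, a) (Pi.single i 1, j.2.2 i)
        + b i * fderiv ℝ f (j.1, j.2.1) (0, 1) := by
  let π : Jet1 ι →L[ℝ] Jet0 ι :=
    (ContinuousLinearMap.fst ℝ (ι → ℝ) (ℝ × (ι → ℝ))).prod
      ((ContinuousLinearMap.fst ℝ ℝ (ι → ℝ)).comp
        (ContinuousLinearMap.snd ℝ (ι → ℝ) (ℝ × (ι → ℝ))))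
  let ρ : Jet1 ι →L[ℝ] Jet0 ι :=
    (ContinuousLinearMap.inr ℝ (ι → ℝ) ℝ).comp
      ((ContinuousLinearMap.proj (R := ℝ) (φ := fun _ : ι => ℝ) i).comp
        ((ContinuousLinearMap.snd ℝ ℝ (ι → ℝ)).comp
          (ContinuousLinearMap.snd ℝ (ι → ℝ) (ℝ × (ι → ℝ)))))
  have h1 : HasFDerivAt (fun j : Jet1 ι => fderiv ℝ f (π j))
      ((fderiv ℝ (fderiv ℝ f) (j.1, j.2.1)).comp π) j :=
    (differentiableAt_fderiv_of_contDiffAt hf).hasFDerivAt.comp j π.hasFDerivAt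
  have h2 : HasFDerivAt (fun j : Jet1 ι => ((Pi.single i 1, 0) : Jet0 ι) + ρ j) ρ j :=
    ρ.hasFDerivAt.const_add _
  refine ⟨_, (h1.clm_apply h2).congr_of_eventuallyEq (Eventually.of_forall fun j => ?_), ?_⟩
  · simp [totalDeriv0, π, ρ]
  · intro e a b
    have : ((0 : ι → ℝ), b i) = b i • ((0 : ι → ℝ), (1 : ℝ)) := by simp
    simp only [add_apply, ContinuousLinearMap.comp_apply,
      ContinuousLinearMap.flip_apply]
    simp [π, ρ]
    rw [this, map_smul, smul_eq_mul]; ring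

/-- The second total derivative `D_l D_i f` without the terms containing `u_il`. -/
def hess (f : Jet0 ι → ℝ) (i l : ι) (j : Jet1 ι) : ℝ :=
  fderiv ℝ (fderiv ℝ f) (j.1, j.2.1) (Pi.single l 1, j.2.2 l) (Pi.single i 1, j.2.2 i)

/-- The derivative of `f` along the dependent variable. -/
def derivU (f : Jet0 ι → ℝ) (w : Jet0 ι) : ℝ := fderiv ℝ f w (0, 1)

/-- The product rule for u_k D_i ξ^k produces u_lk D_i ξ^k, and a repeated total derivative D_l D_i
f is `hess f` plus u_li ∂_u f. Third derivatives of u cannot occur, as η_[i] is a function of the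
first jet. The dependence on every second derivative is now explicit and linear. -/
lemma prolong2_eq {ξ : Jet0 ι → ι → ℝ} {η : Jet0 ι → ℝ} {j : Jet2 ι}
    (hξ : ∀ k, ContDiffAt ℝ 2 (fun w => ξ w k) j.base) (hη : ContDiffAt ℝ 2 η j.base) (i l : ι) :
    prolong2 ξ η i l j = hess η i l j.toJet1 + j.2.2.2 l i * derivU η j.base
      - ∑ k, (j.2.2.2 l k * totalDeriv0 (fun w => ξ w k) i j.toJet1
        + j.2.2.2 i k * totalDeriv0 (fun w => ξ w k) l j.toJet1
        + j.2.2.1 k * (hess (fun w => ξ w k) i l j.toJet1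
          + j.2.2.2 l i * derivU (fun w => ξ w k) j.base)) := by
  obtain ⟨L, hL, hL'⟩ := hasFDerivAt_totalDeriv0 (j := j.toJet1) hη i
  choose K hK hK' using fun k => hasFDerivAt_totalDeriv0 (j := j.toJet1) (hξ k) i
  let ρ : ι → Jet1 ι →L[ℝ] ℝ := fun k =>
      (ContinuousLinearMap.proj (R := ℝ) (φ := fun _ : ι => ℝ) k).comp
        ((ContinuousLinearMap.snd ℝ ℝ (ι → ℝ)).comp
          (ContinuousLinearMap.snd ℝ (ι → ℝ) (ℝ × (ι → ℝ))))
  have h : HasFDerivAt (prolong1 ξ η i) _ j.toJet1 :=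
    hL.sub (HasFDerivAt.fun_sum (u := Finset.univ) fun k _ => ((ρ k).hasFDerivAt).mul (hK k))
  rw [prolong2, totalDeriv1, h.fderiv]
  simp only [sub_apply, sum_apply,
    add_apply, smul_apply, hL', hK', smul_eq_mul]
  simp only [ρ, ContinuousLinearMap.comp_apply, ContinuousLinearMap.coe_snd',
    ContinuousLinearMap.proj_apply]
  rw [sub_sub, ← Finset.sum_add_distrib]
  simp only [hess, derivU, Jet2.base, Jet2.toJet1]
  congr 1
  refine Finset.sum_congr rfl fun k _ => ?_
  ring

end JetFormulas

/-! ### The prolonged field applied to the Schrödinger expression -/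

section SchrodingerJets

variable {n : ℕ} {M : Type*} [TopologicalSpace M] [ChartedSpace (E n) M]

/-- `spacePart` as a continuous linear map. -/
def spacePartL (n : ℕ) : (Option (Fin n) → ℝ) →L[ℝ] E n :=
  ((EuclideanSpace.equiv (Fin n) ℝ).symm : (Fin n → ℝ) →L[ℝ] E n).comp
    (ContinuousLinearMap.pi fun i => ContinuousLinearMap.proj (some i))

lemma spacePartL_apply (z : Option (Fin n) → ℝ) : spacePartL n z = spacePart z := rfl

variable (g : Metric n M) (V : M → ℝ) (e : OpenPartialHomeomorph M (E n))

/-- Chain rule: H is affine in u and its derivatives, with coefficients depending on x alone. Of the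
second prolongation only the purely spatial components enter, because H contains neither u_tt nor
u_ti. -/
lemma prolongApply_schrodinger {ξ : Jet0 (Option (Fin n)) → Option (Fin n) → ℝ}
    {η : Jet0 (Option (Fin n)) → ℝ} (j : Jet2 (Option (Fin n)))
    (hG : ∀ i k, DifferentiableAt ℝ (fun y => g.inv e y i k) (spacePart j.1))
    (hΓ : ∀ i, DifferentiableAt ℝ (fun y => g.contractedChristoffel e y i) (spacePart j.1))
    (hV : DifferentiableAt ℝ (fun y => V (e.symm y)) (spacePart j.1)) :
    prolongApply ξ η (schrodinger g V e) j =
      (∑ i, ∑ k,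
        (fderiv ℝ (fun y => g.inv e y i k) (spacePart j.1) (spacePart (ξ j.base))
          * j.2.2.2 (some i) (some k)
        + g.inv e (spacePart j.1) i k * prolong2 ξ η (some i) (some k) j))
      - (∑ i, (fderiv ℝ (fun y => g.contractedChristoffel e y i) (spacePart j.1)
          (spacePart (ξ j.base)) * j.2.2.1 (some i)
        + g.contractedChristoffel e (spacePart j.1) i * prolong1 ξ η (some i) j.toJet1))
      - prolong1 ξ η none j.toJet1
      - (fderiv ℝ (fun y => V (e.symm y)) (spacePart j.1) (spacePart (ξ j.base)) * j.2.1
        + V (e.symm (spacePart j.1)) * η j.base) := by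
  let I' := Option (Fin n)
  let πz : Jet2 I' →L[ℝ] E n := (spacePartL n).comp (ContinuousLinearMap.fst ℝ _ _)
  let πu : Jet2 I' →L[ℝ] ℝ := (ContinuousLinearMap.fst ℝ _ _).comp (ContinuousLinearMap.snd ℝ _ _)
  let πp : I' → Jet2 I' →L[ℝ] ℝ := fun i => (ContinuousLinearMap.proj (R := ℝ) i).comp
    ((ContinuousLinearMap.fst ℝ (I' → ℝ) (I' → I' → ℝ)).comp
      ((ContinuousLinearMap.snd ℝ _ _).comp (ContinuousLinearMap.snd ℝ _ _)))
  let πq : I' → I' → Jet2 I' →L[ℝ] ℝ := fun i k =>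
    (ContinuousLinearMap.proj (R := ℝ) (φ := fun _ : I' => ℝ) k).comp
    ((ContinuousLinearMap.proj (R := ℝ) (φ := fun _ : I' => I' → ℝ) i).comp
    ((ContinuousLinearMap.snd ℝ (I' → ℝ) (I' → I' → ℝ)).comp
      ((ContinuousLinearMap.snd ℝ _ _).comp (ContinuousLinearMap.snd ℝ _ _))))
  have cG : ∀ i k, HasFDerivAt (fun j : Jet2 I' => g.inv e (πz j) i k)
      ((fderiv ℝ (fun y => g.inv e y i k) (spacePart j.1)).comp πz) j := fun i k =>
    HasFDerivAt.comp (g := fun y => g.inv e y i k) j (hG i k).hasFDerivAt πz.hasFDerivAt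
  have cΓ : ∀ i, HasFDerivAt (fun j : Jet2 I' => g.contractedChristoffel e (πz j) i)
      ((fderiv ℝ (fun y => g.contractedChristoffel e y i) (spacePart j.1)).comp πz) j := fun i =>
    HasFDerivAt.comp (g := fun y => g.contractedChristoffel e y i) j (hΓ i).hasFDerivAt
      πz.hasFDerivAt
  have cV : HasFDerivAt (fun j : Jet2 I' => V (e.symm (πz j)))
      ((fderiv ℝ (fun y => V (e.symm y)) (spacePart j.1)).comp πz) j :=
    HasFDerivAt.comp (g := fun y => V (e.symm y)) j hV.hasFDerivAt πz.hasFDerivAt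
  have h : HasFDerivAt (schrodinger g V e) _ j :=
    (((HasFDerivAt.fun_sum (u := Finset.univ) fun i _ =>
      HasFDerivAt.fun_sum (u := Finset.univ) fun k _ =>
        (cG i k).mul ((πq (some i) (some k)).hasFDerivAt)).sub
      (HasFDerivAt.fun_sum (u := Finset.univ) fun i _ =>
        (cΓ i).mul ((πp (some i)).hasFDerivAt))).sub ((πp none).hasFDerivAt)).sub
      (cV.mul πu.hasFDerivAt)
  rw [prolongApply, h.fderiv]
  simp only [sub_apply, sum_apply, add_apply, smul_apply, smul_eq_mul, πz, πu, πp, πq,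
    ContinuousLinearMap.comp_apply, ContinuousLinearMap.coe_fst', ContinuousLinearMap.coe_snd',
    ContinuousLinearMap.proj_apply, spacePartL_apply]
  congr 1
  · congr 1
    congr 1
    · exact Finset.sum_congr rfl fun i _ => Finset.sum_congr rfl fun k _ => by ring
    · exact Finset.sum_congr rfl fun i _ => by ring
  · ring

/-- The part of the prolonged symmetry condition that contains no second derivatives of `u`, once
`u_t` has been eliminated. -/
def lowerOrderPart (ξ : Jet0 (Option (Fin n)) → Option (Fin n) → ℝ)
    (η : Jet0 (Option (Fin n)) → ℝ) (j : Jet1 (Option (Fin n))) : ℝ :=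
  let y := spacePart j.1
  let w : Jet0 (Option (Fin n)) := (j.1, j.2.1)
  (∑ i, ∑ k, g.inv e y i k * (hess η (some i) (some k) j
      - ∑ m, j.2.2 (some m) * hess (fun w => ξ w (some m)) (some i) (some k) j))
    - (∑ i, (fderiv ℝ (fun y => g.contractedChristoffel e y i) y (spacePart (ξ w)) * j.2.2 (some i)
      + g.contractedChristoffel e y i * (totalDeriv0 η (some i) j
        - ∑ m, j.2.2 (some m) * totalDeriv0 (fun w => ξ w (some m)) (some i) j)))
    - fderiv ℝ η w (Pi.single none 1, 0)
    + (∑ m, j.2.2 (some m) * fderiv ℝ (fun w => ξ w (some m)) w (Pi.single none 1, 0))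
    - (fderiv ℝ (fun y => V (e.symm y)) y (spacePart (ξ w)) * j.2.1 + V (e.symm y) * η w)
    - (fderiv ℝ (fun w => ξ w none) w (Pi.single none 1, 0) - derivU η w
        + ∑ m, j.2.2 (some m) * derivU (fun w => ξ w (some m)) w)
      * ((∑ i, g.contractedChristoffel e y i * j.2.2 (some i)) + V (e.symm y) * j.2.1)

lemma totalDeriv0_eq {ι : Type*} [Fintype ι] [DecidableEq ι] (f : Jet0 ι → ℝ) (i : ι)
    (j : Jet1 ι) :
    totalDeriv0 f i j = fderiv ℝ f (j.1, j.2.1) (Pi.single i 1, 0)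
      + j.2.2 i * derivU f (j.1, j.2.1) := by
  have : ((Pi.single i 1 : ι → ℝ), j.2.2 i) = (Pi.single i 1, 0) + j.2.2 i • (0, (1 : ℝ)) := by
    simp
  rw [totalDeriv0, this, map_add, map_smul, derivU, smul_eq_mul]

/-- The hypotheses on ξ^t remove every u_ti. Eliminating u_t then brings in further second
derivatives: u_t has the coefficient ξ^t_t - η_u + u_m ∂_u ξ^m, and the part -η_u + u_m ∂_u ξ^m
cancels against the same multiple of g^ik u_ik in g^ik η_[ik]. Only ξ^t_t g^ik and the Lie
derivative of g^ik, taken with total derivatives, remain in front of u_ik. -/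
lemma prolongApply_schrodinger_of_eq_zero {ξ : Jet0 (Option (Fin n)) → Option (Fin n) → ℝ}
    {η : Jet0 (Option (Fin n)) → ℝ} (j : Jet2 (Option (Fin n)))
    (hG : ∀ i k, DifferentiableAt ℝ (fun y => g.inv e y i k) (spacePart j.1))
    (hΓ : ∀ i, DifferentiableAt ℝ (fun y => g.contractedChristoffel e y i) (spacePart j.1))
    (hV : DifferentiableAt ℝ (fun y => V (e.symm y)) (spacePart j.1))
    (hξ : ∀ k, ContDiffAt ℝ 2 (fun w => ξ w k) j.base) (hη : ContDiffAt ℝ 2 η j.base)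
    (hs : ∀ i l, j.2.2.2 i l = j.2.2.2 l i)
    (hGs : ∀ i k, g.inv e (spacePart j.1) i k = g.inv e (spacePart j.1) k i)
    (hj : schrodinger g V e j = 0)
    (ht : ∀ i, fderiv ℝ (fun w => ξ w none) j.base (Pi.single (some i) 1, 0) = 0)
    (htu : derivU (fun w => ξ w none) j.base = 0)
    (hth : ∀ i k, hess (fun w => ξ w none) (some i) (some k) j.toJet1 = 0) :
    prolongApply ξ η (schrodinger g V e) j =
      (∑ i, ∑ k, j.2.2.2 (some i) (some k) *
        (fderiv ℝ (fun y => g.inv e y i k) (spacePart j.1) (spacePart (ξ j.base))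
          + fderiv ℝ (fun w => ξ w none) j.base (Pi.single none 1, 0) * g.inv e (spacePart j.1) i k
          - 2 * ∑ l, g.inv e (spacePart j.1) i l *
            totalDeriv0 (fun w => ξ w (some k)) (some l) j.toJet1))
      + lowerOrderPart g V e ξ η j.toJet1 := by
  have hD : ∀ i, totalDeriv0 (fun w => ξ w none) (some i) j.toJet1 = 0 := fun i => by
    rw [totalDeriv0_eq]
    have h1 := ht i
    have h2 := htu
    simp only [Jet2.base] at h1 h2
    simp [Jet2.toJet1, h1, h2]
  have hpt : j.2.2.1 none = (∑ i, ∑ k, g.inv e (spacePart j.1) i k * j.2.2.2 (some i) (some k))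
      - ((∑ i, g.contractedChristoffel e (spacePart j.1) i * j.2.2.1 (some i))
        + V (e.symm (spacePart j.1)) * j.2.1) := by
    simp only [schrodinger] at hj; linarith
  rw [prolongApply_schrodinger g V e j hG hΓ hV]
  have h2 : ∀ i k : Fin n, prolong2 ξ η (some i) (some k) j
      = (hess η (some i) (some k) j.toJet1
        - ∑ m, j.2.2.1 (some m) * hess (fun w => ξ w (some m)) (some i) (some k) j.toJet1)
      + j.2.2.2 (some i) (some k) * (derivU η j.base
        - ∑ m, j.2.2.1 (some m) * derivU (fun w => ξ w (some m)) j.base)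
      - ((∑ m, j.2.2.2 (some k) (some m) * totalDeriv0 (fun w => ξ w (some m)) (some i) j.toJet1)
      + ∑ m, j.2.2.2 (some i) (some m) * totalDeriv0 (fun w => ξ w (some m)) (some k) j.toJet1) := by
    intro i k
    rw [prolong2_eq hξ hη, Fintype.sum_option, hth, htu, hD, hD, hs (some k) (some i)]
    simp only [mul_add, Finset.sum_add_distrib, mul_sub, Finset.mul_sum]
    have : ∀ m, j.2.2.1 (some m) * (j.2.2.2 (some i) (some k) *
        derivU (fun w => ξ w (some m)) j.base) = j.2.2.2 (some i) (some k) *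
        (j.2.2.1 (some m) * derivU (fun w => ξ w (some m)) j.base) := fun m => by ring
    simp only [this]
    ring
  have h1t : prolong1 ξ η none j.toJet1 = fderiv ℝ η j.base (Pi.single none 1, 0)
      - (∑ m, j.2.2.1 (some m) *
        fderiv ℝ (fun w => ξ w (some m)) j.base (Pi.single none 1, 0))
      - j.2.2.1 none * (fderiv ℝ (fun w => ξ w none) j.base (Pi.single none 1, 0)
        - derivU η j.base + ∑ m, j.2.2.1 (some m) * derivU (fun w => ξ w (some m)) j.base) := by
    rw [prolong1, Fintype.sum_option, totalDeriv0_eq, totalDeriv0_eq]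
    simp only [totalDeriv0_eq (fun w => ξ w (some _))]
    have h3 := htu
    simp only [Jet2.base] at h3
    simp only [Jet2.toJet1, Jet2.base, h3, mul_add, Finset.sum_add_distrib, Finset.mul_sum]
    have : ∀ m, j.2.2.1 (some m) * (j.2.2.1 none *
        derivU (fun w => ξ w (some m)) (j.1, j.2.1)) = j.2.2.1 none *
        (j.2.2.1 (some m) * derivU (fun w => ξ w (some m)) (j.1, j.2.1)) := fun m => by ring
    simp only [this]
    ring
  have h1 : ∀ i : Fin n, prolong1 ξ η (some i) j.toJet1 = totalDeriv0 η (some i) j.toJet1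
      - ∑ m, j.2.2.1 (some m) * totalDeriv0 (fun w => ξ w (some m)) (some i) j.toJet1 := by
    intro i
    rw [prolong1, Fintype.sum_option, hD]
    simp [Jet2.toJet1]
  -- The two terms of η_[ik] with D_i ξ^m and D_k ξ^m have the same contraction with g^ik after
  -- renaming indices; this is the factor 2 in the claim.
  have hswap : (∑ i, ∑ k, g.inv e (spacePart j.1) i k *
        ∑ m, j.2.2.2 (some k) (some m) * totalDeriv0 (fun w => ξ w (some m)) (some i) j.toJet1)
      = ∑ i, ∑ k, j.2.2.2 (some i) (some k) * ∑ l, g.inv e (spacePart j.1) i l *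
            totalDeriv0 (fun w => ξ w (some k)) (some l) j.toJet1 := by
    simp only [Finset.mul_sum]
    rw [Finset.sum_comm]
    refine Finset.sum_congr rfl fun i _ => ?_
    rw [Finset.sum_comm]
    refine Finset.sum_congr rfl fun k _ => Finset.sum_congr rfl fun l _ => ?_
    rw [hGs]; ring
  have hswap' : (∑ i, ∑ k, g.inv e (spacePart j.1) i k *
        ∑ m, j.2.2.2 (some i) (some m) * totalDeriv0 (fun w => ξ w (some m)) (some k) j.toJet1)
      = ∑ i, ∑ k, j.2.2.2 (some i) (some k) * ∑ l, g.inv e (spacePart j.1) i l *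
            totalDeriv0 (fun w => ξ w (some k)) (some l) j.toJet1 := by
    simp only [Finset.mul_sum]
    refine Finset.sum_congr rfl fun i _ => ?_
    rw [Finset.sum_comm]
    refine Finset.sum_congr rfl fun k _ => Finset.sum_congr rfl fun l _ => ?_
    ring
  simp only [h1, h2, h1t]
  have hsum : (∑ i, ∑ k,
        (fderiv ℝ (fun y => g.inv e y i k) (spacePart j.1) (spacePart (ξ j.base))
          * j.2.2.2 (some i) (some k)
        + g.inv e (spacePart j.1) i k * ((hess η (some i) (some k) j.toJet1
        - ∑ m, j.2.2.1 (some m) * hess (fun w => ξ w (some m)) (some i) (some k) j.toJet1)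
      + j.2.2.2 (some i) (some k) * (derivU η j.base
        - ∑ m, j.2.2.1 (some m) * derivU (fun w => ξ w (some m)) j.base)
      - ((∑ m, j.2.2.2 (some k) (some m) * totalDeriv0 (fun w => ξ w (some m)) (some i) j.toJet1)
      + ∑ m, j.2.2.2 (some i) (some m)
        * totalDeriv0 (fun w => ξ w (some m)) (some k) j.toJet1))))
      = (∑ i, ∑ k, j.2.2.2 (some i) (some k) *
        fderiv ℝ (fun y => g.inv e y i k) (spacePart j.1) (spacePart (ξ j.base)))
      + (∑ i, ∑ k, g.inv e (spacePart j.1) i k * (hess η (some i) (some k) j.toJet1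
        - ∑ m, j.2.2.1 (some m) * hess (fun w => ξ w (some m)) (some i) (some k) j.toJet1))
      + (derivU η j.base - ∑ m, j.2.2.1 (some m) * derivU (fun w => ξ w (some m)) j.base)
        * (∑ i, ∑ k, g.inv e (spacePart j.1) i k * j.2.2.2 (some i) (some k))
      - 2 * ∑ i, ∑ k, j.2.2.2 (some i) (some k) * ∑ l, g.inv e (spacePart j.1) i l *
            totalDeriv0 (fun w => ξ w (some k)) (some l) j.toJet1 := by
    rw [two_mul, ← sub_sub]
    nth_rewrite 1 [← hswap]
    rw [← hswap', Finset.mul_sum]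
    simp only [Finset.mul_sum _ _ (derivU η j.base - _)]
    simp only [← Finset.sum_add_distrib, ← Finset.sum_sub_distrib]
    refine Finset.sum_congr rfl fun i _ => Finset.sum_congr rfl fun k _ => ?_
    simp only [Finset.sum_add_distrib]
    ring
  rw [hsum]
  have hsum2 : (∑ i, ∑ k, j.2.2.2 (some i) (some k) *
        (fderiv ℝ (fun y => g.inv e y i k) (spacePart j.1) (spacePart (ξ j.base))
          + fderiv ℝ (fun w => ξ w none) j.base (Pi.single none 1, 0) * g.inv e (spacePart j.1) i k
          - 2 * ∑ l, g.inv e (spacePart j.1) i l *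
            totalDeriv0 (fun w => ξ w (some k)) (some l) j.toJet1))
      = (∑ i, ∑ k, j.2.2.2 (some i) (some k) *
        fderiv ℝ (fun y => g.inv e y i k) (spacePart j.1) (spacePart (ξ j.base)))
      + fderiv ℝ (fun w => ξ w none) j.base (Pi.single none 1, 0) *
        (∑ i, ∑ k, g.inv e (spacePart j.1) i k * j.2.2.2 (some i) (some k))
      - 2 * ∑ i, ∑ k, j.2.2.2 (some i) (some k) * ∑ l, g.inv e (spacePart j.1) i l *
            totalDeriv0 (fun w => ξ w (some k)) (some l) j.toJet1 := by
    simp only [two_mul,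
      Finset.mul_sum _ _ (fderiv ℝ (fun w => ξ w none) j.base (Pi.single none 1, 0))]
    simp only [← Finset.sum_add_distrib, ← Finset.sum_sub_distrib]
    refine Finset.sum_congr rfl fun i _ => Finset.sum_congr rfl fun k _ => ?_
    simp only [Finset.sum_add_distrib]
    ring
  rw [hsum2, lowerOrderPart, hpt]
  simp only [Jet2.toJet1, Jet2.base]
  ring

end SchrodingerJets

/-! ### Vectors and functions in the charts of the atlas -/

section ChartCalculus

lemma two_le_infty : (2 : WithTop ℕ∞) ≤ ∞ := by
  exact WithTop.coe_le_coe.mpr (le_top : (2 : ℕ∞) ≤ ⊤)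

variable {n : ℕ} {M : Type*} [TopologicalSpace M] [ChartedSpace (E n) M]

lemma ContDiffOn.pd {f : E n → ℝ} {U : Set (E n)} (hf : ContDiffOn ℝ ∞ f U) (hU : IsOpen U)
    (k : Fin n) : ContDiffOn ℝ ∞ (pd k f) U :=
  (hf.fderiv_of_isOpen hU (by simp)).clm_apply contDiffOn_const

lemma differentiableAt_of_contDiffOn {F : Type*} [NormedAddCommGroup F] [NormedSpace ℝ F]
    {f : F → ℝ} {U : Set F} (hf : ContDiffOn ℝ ∞ f U) (hU : IsOpen U) {y : F} (hy : y ∈ U) :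
    DifferentiableAt ℝ f y :=
  (hf.contDiffAt (hU.mem_nhds hy)).differentiableAt (by simp)

lemma euclidean_eq_sum (v : E n) : v = ∑ i, v i • EuclideanSpace.single i (1 : ℝ) := by
  ext j
  simp [Finset.sum_apply, Pi.single_apply]

lemma fderiv_eq_sum_pd (f : E n → ℝ) (y v : E n) : fderiv ℝ f y v = ∑ i, v i * pd i f y := by
  conv_lhs => rw [euclidean_eq_sum v]
  simp [map_sum, pd]

lemma pd_congr {f h : E n → ℝ} {U : Set (E n)} (hU : IsOpen U) (hfh : EqOn f h U) {y : E n}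
    (hy : y ∈ U) (k : Fin n) : pd k f y = pd k h y := by
  rw [pd, pd, (hfh.eventuallyEq_of_mem (hU.mem_nhds hy)).fderiv_eq]

lemma pd_comm {f : E n → ℝ} {U : Set (E n)} (hf : ContDiffOn ℝ ∞ f U) (hU : IsOpen U) {y : E n}
    (hy : y ∈ U) (i k : Fin n) : pd i (pd k f) y = pd k (pd i f) y := by
  have hc : ContDiffAt ℝ ∞ f y := hf.contDiffAt (hU.mem_nhds hy)
  have hd : DifferentiableAt ℝ (fderiv ℝ f) y :=
    differentiableAt_fderiv_of_contDiffAt (hc.of_le two_le_infty)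
  have h : ∀ a b : Fin n, pd a (pd b f) y = fderiv ℝ (fderiv ℝ f) y
      (EuclideanSpace.single a 1) (EuclideanSpace.single b 1) := fun a b => by
    have := hd.hasFDerivAt.clm_apply
      (hasFDerivAt_const (EuclideanSpace.single b (1 : ℝ) : E n) y)
    change fderiv ℝ (fun y => fderiv ℝ f y (EuclideanSpace.single b 1)) y _ = _
    rw [this.fderiv]
    simp
  rw [h, h]
  exact (hc.isSymmSndFDerivAt (by simpa using two_le_infty)) _ _

section Atlas

variable [IsManifold (𝓡 n) ∞ M] {e : OpenPartialHomeomorph M (E n)}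

lemma mdifferentiable_of_atlas (he : e ∈ atlas (E n) M) :
    e.MDifferentiable (𝓡 n) (𝓡 n) :=
  haveI : IsManifold (𝓡 n) 1 M := IsManifold.of_le (n := ∞) (by simp)
  mdifferentiable_of_mem_atlas he

lemma mfderiv_comp_coordVec (he : e ∈ atlas (E n) M) {y : E n} (hy : y ∈ e.target) (w : E n) :
    (mfderiv (𝓡 n) (𝓡 n) e (e.symm y)) (mfderiv (𝓡 n) (𝓡 n) e.symm y w) = w := by
  have := (mdifferentiable_of_atlas he).comp_symm_deriv hy
  exact congrArg (fun L => L w) this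

/-- Both derivatives are read as endomorphisms of the finite-dimensional space `E n`, where a
one-sided inverse is two-sided. -/
lemma coordVec_comp_mfderiv (he : e ∈ atlas (E n) M) {y : E n} (hy : y ∈ e.target)
    (v : TangentSpace (𝓡 n) (e.symm y)) :
    mfderiv (𝓡 n) (𝓡 n) e.symm y (mfderiv (𝓡 n) (𝓡 n) e (e.symm y) v) = v := by
  let A : E n →ₗ[ℝ] E n := (mfderiv (𝓡 n) (𝓡 n) e (e.symm y)).toLinearMap
  let B : E n →ₗ[ℝ] E n := (mfderiv (𝓡 n) (𝓡 n) e.symm y).toLinearMap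
  have h : A * B = 1 := LinearMap.ext fun w => mfderiv_comp_coordVec he hy w
  have h' : B * A = 1 := mul_eq_one_comm.mp h
  exact congrArg (fun L => L v) h'

lemma vec_eq_sum (he : e ∈ atlas (E n) M) {y : E n} (hy : y ∈ e.target)
    (v : TangentSpace (𝓡 n) (e.symm y)) :
    v = ∑ i, vecComp e (e.symm y) v i • coordVec e y i := by
  let A : E n →ₗ[ℝ] E n := (mfderiv (𝓡 n) (𝓡 n) e (e.symm y)).toLinearMap
  let B : E n →ₗ[ℝ] E n := (mfderiv (𝓡 n) (𝓡 n) e.symm y).toLinearMap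
  have h := congrArg B (euclidean_eq_sum (A v))
  simp only [map_sum, map_smul] at h
  exact (coordVec_comp_mfderiv he hy v).symm.trans h

lemma vecComp_coordVec (he : e ∈ atlas (E n) M) {y : E n} (hy : y ∈ e.target) (i k : Fin n) :
    vecComp e (e.symm y) (coordVec e y i) k = if k = i then 1 else 0 := by
  have := mfderiv_comp_coordVec he hy (EuclideanSpace.single i 1)
  refine (congrArg (fun w : E n => w k) this).trans ?_
  simp

lemma vec_ext (he : e ∈ atlas (E n) M) {y : E n} (hy : y ∈ e.target)
    {v w : TangentSpace (𝓡 n) (e.symm y)}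
    (h : ∀ i, vecComp e (e.symm y) v i = vecComp e (e.symm y) w i) : v = w := by
  rw [vec_eq_sum he hy v, vec_eq_sum he hy w]
  simp only [h]

omit [IsManifold (𝓡 n) ∞ M] in
lemma vecComp_smul (x : M) (c : ℝ) (v : TangentSpace (𝓡 n) x) (i : Fin n) :
    vecComp e x (c • v) i = c * vecComp e x v i := by
  rw [vecComp, map_smul]; rfl

omit [IsManifold (𝓡 n) ∞ M] in
lemma exists_mem_chart_target (x : M) : ∃ e ∈ atlas (E n) M, ∃ y ∈ e.target, e.symm y = x :=
  ⟨chartAt (E n) x, chart_mem_atlas _ x, chartAt (E n) x x, mem_chart_target _ x,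
    (chartAt (E n) x).left_inv (mem_chart_source _ x)⟩

lemma contDiffOn_comp_symm (he : e ∈ atlas (E n) M) {f : M → ℝ}
    (hf : ContMDiff (𝓡 n) 𝓘(ℝ, ℝ) ∞ f) : ContDiffOn ℝ ∞ (fun y => f (e.symm y)) e.target :=
  contMDiffOn_iff_contDiffOn.mp <| hf.comp_contMDiffOn <|
    contMDiffOn_symm_of_mem_maximalAtlas (IsManifold.subset_maximalAtlas he)

lemma contMDiff_of_contDiffOn {f : M → ℝ}
    (hf : ∀ e ∈ atlas (E n) M, ContDiffOn ℝ ∞ (fun y => f (e.symm y)) e.target) :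
    ContMDiff (𝓡 n) 𝓘(ℝ, ℝ) ∞ f := by
  intro x
  have h1 := contMDiffAt_of_mem_maximalAtlas (I := 𝓡 n) (n := ∞) (e := chartAt (E n) x)
    (IsManifold.subset_maximalAtlas (chart_mem_atlas _ x)) (mem_chart_source _ x)
  have h2 : ContMDiffAt (𝓡 n) 𝓘(ℝ, ℝ) ∞ (fun y => f ((chartAt (E n) x).symm y))
      (chartAt (E n) x x) := contMDiffAt_iff_contDiffAt.mpr <|
    (hf _ (chart_mem_atlas _ x)).contDiffAt
      ((chartAt (E n) x).open_target.mem_nhds (mem_chart_target _ x))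
  refine (h2.comp x h1).congr_of_eventuallyEq ?_
  filter_upwards [(chartAt (E n) x).open_source.mem_nhds (mem_chart_source _ x)] with z hz
  simp [(chartAt (E n) x).left_inv hz]

lemma pd_comp_symm (he : e ∈ atlas (E n) M) {y : E n} (hy : y ∈ e.target) {f : M → ℝ}
    (hf : MDifferentiableAt (𝓡 n) 𝓘(ℝ, ℝ) f (e.symm y)) (i : Fin n) :
    pd i (fun y => f (e.symm y)) y = dirDeriv f (e.symm y) (coordVec e y i) := by
  have h := mfderiv_comp y hf ((mdifferentiable_of_atlas he).mdifferentiableAt_symm hy)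
  rw [mfderiv_eq_fderiv] at h
  exact congrArg (fun L => L (EuclideanSpace.single i (1 : ℝ))) h

lemma dirDeriv_eq_sum (he : e ∈ atlas (E n) M) {y : E n} (hy : y ∈ e.target) {f : M → ℝ}
    (hf : MDifferentiableAt (𝓡 n) 𝓘(ℝ, ℝ) f (e.symm y)) (v : TangentSpace (𝓡 n) (e.symm y)) :
    dirDeriv f (e.symm y) v
      = ∑ i, vecComp e (e.symm y) v i * pd i (fun y => f (e.symm y)) y := by
  simp only [pd_comp_symm he hy hf]
  conv_lhs => rw [vec_eq_sum he hy v]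
  rw [dirDeriv, map_sum]
  refine Finset.sum_congr rfl fun i _ => ?_
  rw [map_smul]
  rfl

end Atlas

/-! ### The inverse metric and the Christoffel symbols are smooth -/

namespace Metric

variable (g : Metric n M) (e : OpenPartialHomeomorph M (E n))

lemma comp_apply (y : E n) (i j : Fin n) :
    g.comp e y i j = g.val (e.symm y) (coordVec e y i) (coordVec e y j) := rfl

lemma comp_symm (y : E n) (i j : Fin n) : g.comp e y i j = g.comp e y j i := g.symm _ _ _

lemma comp_transpose (y : E n) : (g.comp e y).transpose = g.comp e y :=
  Matrix.ext fun _ _ => g.comp_symm e y _ _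

lemma inv_transpose (y : E n) : (g.inv e y).transpose = g.inv e y := by
  rw [inv, Matrix.transpose_nonsing_inv, comp_transpose]

lemma inv_symm (y : E n) (i j : Fin n) : g.inv e y i j = g.inv e y j i := by
  conv_lhs => rw [← inv_transpose]
  rfl

variable {e}

lemma contDiffOn_comp (he : e ∈ atlas (E n) M) (i j : Fin n) :
    ContDiffOn ℝ ∞ (fun y => g.comp e y i j) e.target := g.smooth e he i j

variable [IsManifold (𝓡 n) ∞ M]

lemma val_coordVec (he : e ∈ atlas (E n) M) {y : E n} (hy : y ∈ e.target)
    (v : TangentSpace (𝓡 n) (e.symm y)) (j : Fin n) :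
    g.val (e.symm y) v (coordVec e y j) = ∑ k, g.comp e y k j * vecComp e (e.symm y) v k := by
  conv_lhs => rw [vec_eq_sum he hy v]
  rw [map_sum, sum_apply]
  refine Finset.sum_congr rfl fun i _ => ?_
  rw [map_smul, smul_apply, smul_eq_mul, mul_comm, comp_apply]

/-- A vector in the kernel of the matrix g_ij would be the component vector of a tangent vector
orthogonal to everything, contrary to nondegeneracy. -/
lemma isUnit_det_comp (he : e ∈ atlas (E n) M) {y : E n} (hy : y ∈ e.target) :
    IsUnit (g.comp e y).det := by
  rw [isUnit_iff_ne_zero]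
  intro h
  obtain ⟨c, hc, hc'⟩ := Matrix.exists_mulVec_eq_zero_iff.mpr h
  refine hc (funext fun i => ?_)
  set v : TangentSpace (𝓡 n) (e.symm y) := ∑ i, c i • coordVec e y i with hv
  have hvc : ∀ k, vecComp e (e.symm y) v k = c k := fun k => by
    have h0 : ∀ i, vecComp e (e.symm y) (c i • coordVec e y i) k = if k = i then c i else 0 :=
      fun i => by rw [vecComp_smul, vecComp_coordVec he hy]; split_ifs <;> simp
    have h1 : vecComp e (e.symm y) v k = ∑ i, vecComp e (e.symm y) (c i • coordVec e y i) k := by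
      exact map_sum ((EuclideanSpace.proj k : E n →L[ℝ] ℝ).comp
        (mfderiv (𝓡 n) (𝓡 n) e (e.symm y) : E n →L[ℝ] E n)) _ _
    rw [h1]; simp [h0]
  have hv0 : v = 0 := by
    refine g.nondegenerate _ v fun w => ?_
    rw [vec_eq_sum he hy w, map_sum]
    refine Finset.sum_eq_zero fun j _ => ?_
    rw [map_smul, val_coordVec g he hy]
    have := congrFun hc' j
    simp only [Matrix.mulVec, dotProduct, Pi.zero_apply] at this
    simp only [hvc, g.comp_symm e y _ j, this, smul_zero]
  rw [← hvc i, hv0, vecComp, map_zero]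
  rfl

lemma comp_mul_inv (he : e ∈ atlas (E n) M) {y : E n} (hy : y ∈ e.target) :
    g.comp e y * g.inv e y = 1 := Matrix.mul_nonsing_inv _ (g.isUnit_det_comp he hy)

lemma inv_mul_comp (he : e ∈ atlas (E n) M) {y : E n} (hy : y ∈ e.target) :
    g.inv e y * g.comp e y = 1 := Matrix.nonsing_inv_mul _ (g.isUnit_det_comp he hy)

/-- Cramer's rule: the entries of the inverse are polynomials in the g_ij divided by the
determinant, which does not vanish. -/
lemma contDiffOn_inv (he : e ∈ atlas (E n) M) (i j : Fin n) :
    ContDiffOn ℝ ∞ (fun y => g.inv e y i j) e.target := by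
  have hdet : ∀ A : E n → Matrix (Fin n) (Fin n) ℝ,
      (∀ i j, ContDiffOn ℝ ∞ (fun y => A y i j) e.target) →
      ContDiffOn ℝ ∞ (fun y => (A y).det) e.target := by
    intro A hA
    simp only [Matrix.det_apply]
    refine ContDiffOn.sum fun σ _ => ?_
    exact (contDiffOn_prod fun i _ => hA _ _).const_smul _
  have h : ∀ y, g.inv e y i j = (g.comp e y).det⁻¹ * (g.comp e y).adjugate i j := fun y => by
    rw [inv, Matrix.inv_def, Matrix.smul_apply, smul_eq_mul, Ring.inverse_eq_inv']
  simp only [h, Matrix.adjugate_apply]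
  refine ((hdet _ fun i j => g.contDiffOn_comp he i j).inv fun y hy =>
    (g.isUnit_det_comp he hy).ne_zero).mul (hdet _ fun k l => ?_)
  by_cases hk : k = j
  · subst hk
    simp only [Matrix.updateRow_self]
    exact contDiffOn_const
  · simp only [Matrix.updateRow_ne hk]
    exact g.contDiffOn_comp he k l

lemma contDiffOn_christoffel (he : e ∈ atlas (E n) M) (i j k : Fin n) :
    ContDiffOn ℝ ∞ (fun y => g.christoffel e y i j k) e.target := by
  unfold christoffel
  refine ContDiffOn.sum fun l _ => ?_
  have hp := fun a b c => ContDiffOn.pd (g.contDiffOn_comp he a b) e.open_target c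
  exact ((contDiffOn_const.mul (g.contDiffOn_inv he i l))).mul
    (((hp l k j).add (hp l j k)).sub (hp j k l))

lemma contDiffOn_contractedChristoffel (he : e ∈ atlas (E n) M) (i : Fin n) :
    ContDiffOn ℝ ∞ (fun y => g.contractedChristoffel e y i) e.target := by
  unfold contractedChristoffel
  exact ContDiffOn.sum fun j _ => ContDiffOn.sum fun k _ =>
    (g.contDiffOn_inv he j k).mul (g.contDiffOn_christoffel he i j k)

end Metric

end ChartCalculus

/-! ### Rules for partial derivatives -/

section PartialDerivatives

variable {n : ℕ} {f h : E n → ℝ} {y : E n}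

lemma pd_add (hf : DifferentiableAt ℝ f y) (hh : DifferentiableAt ℝ h y) (k : Fin n) :
    pd k (fun y => f y + h y) y = pd k f y + pd k h y := by
  rw [pd, fderiv_fun_add hf hh]; rfl

lemma pd_sub (hf : DifferentiableAt ℝ f y) (hh : DifferentiableAt ℝ h y) (k : Fin n) :
    pd k (fun y => f y - h y) y = pd k f y - pd k h y := by
  rw [pd, fderiv_fun_sub hf hh]; rfl

lemma pd_mul (hf : DifferentiableAt ℝ f y) (hh : DifferentiableAt ℝ h y) (k : Fin n) :
    pd k (fun y => f y * h y) y = pd k f y * h y + f y * pd k h y := by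
  rw [pd, fderiv_fun_mul hf hh]
  simp only [add_apply, smul_apply, smul_eq_mul, pd]
  ring

lemma pd_const_mul (c : ℝ) (hf : DifferentiableAt ℝ f y) (k : Fin n) :
    pd k (fun y => c * f y) y = c * pd k f y := by
  rw [pd, fderiv_const_mul hf]; rfl

lemma pd_sum {ι : Type*} {s : Finset ι} {F : ι → E n → ℝ}
    (hF : ∀ i ∈ s, DifferentiableAt ℝ (F i) y) (k : Fin n) :
    pd k (fun y => ∑ i ∈ s, F i y) y = ∑ i ∈ s, pd k (F i) y := by
  rw [pd, fderiv_fun_sum hF, sum_apply]; rfl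

end PartialDerivatives

/-! ### Homotheties, the Levi-Civita connection and the Laplacian -/

namespace Metric

variable {n : ℕ} {M : Type*} [TopologicalSpace M] [ChartedSpace (E n) M]
variable (g : Metric n M) (e : OpenPartialHomeomorph M (E n))

/-- The Lie derivative of the metric along the vector field with components `ξ` in a chart. -/
def lieForm (ξ : Fin n → E n → ℝ) (y : E n) (i j : Fin n) : ℝ :=
  ∑ k, (ξ k y * pd k (fun y => g.comp e y i j) y
    + g.comp e y k j * pd i (ξ k) y + g.comp e y i k * pd j (ξ k) y)

/-- The Christoffel symbols of the first kind. -/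
def lowerChristoffel (l j k : Fin n) (y : E n) : ℝ :=
  (1 / 2) * (pd j (fun y => g.comp e y l k) y + pd k (fun y => g.comp e y l j) y
      - pd l (fun y => g.comp e y j k) y)

/-- `∑ j k, g^jk Γ_{l,jk}`. -/
def lowerContracted (l : Fin n) (y : E n) : ℝ :=
  ∑ j, ∑ k, g.inv e y j k * g.lowerChristoffel e l j k y

lemma lowerChristoffel_comm (l j k : Fin n) (y : E n) :
    g.lowerChristoffel e l j k y = g.lowerChristoffel e l k j y := by
  simp only [lowerChristoffel, fun y => g.comp_symm e y j k]
  ring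

/-- Working with the lowered symbols Γ_{l,jk} keeps the inverse metric out of the derivatives until
the index is raised at the very end. -/
lemma contractedChristoffel_eq (y : E n) (i : Fin n) :
    g.contractedChristoffel e y i = ∑ l, g.inv e y i l * g.lowerContracted e l y := by
  simp only [contractedChristoffel, christoffel, lowerContracted, lowerChristoffel,
    Finset.mul_sum]
  symm
  rw [Finset.sum_comm]
  refine Finset.sum_congr rfl fun j _ => ?_
  rw [Finset.sum_comm]
  exact Finset.sum_congr rfl fun k _ => Finset.sum_congr rfl fun l _ => by ring

variable {e}

lemma contDiffOn_lowerChristoffel (he : e ∈ atlas (E n) M) (l j k : Fin n) :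
    ContDiffOn ℝ ∞ (g.lowerChristoffel e l j k) e.target := by
  unfold lowerChristoffel
  have hp := fun a b c => ContDiffOn.pd (g.contDiffOn_comp he a b) e.open_target c
  exact contDiffOn_const.mul (((hp l k j).add (hp l j k)).sub (hp j k l))

variable [IsManifold (𝓡 n) ∞ M]

lemma contDiffOn_lowerContracted (he : e ∈ atlas (E n) M) (l : Fin n) :
    ContDiffOn ℝ ∞ (g.lowerContracted e l) e.target := by
  unfold lowerContracted
  exact ContDiffOn.sum fun j _ => ContDiffOn.sum fun k _ =>
    (g.contDiffOn_inv he j k).mul (g.contDiffOn_lowerChristoffel he l j k)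

/-- This is the derivative of the identity g⁻¹ g = 1 along v. -/
lemma fderiv_inv_mul_comp (he : e ∈ atlas (E n) M) {y : E n} (hy : y ∈ e.target) (v : E n) :
    (Matrix.of fun i k => fderiv ℝ (fun y => g.inv e y i k) y v) * g.comp e y
      + g.inv e y * (Matrix.of fun i k => fderiv ℝ (fun y => g.comp e y i k) y v) = 0 := by
  have hG := fun i k => differentiableAt_of_contDiffOn (g.contDiffOn_inv he i k) e.open_target hy
  have hg := fun i k => differentiableAt_of_contDiffOn (g.contDiffOn_comp he i k) e.open_target hy
  ext i j
  have h1 : (fun y => ∑ k, g.inv e y i k * g.comp e y k j)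
      =ᶠ[𝓝 y] fun _ => (1 : Matrix (Fin n) (Fin n) ℝ) i j := by
    filter_upwards [e.open_target.mem_nhds hy] with z hz
    rw [← g.inv_mul_comp he hz, Matrix.mul_apply]
  have h2 := h1.fderiv_eq (𝕜 := ℝ)
  rw [fderiv_fun_sum fun k _ => (hG i k).fun_mul (hg k j), fderiv_fun_const] at h2
  have h3 := congrArg (fun L => L v) h2
  simp only [sum_apply, fderiv_fun_mul (hG i _) (hg _ j), add_apply, smul_apply, smul_eq_mul,
    Pi.zero_apply, zero_apply, Finset.sum_add_distrib] at h3
  simp only [Matrix.add_apply, Matrix.mul_apply, Matrix.of_apply, Matrix.zero_apply]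
  rw [← h3, add_comm]
  congr 1
  exact Finset.sum_congr rfl fun k _ => mul_comm _ _

/-- The Jacobian of the components of a vector field. -/
def jacobian (ξ : Fin n → E n → ℝ) (y : E n) : Matrix (Fin n) (Fin n) ℝ :=
  Matrix.of fun i k => pd i (ξ k) y

/-- The vector with components `ξ`. -/
def vecOf (ξ : Fin n → E n → ℝ) (y : E n) : E n := WithLp.toLp 2 fun i => ξ i y

omit [TopologicalSpace M] [ChartedSpace (E n) M] [IsManifold (𝓡 n) ∞ M] in
lemma fderiv_vecOf (f : E n → ℝ) (ξ : Fin n → E n → ℝ) (y : E n) :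
    fderiv ℝ f y (vecOf ξ y) = ∑ m, ξ m y * pd m f y := fderiv_eq_sum_pd _ _ _

/-- The equation `L_ξ g = c g` in terms of the inverse metric. -/
lemma lieForm_eq_iff (he : e ∈ atlas (E n) M) {y : E n} (hy : y ∈ e.target)
    (ξ : Fin n → E n → ℝ) (c : ℝ) :
    (∀ i j, g.lieForm e ξ y i j = c * g.comp e y i j) ↔
      (Matrix.of fun i k => fderiv ℝ (fun y => g.inv e y i k) y (vecOf ξ y)) + c • g.inv e y
        = g.inv e y * jacobian ξ y + (jacobian ξ y).transpose * g.inv e y := by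
  set dG := Matrix.of fun i k => fderiv ℝ (fun y => g.inv e y i k) y (vecOf ξ y) with hdG
  set dg := Matrix.of fun i k => fderiv ℝ (fun y => g.comp e y i k) y (vecOf ξ y) with hdg
  have h0 : dG * g.comp e y + g.inv e y * dg = 0 := g.fderiv_inv_mul_comp he hy _
  have h1 := g.comp_mul_inv he hy
  have h2 := g.inv_mul_comp he hy
  have hl : (∀ i j, g.lieForm e ξ y i j = c * g.comp e y i j) ↔
      dg + jacobian ξ y * g.comp e y + g.comp e y * (jacobian ξ y).transpose
        = c • g.comp e y := by
    rw [← Matrix.ext_iff]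
    refine forall_congr' fun i => forall_congr' fun j => ?_
    simp only [lieForm, hdg, fderiv_vecOf, Matrix.add_apply, Matrix.mul_apply, Matrix.of_apply,
      Matrix.smul_apply, smul_eq_mul, Finset.sum_add_distrib, jacobian, Matrix.transpose_apply]
    simp only [mul_comm (pd i (ξ _) y)]
  rw [hl]
  -- The rest is matrix algebra. Multiplying by G on both sides leads from the equation for γ to
  -- that for G, and multiplying by γ leads back; differentiating G γ = 1 gave G dγ G = -dG.
  generalize g.comp e y = γ at *
  generalize g.inv e y = G at *
  generalize jacobian ξ y = D at *
  constructor
  · intro h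
    have h3 := congrArg (fun A => G * A * G) h
    simp only [Matrix.mul_add, Matrix.add_mul, Matrix.mul_smul, Matrix.smul_mul] at h3
    have e1 : G * dg * G = -dG := by
      rw [← neg_eq_of_add_eq_zero_right h0, Matrix.neg_mul, Matrix.mul_assoc, h1, Matrix.mul_one]
    rw [e1, ← Matrix.mul_assoc G D, Matrix.mul_assoc _ γ G, h1, Matrix.mul_one,
      ← Matrix.mul_assoc G γ, h2, Matrix.one_mul, Matrix.one_mul] at h3
    rw [← h3]; abel
  · intro h
    have h3 := congrArg (fun A => γ * A * γ) h
    simp only [Matrix.mul_add, Matrix.add_mul, Matrix.mul_smul, Matrix.smul_mul] at h3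
    have e1 : γ * dG * γ = -dg := by
      rw [Matrix.mul_assoc, eq_neg_of_add_eq_zero_left h0, Matrix.mul_neg, ← Matrix.mul_assoc, h1,
        Matrix.one_mul]
    rw [e1, ← Matrix.mul_assoc γ G D, h1, Matrix.one_mul, Matrix.mul_assoc γ (D.transpose * G),
      Matrix.mul_assoc D.transpose, h2, Matrix.mul_one, Matrix.one_mul] at h3
    rw [add_assoc, ← h3]; abel

omit [IsManifold (𝓡 n) ∞ M] in
lemma pd_lowerChristoffel (he : e ∈ atlas (E n) M) {y : E n} (hy : y ∈ e.target)
    (l j k m : Fin n) : pd m (g.lowerChristoffel e l j k) y =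
      (1 / 2) * (pd m (pd j fun y => g.comp e y l k) y + pd m (pd k fun y => g.comp e y l j) y
      - pd m (pd l fun y => g.comp e y j k) y) := by
  have hp := fun a b c => differentiableAt_of_contDiffOn
    (ContDiffOn.pd (g.contDiffOn_comp he a b) e.open_target c) e.open_target hy
  unfold lowerChristoffel
  rw [pd_const_mul _ (((hp l k j).fun_add (hp l j k)).fun_sub (hp j k l)),
    pd_sub ((hp l k j).fun_add (hp l j k)) (hp j k l), pd_add (hp l k j) (hp l j k)]

section Homothety

variable {ξ : Fin n → E n → ℝ} {c : ℝ}

omit [IsManifold (𝓡 n) ∞ M] in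
-- The differentiated homothety equation, expanded by the product rule. The Christoffel symbols are
-- combinations of three such derivatives.
lemma pd_lieForm (he : e ∈ atlas (E n) M) (hξ : ∀ k, ContDiffOn ℝ ∞ (ξ k) e.target)
    (hL : ∀ y ∈ e.target, ∀ i j, g.lieForm e ξ y i j = c * g.comp e y i j) {y : E n}
    (hy : y ∈ e.target) (p i j : Fin n) :
    (∑ k, (pd p (ξ k) y * pd k (fun y => g.comp e y i j) y
      + ξ k y * pd p (pd k fun y => g.comp e y i j) y
      + (pd p (fun y => g.comp e y k j) y * pd i (ξ k) y + g.comp e y k j * pd p (pd i (ξ k)) y)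
      + (pd p (fun y => g.comp e y i k) y * pd j (ξ k) y + g.comp e y i k * pd p (pd j (ξ k)) y)))
      = c * pd p (fun y => g.comp e y i j) y := by
  have hg := fun a b => differentiableAt_of_contDiffOn (g.contDiffOn_comp he a b) e.open_target hy
  have hp := fun a b c => differentiableAt_of_contDiffOn
    (ContDiffOn.pd (g.contDiffOn_comp he a b) e.open_target c) e.open_target hy
  have hx := fun k => differentiableAt_of_contDiffOn (hξ k) e.open_target hy
  have hxp := fun k a => differentiableAt_of_contDiffOn
    (ContDiffOn.pd (hξ k) e.open_target a) e.open_target hy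
  rw [← pd_const_mul c (hg i j),
    ← pd_congr e.open_target (fun y hy => hL y hy i j) hy p]
  unfold lieForm
  rw [pd_sum fun k _ => (((hx k).fun_mul (hp i j k)).fun_add ((hg k j).fun_mul (hxp k i))).fun_add
    ((hg i k).fun_mul (hxp k j))]
  refine Finset.sum_congr rfl fun k _ => ?_
  rw [pd_add (((hx k).fun_mul (hp i j k)).fun_add ((hg k j).fun_mul (hxp k i))) ((hg i k).fun_mul (hxp k j)),
    pd_add ((hx k).fun_mul (hp i j k)) ((hg k j).fun_mul (hxp k i)), pd_mul (hx k) (hp i j k),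
    pd_mul (hg k j) (hxp k i), pd_mul (hg i k) (hxp k j)]

omit [IsManifold (𝓡 n) ∞ M] in
/-- A homothety preserves the Levi-Civita connection. -/
lemma lieDeriv_lowerChristoffel (he : e ∈ atlas (E n) M)
    (hξ : ∀ k, ContDiffOn ℝ ∞ (ξ k) e.target)
    (hL : ∀ y ∈ e.target, ∀ i j, g.lieForm e ξ y i j = c * g.comp e y i j) {y : E n}
    (hy : y ∈ e.target) (l j k : Fin n) :
    (∑ m, g.comp e y l m * pd j (pd k (ξ m)) y)
      + (∑ m, ξ m y * pd m (g.lowerChristoffel e l j k) y)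
      + (∑ m, pd l (ξ m) y * g.lowerChristoffel e m j k y)
      + (∑ m, pd j (ξ m) y * g.lowerChristoffel e l m k y)
      + (∑ m, pd k (ξ m) y * g.lowerChristoffel e l j m y)
      = c * g.lowerChristoffel e l j k y := by
  -- The combination ∂_j (L g)_lk + ∂_k (L g)_lj - ∂_l (L g)_jk mirrors the definition of Γ_{l,jk}.
  -- As partial derivatives commute, the second derivatives of ξ in it collapse to 2 g_lm ∂_j ∂_k
  -- ξ^m.
  have h1 := g.pd_lieForm he hξ hL hy j l k
  have h2 := g.pd_lieForm he hξ hL hy k l j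
  have h3 := g.pd_lieForm he hξ hL hy l j k
  have hR : c * g.lowerChristoffel e l j k y = (1 / 2) * (c * pd j (fun y => g.comp e y l k) y
      + c * pd k (fun y => g.comp e y l j) y - c * pd l (fun y => g.comp e y j k) y) := by
    rw [lowerChristoffel]; ring
  rw [hR, ← h1, ← h2, ← h3]
  simp only [← Finset.sum_add_distrib, ← Finset.sum_sub_distrib, Finset.mul_sum]
  refine Finset.sum_congr rfl fun m _ => ?_
  rw [pd_lowerChristoffel g he hy]
  simp only [lowerChristoffel]
  have hg := fun a b => g.contDiffOn_comp he a b
  rw [pd_comm (hξ m) e.open_target hy k j, pd_comm (hξ m) e.open_target hy k l,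
    pd_comm (hξ m) e.open_target hy j l,
    pd_comm (hg l k) e.open_target hy m j, pd_comm (hg l j) e.open_target hy m k,
    pd_comm (hg j k) e.open_target hy m l]
  simp only [fun y => g.comp_symm e y m j, fun y => g.comp_symm e y m k]
  ring

/-- Trace of `lieDeriv_lowerChristoffel` with g^jk. The derivative also hits g^jk, and by
`lieForm_eq_iff` this contributes 2 tr(G D C) - c tr(G C), with D the Jacobian and C the matrix
Γ_{l,jk}. These are exactly the terms needed to cancel the two Jacobian terms and the factor c of
the connection. -/
lemma fderiv_lowerContracted (he : e ∈ atlas (E n) M)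
    (hξ : ∀ k, ContDiffOn ℝ ∞ (ξ k) e.target)
    (hL : ∀ y ∈ e.target, ∀ i j, g.lieForm e ξ y i j = c * g.comp e y i j) {y : E n}
    (hy : y ∈ e.target) (l : Fin n) :
    fderiv ℝ (g.lowerContracted e l) y (vecOf ξ y)
      = -(∑ m, g.comp e y l m * ∑ j, ∑ k, g.inv e y j k * pd j (pd k (ξ m)) y)
        - ∑ m, pd l (ξ m) y * g.lowerContracted e m y := by
  set C : Fin n → Matrix (Fin n) (Fin n) ℝ := fun l =>
    Matrix.of fun j k => g.lowerChristoffel e l j k y with hC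
  set dC : Matrix (Fin n) (Fin n) ℝ :=
    Matrix.of fun j k => fderiv ℝ (g.lowerChristoffel e l j k) y (vecOf ξ y) with hdC
  set H : Fin n → Matrix (Fin n) (Fin n) ℝ := fun m =>
    Matrix.of fun j k => pd j (pd k (ξ m)) y with hH
  set dG := Matrix.of fun i k => fderiv ℝ (fun y => g.inv e y i k) y (vecOf ξ y) with hdG
  have hA := (g.lieForm_eq_iff he hy ξ c).mp (hL y hy)
  rw [← hdG] at hA
  have hCt : ∀ m, (C m).transpose = C m := fun m =>
    Matrix.ext fun i k => g.lowerChristoffel_comm e m k i y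
  have hB : (∑ m, g.comp e y l m • H m) + dC + (∑ m, pd l (ξ m) y • C m)
      + jacobian ξ y * C l + (jacobian ξ y * C l).transpose = c • C l := by
    ext j k
    have := g.lieDeriv_lowerChristoffel he hξ hL hy l j k
    simp only [Matrix.add_apply, Matrix.sum_apply, Matrix.smul_apply, Matrix.mul_apply,
      Matrix.transpose_apply, hC, hdC, hH, Matrix.of_apply, jacobian, smul_eq_mul, fderiv_vecOf]
    rw [← this]
    simp only [g.lowerChristoffel_comm e l j _ y]
  have htr : ∀ A : Matrix (Fin n) (Fin n) ℝ,
      (∑ j, ∑ k, g.inv e y j k * A j k) = (g.inv e y * A.transpose).trace := fun A => by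
    simp [Matrix.trace, Matrix.mul_apply]
  have hlc : ∀ m, g.lowerContracted e m y = (g.inv e y * C m).trace := fun m => by
    rw [← hCt m, ← htr]; rfl
  have hd : fderiv ℝ (g.lowerContracted e l) y (vecOf ξ y)
      = (dG * C l).trace + (g.inv e y * dC).trace := by
    have hG := fun i k => differentiableAt_of_contDiffOn (g.contDiffOn_inv he i k) e.open_target hy
    have hc := fun i k => differentiableAt_of_contDiffOn (g.contDiffOn_lowerChristoffel he l i k)
      e.open_target hy
    have hdCt : dC.transpose = dC := Matrix.ext fun i k => by
      have : g.lowerChristoffel e l k i = g.lowerChristoffel e l i k :=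
        funext fun y => g.lowerChristoffel_comm e l k i y
      simp only [hdC, Matrix.transpose_apply, Matrix.of_apply, this]
    rw [← hdCt, ← htr, ← hCt l]
    unfold lowerContracted
    rw [fderiv_fun_sum fun j _ => DifferentiableAt.fun_sum fun k _ => (hG j k).fun_mul (hc j k),
      sum_apply]
    simp only [fderiv_fun_sum fun k _ => (hG _ k).fun_mul (hc _ k), sum_apply,
      fderiv_fun_mul (hG _ _) (hc _ _), add_apply, smul_apply, smul_eq_mul]
    simp only [Matrix.trace, Matrix.mul_apply, Matrix.diag_apply, Matrix.transpose_apply,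
      ← Finset.sum_add_distrib]
    refine Finset.sum_congr rfl fun j _ => Finset.sum_congr rfl fun k _ => ?_
    simp only [hC, hdC, hdG, Matrix.of_apply]
    ring
  have hHt : ∀ m, (∑ j, ∑ k, g.inv e y j k * pd j (pd k (ξ m)) y) = (g.inv e y * H m).trace :=
    fun m => by
      have : (H m).transpose = H m :=
        Matrix.ext fun i k => pd_comm (hξ m) e.open_target hy k i
      rw [← this, ← htr]; rfl
  simp only [hHt, hlc]
  have hGt := g.inv_transpose e y
  rw [hd, eq_sub_of_add_eq hA]
  have hdC' : dC = c • C l - (jacobian ξ y * C l).transpose - jacobian ξ y * C l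
      - (∑ m, pd l (ξ m) y • C m) - ∑ m, g.comp e y l m • H m := by
    rw [← hB]; abel
  have t1 : ((jacobian ξ y).transpose * g.inv e y * C l).trace
      = (g.inv e y * (jacobian ξ y * C l)).trace := by
    rw [← Matrix.trace_transpose, Matrix.transpose_mul, Matrix.transpose_mul, hGt, hCt,
      Matrix.transpose_transpose, Matrix.trace_mul_comm, Matrix.mul_assoc]
  have t2 : (g.inv e y * (jacobian ξ y * C l).transpose).trace
      = (g.inv e y * (jacobian ξ y * C l)).trace := by
    rw [← Matrix.trace_transpose, Matrix.transpose_mul, Matrix.transpose_transpose, hGt,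
      Matrix.trace_mul_comm]
  rw [hdC']
  simp only [Matrix.mul_sub, Matrix.sub_mul, Matrix.add_mul, Matrix.trace_sub, Matrix.trace_add,
    Matrix.mul_sum, Matrix.trace_sum, Matrix.mul_smul, Matrix.smul_mul, Matrix.trace_smul,
    t1, t2, Matrix.mul_assoc (g.inv e y) (jacobian ξ y), smul_eq_mul]
  ring

/-- The trace of the invariance of the connection under a homothety. -/
lemma lieDeriv_contractedChristoffel (he : e ∈ atlas (E n) M)
    (hξ : ∀ k, ContDiffOn ℝ ∞ (ξ k) e.target)
    (hL : ∀ y ∈ e.target, ∀ i j, g.lieForm e ξ y i j = c * g.comp e y i j) {y : E n}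
    (hy : y ∈ e.target) (i : Fin n) :
    (∑ j, ∑ k, g.inv e y j k * pd j (pd k (ξ i)) y)
      - (∑ m, g.contractedChristoffel e y m * pd m (ξ i) y)
      + fderiv ℝ (fun y => g.contractedChristoffel e y i) y (vecOf ξ y)
      + c * g.contractedChristoffel e y i = 0 := by
  set G := g.inv e y with hGdef
  set γ := fun l => g.lowerContracted e l y with hγ
  set D := jacobian ξ y with hD
  set h : Fin n → ℝ := fun m => ∑ j, ∑ k, G j k * pd j (pd k (ξ m)) y with hh
  set dG := Matrix.of fun i k => fderiv ℝ (fun y => g.inv e y i k) y (vecOf ξ y) with hdG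
  have hA : dG + c • G = G * D + D.transpose * G := (g.lieForm_eq_iff he hy ξ c).mp (hL y hy)
  have hΓ : (fun m => g.contractedChristoffel e y m) = G.mulVec γ :=
    funext fun m => g.contractedChristoffel_eq e y m
  have hdγ : (fun l => fderiv ℝ (g.lowerContracted e l) y (vecOf ξ y))
      = -((g.comp e y).mulVec h) - D.mulVec γ :=
    funext fun l => g.fderiv_lowerContracted he hξ hL hy l
  have hdΓ : (fun i => fderiv ℝ (fun y => g.contractedChristoffel e y i) y (vecOf ξ y))
      = dG.mulVec γ + G.mulVec fun l => fderiv ℝ (g.lowerContracted e l) y (vecOf ξ y) := by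
    funext i
    have hG := fun i k => differentiableAt_of_contDiffOn (g.contDiffOn_inv he i k) e.open_target hy
    have hc := fun i => differentiableAt_of_contDiffOn (g.contDiffOn_lowerContracted he i)
      e.open_target hy
    simp only [g.contractedChristoffel_eq e _ i]
    rw [fderiv_fun_sum fun l _ => (hG i l).fun_mul (hc l), sum_apply]
    simp only [fderiv_fun_mul (hG i _) (hc _), add_apply, smul_apply, smul_eq_mul,
      Pi.add_apply, Matrix.mulVec, dotProduct, hdG, Matrix.of_apply, ← Finset.sum_add_distrib, hγ]
    exact Finset.sum_congr rfl fun l _ => by ring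
  -- After inserting dG = G D + Dᵀ G - c G and G g = 1, all terms cancel in pairs.
  have key : h - D.transpose.mulVec (G.mulVec γ) + (dG.mulVec γ + G.mulVec
      (-((g.comp e y).mulVec h) - D.mulVec γ)) + c • G.mulVec γ = 0 := by
    rw [eq_sub_of_add_eq hA]
    simp only [Matrix.sub_mulVec, Matrix.add_mulVec, Matrix.mulVec_sub, Matrix.mulVec_neg,
      Matrix.mulVec_mulVec, hGdef, g.inv_mul_comp he hy, Matrix.one_mulVec, Matrix.smul_mulVec]
    abel
  rw [← hdγ, ← hdΓ, ← hΓ] at key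
  have := congrFun key i
  simp only [Pi.add_apply, Pi.sub_apply, Pi.smul_apply, smul_eq_mul, Pi.zero_apply] at this
  rw [← this]
  congr 3
  simp only [Matrix.mulVec, dotProduct, Matrix.transpose_apply, hD, jacobian, Matrix.of_apply]
  exact Finset.sum_congr rfl fun m _ => mul_comm _ _

lemma lowerContracted_eq (he : e ∈ atlas (E n) M) {y : E n} (hy : y ∈ e.target) (l : Fin n) :
    g.lowerContracted e l y = ∑ i, g.comp e y l i * g.contractedChristoffel e y i := by
  have h : (fun m => g.contractedChristoffel e y m)
      = (g.inv e y).mulVec fun l => g.lowerContracted e l y :=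
    funext fun m => g.contractedChristoffel_eq e y m
  have h2 := congrArg (g.comp e y).mulVec h
  rw [Matrix.mulVec_mulVec, g.comp_mul_inv he hy, Matrix.one_mulVec] at h2
  exact (congrFun h2 l).symm

/-- The Laplacian of the potential of a gradient homothety. -/
lemma laplacian_of_gradient (he : e ∈ atlas (E n) M)
    (hξ : ∀ k, ContDiffOn ℝ ∞ (ξ k) e.target) {A : E n → ℝ} (hA : ContDiffOn ℝ ∞ A e.target)
    (hgrad : ∀ y ∈ e.target, ∀ j, ∑ k, g.comp e y k j * ξ k y = -2 * pd j A y) {y : E n}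
    (hy : y ∈ e.target) (hL : ∀ i j, g.lieForm e ξ y i j = c * g.comp e y i j) :
    (∑ i, ∑ j, g.inv e y i j * pd i (pd j A) y)
      - (∑ i, g.contractedChristoffel e y i * pd i A y) = -(n / 4) * c := by
  have hg := fun a b => differentiableAt_of_contDiffOn (g.contDiffOn_comp he a b) e.open_target hy
  have hx := fun k => differentiableAt_of_contDiffOn (hξ k) e.open_target hy
  have hAp := fun a => differentiableAt_of_contDiffOn
    (ContDiffOn.pd hA e.open_target a) e.open_target hy
  have h1 : ∀ i j, (∑ k, (pd i (fun y => g.comp e y k j) y * ξ k y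
      + g.comp e y k j * pd i (ξ k) y)) = -2 * pd i (pd j A) y := fun i j => by
    rw [← pd_const_mul _ (hAp j), ← pd_congr e.open_target (fun y hy => hgrad y hy j) hy i,
      pd_sum fun k _ => (hg k j).fun_mul (hx k)]
    exact Finset.sum_congr rfl fun k _ => (pd_mul (hg k j) (hx k) i).symm
  -- This is c g_ij = -4 ∇_i ∂_j A, the Hessian form of L_ξ g for ξ = -2 ∇A. The Christoffel term is
  -- still written with ξ^k Γ_{k,ij}; `h4` turns its trace into Γ^i ∂_i A.
  have h2 : ∀ i j, c * g.comp e y i j = -2 * (∑ k, ξ k y * g.lowerChristoffel e k i j y)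
      - 4 * pd i (pd j A) y := fun i j => by
    have e1 := h1 i j
    have e2 := h1 j i
    rw [pd_comm hA e.open_target hy j i] at e2
    have e3 : 4 * pd i (pd j A) y = -(-2 * pd i (pd j A) y) - (-2 * pd i (pd j A) y) := by ring
    rw [e3]
    nth_rewrite 1 [← e1]
    rw [← e2, ← hL i j, lieForm, Finset.mul_sum, ← sub_eq_zero]
    simp only [← Finset.sum_sub_distrib, ← Finset.sum_neg_distrib]
    refine Finset.sum_eq_zero fun k _ => ?_
    simp only [lowerChristoffel, fun y => g.comp_symm e y k i]
    ring
  have h3 : (∑ i, ∑ j, g.inv e y i j * g.comp e y i j) = n := by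
    have := congrArg Matrix.trace (g.inv_mul_comp he hy)
    simp only [Matrix.trace, Matrix.mul_apply, Matrix.diag_apply, Matrix.one_apply_eq,
      Finset.sum_const, Finset.card_univ, Fintype.card_fin, nsmul_eq_mul, mul_one] at this
    rw [← this]
    exact Finset.sum_congr rfl fun i _ => Finset.sum_congr rfl fun j _ => by
      rw [g.comp_symm e y i j]
  have h4 : (∑ i, ∑ j, g.inv e y i j * (∑ k, ξ k y * g.lowerChristoffel e k i j y))
      = -2 * ∑ i, g.contractedChristoffel e y i * pd i A y := by
    calc _ = ∑ k, ξ k y * g.lowerContracted e k y := by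
          simp only [lowerContracted, Finset.mul_sum]
          rw [Finset.sum_congr rfl fun i _ => Finset.sum_comm, Finset.sum_comm]
          exact Finset.sum_congr rfl fun k _ => Finset.sum_congr rfl fun i _ =>
            Finset.sum_congr rfl fun j _ => by ring
      _ = ∑ i, g.contractedChristoffel e y i * ∑ k, g.comp e y k i * ξ k y := by
          simp only [g.lowerContracted_eq he hy, Finset.mul_sum]
          rw [Finset.sum_comm]
          exact Finset.sum_congr rfl fun k _ => Finset.sum_congr rfl fun i _ => by ring
      _ = _ := by
          simp only [hgrad y hy, Finset.mul_sum]
          exact Finset.sum_congr rfl fun k _ => by ring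
  have h5 : (∑ i, ∑ j, g.inv e y i j * (c * g.comp e y i j))
      = -2 * (∑ i, ∑ j, g.inv e y i j * (∑ k, ξ k y * g.lowerChristoffel e k i j y))
        - 4 * ∑ i, ∑ j, g.inv e y i j * pd i (pd j A) y := by
    rw [Finset.mul_sum, Finset.mul_sum, ← Finset.sum_sub_distrib]
    refine Finset.sum_congr rfl fun i _ => ?_
    rw [Finset.mul_sum, Finset.mul_sum, ← Finset.sum_sub_distrib]
    refine Finset.sum_congr rfl fun j _ => ?_
    rw [h2]; ring
  have h6 : (∑ i, ∑ j, g.inv e y i j * (c * g.comp e y i j)) = c * n := by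
    rw [← h3, Finset.mul_sum]
    refine Finset.sum_congr rfl fun i _ => ?_
    rw [Finset.mul_sum]
    exact Finset.sum_congr rfl fun j _ => by ring
  rw [h6, h4] at h5
  linarith

end Homothety

end Metric

/-! ### Comparing coefficients of polynomials in the jet coordinates -/

section Algebra

variable {n : ℕ}

/-- Test against the symmetrized elementary matrix. Since second derivatives of u are symmetric,
only the symmetric part of B can be detected. -/
lemma add_swap_eq_zero_of_pairing {B : Fin n → Fin n → ℝ}
    (h : ∀ Q : Fin n → Fin n → ℝ, (∀ i k, Q i k = Q k i) → ∑ i, ∑ k, Q i k * B i k = 0)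
    (a b : Fin n) : B a b + B b a = 0 := by
  have h1 := h (fun i k => (Pi.single a 1 : Fin n → ℝ) i * (Pi.single b 1 : Fin n → ℝ) k
    + (Pi.single b 1 : Fin n → ℝ) i * (Pi.single a 1 : Fin n → ℝ) k) fun i k => by ring
  simpa [Pi.single_apply, add_mul, Finset.sum_add_distrib] using h1

/-- The value at 0 gives the constant term, the odd part under P ↦ -P gives the linear one, and
polarization of what is left gives the quadratic one. -/
lemma quadratic_eq_zero {c K : ℝ} {G : Fin n → Fin n → ℝ} {L : Fin n → ℝ}
    (hG : ∀ i k, G i k = G k i)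
    (h : ∀ P : Fin n → ℝ, c * (∑ i, ∑ k, G i k * (P i * P k)) + (∑ m, P m * L m) + K = 0) :
    (∀ i k, c * G i k = 0) ∧ (∀ m, L m = 0) ∧ K = 0 := by
  have hK : K = 0 := by simpa using h 0
  have hL : ∀ P : Fin n → ℝ, ∑ m, P m * L m = 0 := fun P => by
    have h1 := h P
    have h2 := h (-P)
    simp only [Pi.neg_apply, mul_neg, neg_mul, neg_neg, Finset.sum_neg_distrib] at h2
    linarith
  have hL' : ∀ m, L m = 0 := fun m => by
    simpa [Pi.single_apply] using hL (Pi.single m 1)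
  have hQ : ∀ P : Fin n → ℝ, c * (∑ i, ∑ k, G i k * (P i * P k)) = 0 := fun P => by
    have h1 := h P
    rw [hL, hK] at h1
    linarith
  refine ⟨fun a b => ?_, hL', hK⟩
  have h1 := hQ (Pi.single a 1 + Pi.single b 1)
  have h2 := hQ (Pi.single a 1)
  have h3 := hQ (Pi.single b 1)
  have h4 := hG a b
  simp only [Pi.add_apply, Pi.single_apply, mul_add, mul_ite, mul_one, mul_zero,
    Finset.sum_add_distrib, Finset.sum_ite_eq', Finset.mem_univ, if_true] at h1 h2 h3
  rw [h4] at h1 ⊢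
  linarith

/-- Bookkeeping for `lowerOrderPart_eq`, with p for u_m, c for η_uu, B for ∂_u ∂_i η, A for ∂_i ∂_k
η and X, D, Xt for derivatives of ξ^m. The right-hand side is sorted by degree in p. -/
lemma sum_lowerOrder {G A : Fin n → Fin n → ℝ} {X : Fin n → Fin n → Fin n → ℝ}
    {p B Γ dΓ a Xt : Fin n → ℝ} {D : Fin n → Fin n → ℝ} {c au at' τ K v : ℝ}
    (hG : ∀ i k, G i k = G k i) (hA : ∀ i k, A i k = A k i) (hX : ∀ m i k, X m i k = X m k i) :
    (∑ i, ∑ k, G i k * (A k i + p k * B i + p i * B k + p k * p i * c - ∑ m, p m * X m k i))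
      - (∑ i, (dΓ i * p i + Γ i * (a i + p i * au - ∑ m, p m * D m i))) - at'
      + (∑ m, p m * Xt m) - K - (τ - au) * ((∑ i, Γ i * p i) + v)
    = c * (∑ i, ∑ k, G i k * (p i * p k))
      + (∑ m, p m * (2 * (∑ k, G m k * B k) - (∑ i, ∑ k, G i k * X m i k) - dΓ m
        + (∑ i, Γ i * D m i) + Xt m - τ * Γ m))
      + ((∑ i, ∑ k, G i k * A i k) - (∑ i, Γ i * a i) - at' - K - (τ - au) * v) := by
  have h1 : (∑ i, ∑ k, G i k * (p k * B i)) = ∑ m, p m * ∑ k, G m k * B k := by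
    simp only [Finset.mul_sum]
    rw [Finset.sum_comm]
    exact Finset.sum_congr rfl fun i _ => Finset.sum_congr rfl fun k _ => by rw [hG]; ring
  have h2 : (∑ i, ∑ k, G i k * (p i * B k)) = ∑ m, p m * ∑ k, G m k * B k := by
    simp only [Finset.mul_sum]
    exact Finset.sum_congr rfl fun i _ => Finset.sum_congr rfl fun k _ => by ring
  have h3 : (∑ i, ∑ k, G i k * (p k * p i * c)) = c * ∑ i, ∑ k, G i k * (p i * p k) := by
    simp only [Finset.mul_sum]
    exact Finset.sum_congr rfl fun i _ => Finset.sum_congr rfl fun k _ => by ring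
  have h4 : (∑ i, ∑ k, G i k * ∑ m, p m * X m k i)
      = ∑ m, p m * ∑ i, ∑ k, G i k * X m i k := by
    simp only [Finset.mul_sum]
    rw [Finset.sum_congr rfl fun i _ => Finset.sum_comm, Finset.sum_comm]
    exact Finset.sum_congr rfl fun m _ => Finset.sum_congr rfl fun i _ =>
      Finset.sum_congr rfl fun k _ => by rw [hX]; ring
  have h5 : (∑ i, Γ i * ∑ m, p m * D m i) = ∑ m, p m * ∑ i, Γ i * D m i := by
    simp only [Finset.mul_sum]
    rw [Finset.sum_comm]
    exact Finset.sum_congr rfl fun m _ => Finset.sum_congr rfl fun i _ => by ring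
  have h6 : (∑ i, Γ i * (p i * au)) = au * ∑ i, Γ i * p i := by
    rw [Finset.mul_sum]
    exact Finset.sum_congr rfl fun i _ => by ring
  have h7 : (∑ m, p m * (τ * Γ m)) = τ * ∑ i, Γ i * p i := by
    rw [Finset.mul_sum]
    exact Finset.sum_congr rfl fun i _ => by ring
  have h8 : (∑ m, p m * (2 * ∑ k, G m k * B k)) = 2 * ∑ m, p m * ∑ k, G m k * B k := by
    rw [Finset.mul_sum]
    exact Finset.sum_congr rfl fun i _ => by ring
  have h9 : (∑ i, dΓ i * p i) = ∑ m, p m * dΓ m := Finset.sum_congr rfl fun i _ => mul_comm _ _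
  have h10 : (∑ i, ∑ k, G i k * A k i) = ∑ i, ∑ k, G i k * A i k :=
    Finset.sum_congr rfl fun i _ => Finset.sum_congr rfl fun k _ => by rw [hA]
  simp only [mul_add, mul_sub, Finset.sum_add_distrib, Finset.sum_sub_distrib, h1, h2, h3, h4, h5,
    h6, h7, h8, h9, h10]
  ring

end Algebra

/-! ### Second derivatives applied to vectors -/

section SecondDerivatives

lemma fderiv_fderiv_apply_eq_zero {F : Type*} [NormedAddCommGroup F] [NormedSpace ℝ F]
    {f : F → ℝ} {w v : F} (hf : ContDiffAt ℝ 2 f w)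
    (h : ∀ᶠ x in 𝓝 w, fderiv ℝ f x v = 0) (a : F) : fderiv ℝ (fderiv ℝ f) w a v = 0 := by
  have h1 := ((differentiableAt_fderiv_of_contDiffAt hf).hasFDerivAt.clm_apply
    (hasFDerivAt_const v w)).fderiv
  have h2 : (fun x => fderiv ℝ f x v) =ᶠ[𝓝 w] fun _ => 0 := h
  rw [h2.fderiv_eq, fderiv_fun_const] at h1
  have h3 := congrArg (fun L => L a) h1
  simpa using h3.symm

lemma fderiv_fderiv_comm {F : Type*} [NormedAddCommGroup F] [NormedSpace ℝ F]
    {f : F → ℝ} {w : F} (hf : ContDiffAt ℝ 2 f w) (a b : F) :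
    fderiv ℝ (fderiv ℝ f) w a b = fderiv ℝ (fderiv ℝ f) w b a :=
  (hf.isSymmSndFDerivAt (by simp)) a b

end SecondDerivatives

/-! ### The determining equations in a chart -/

section Determining

variable {n : ℕ} {M : Type*} [TopologicalSpace M] [ChartedSpace (E n) M]

/-- A basis vector of the space of independent variables, as a vector in `(z, u)`-space. -/
abbrev baseVec (o : Option (Fin n)) : Jet0 (Option (Fin n)) := (Pi.single o 1, 0)

/-- The basis vector along the dependent variable. -/
abbrev fibreVec : Jet0 (Option (Fin n)) := (0, 1)

lemma hess_eq (f : Jet0 (Option (Fin n)) → ℝ) (j : Jet1 (Option (Fin n))) (i k : Fin n) :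
    hess f (some i) (some k) j =
      fderiv ℝ (fderiv ℝ f) (j.1, j.2.1) (baseVec (some k)) (baseVec (some i))
      + j.2.2 (some k) * fderiv ℝ (fderiv ℝ f) (j.1, j.2.1) fibreVec (baseVec (some i))
      + j.2.2 (some i) * fderiv ℝ (fderiv ℝ f) (j.1, j.2.1) (baseVec (some k)) fibreVec
      + j.2.2 (some k) * j.2.2 (some i)
        * fderiv ℝ (fderiv ℝ f) (j.1, j.2.1) fibreVec fibreVec := by
  have : ∀ m : Option (Fin n), ((Pi.single m 1 : Option (Fin n) → ℝ), j.2.2 m)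
      = baseVec m + j.2.2 m • fibreVec := by
    simp
  rw [hess, this, this]
  simp only [map_add, map_smul, add_apply, smul_apply, smul_eq_mul]
  ring

variable (g : Metric n M) (V : M → ℝ) (e : OpenPartialHomeomorph M (E n))

/-- The coefficient of `u_m` in the part of the symmetry condition without second derivatives. -/
def linearCoeff (ξ : Jet0 (Option (Fin n)) → Option (Fin n) → ℝ)
    (η : Jet0 (Option (Fin n)) → ℝ) (w : Jet0 (Option (Fin n))) (m : Fin n) : ℝ :=
  let y := spacePart w.1
  2 * (∑ k, g.inv e y m k * fderiv ℝ (fderiv ℝ η) w fibreVec (baseVec (some k)))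
    - (∑ i, ∑ k, g.inv e y i k * fderiv ℝ (fderiv ℝ fun w => ξ w (some m)) w
        (baseVec (some i)) (baseVec (some k)))
    - fderiv ℝ (fun y => g.contractedChristoffel e y m) y (spacePart (ξ w))
    + (∑ i, g.contractedChristoffel e y i
        * fderiv ℝ (fun w => ξ w (some m)) w (baseVec (some i)))
    + fderiv ℝ (fun w => ξ w (some m)) w (baseVec none)
    - fderiv ℝ (fun w => ξ w none) w (baseVec none) * g.contractedChristoffel e y m

/-- The coefficient of `u_ik` in the symmetry condition, up to symmetrization. -/
def quadraticCoeff (ξ : Jet0 (Option (Fin n)) → Option (Fin n) → ℝ)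
    (w : Jet0 (Option (Fin n))) (i k : Fin n) : ℝ :=
  let y := spacePart w.1
  fderiv ℝ (fun y => g.inv e y i k) y (spacePart (ξ w))
    + fderiv ℝ (fun w => ξ w none) w (baseVec none) * g.inv e y i k
    - 2 * ∑ l, g.inv e y i l * fderiv ℝ (fun w => ξ w (some k)) w (baseVec (some l))

/-- The part of the symmetry condition that contains no derivatives of `u`. -/
def constantCoeff (ξ : Jet0 (Option (Fin n)) → Option (Fin n) → ℝ)
    (η : Jet0 (Option (Fin n)) → ℝ) (w : Jet0 (Option (Fin n))) : ℝ :=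
  let y := spacePart w.1
  (∑ i, ∑ k, g.inv e y i k * fderiv ℝ (fderiv ℝ η) w (baseVec (some i)) (baseVec (some k)))
    - (∑ i, g.contractedChristoffel e y i * fderiv ℝ η w (baseVec (some i)))
    - fderiv ℝ η w (baseVec none)
    - (fderiv ℝ (fun y => V (e.symm y)) y (spacePart (ξ w)) * w.2 + V (e.symm y) * η w)
    - (fderiv ℝ (fun w => ξ w none) w (baseVec none) - derivU η w) * (V (e.symm y) * w.2)

/-- Since ∂_u ξ^m vanishes near the point and not only at it, the second derivatives of ξ^m in a
direction ∂_u vanish too. This removes the cubic terms and leaves a polynomial of degree two in the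
u_m. -/
lemma lowerOrderPart_eq {ξ : Jet0 (Option (Fin n)) → Option (Fin n) → ℝ}
    {η : Jet0 (Option (Fin n)) → ℝ} (j : Jet1 (Option (Fin n)))
    (hξ : ∀ k, ContDiffAt ℝ 2 (fun w => ξ w k) (j.1, j.2.1))
    (hη : ContDiffAt ℝ 2 η (j.1, j.2.1))
    (hu : ∀ᶠ w in 𝓝 ((j.1, j.2.1) : Jet0 (Option (Fin n))),
      ∀ m, derivU (fun w => ξ w (some m)) w = 0) :
    lowerOrderPart g V e ξ η j =
      fderiv ℝ (fderiv ℝ η) (j.1, j.2.1) fibreVec fibreVec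
        * (∑ i, ∑ k, g.inv e (spacePart j.1) i k * (j.2.2 (some i) * j.2.2 (some k)))
      + (∑ m, j.2.2 (some m) * linearCoeff g e ξ η (j.1, j.2.1) m)
      + constantCoeff g V e ξ η (j.1, j.2.1) := by
  have hu0 := hu.self_of_nhds
  have huu : ∀ m a, fderiv ℝ (fderiv ℝ fun w => ξ w (some m)) (j.1, j.2.1) a fibreVec = 0 :=
    fun m a => fderiv_fderiv_apply_eq_zero (hξ _) (hu.mono fun w hw => hw m) a
  have huu' : ∀ m a, fderiv ℝ (fderiv ℝ fun w => ξ w (some m)) (j.1, j.2.1) fibreVec a = 0 :=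
    fun m a => by rw [fderiv_fderiv_comm (hξ _), huu]
  have hs := g.inv_symm e (spacePart j.1)
  unfold lowerOrderPart
  simp only [hess_eq, huu, huu', hu0, totalDeriv0_eq, mul_zero, add_zero, Finset.sum_const_zero,
    fderiv_fderiv_comm hη (baseVec _) fibreVec]
  exact sum_lowerOrder hs (fun i k => fderiv_fderiv_comm hη _ _)
    (fun m i k => fderiv_fderiv_comm (hξ _) _ _)

/-- The second jet over `(z, u)` that solves the equation and has the given spatial first
derivatives, spatial second derivatives and mixed second derivatives. -/
def jetWith (z : Option (Fin n) → ℝ) (u : ℝ) (P : Fin n → ℝ) (Q : Fin n → Fin n → ℝ)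
    (c : Fin n → ℝ) : Jet2 (Option (Fin n)) :=
  (z, u, fun o => o.elim ((∑ i, ∑ k, g.inv e (spacePart z) i k * Q i k)
      - (∑ i, g.contractedChristoffel e (spacePart z) i * P i) - V (e.symm (spacePart z)) * u) P,
    fun a b => a.elim (b.elim 0 c) fun i => b.elim (c i) (Q i))

lemma schrodinger_jetWith (z : Option (Fin n) → ℝ) (u : ℝ) (P : Fin n → ℝ)
    (Q : Fin n → Fin n → ℝ) (c : Fin n → ℝ) :
    schrodinger g V e (jetWith g V e z u P Q c) = 0 := by
  simp [schrodinger, jetWith]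

lemma jetWith_symm {z : Option (Fin n) → ℝ} {u : ℝ} {P : Fin n → ℝ} {Q : Fin n → Fin n → ℝ}
    {c : Fin n → ℝ} (hQ : ∀ i k, Q i k = Q k i) (a b : Option (Fin n)) :
    (jetWith g V e z u P Q c).2.2.2 a b = (jetWith g V e z u P Q c).2.2.2 b a := by
  cases a <;> cases b <;> simp [jetWith, hQ]

omit [ChartedSpace (E n) M] in
lemma isOpen_chartDomain {I : Set ℝ} (hI : IsOpen I) (e : OpenPartialHomeomorph M (E n)) :
    IsOpen (chartDomain I e) :=
  (hI.preimage (continuous_apply none)).inter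
    (e.open_target.preimage (spacePartL n).continuous)

variable [IsManifold (𝓡 n) ∞ M] {g V e}

section Criterion

variable {I J : Set ℝ} {ξ : Jet0 (Option (Fin n)) → Option (Fin n) → ℝ}
  {η : Jet0 (Option (Fin n)) → ℝ}

/-- The mixed derivatives c_i = u_ti do not occur in H, so they may be varied freely on solution
jets. They enter X^[2] H only through -g^ik (c_k D_i ξ^t + c_i D_k ξ^t), and nondegeneracy of g
forces D_i ξ^t = 0. As D_i ξ^t = ∂_i ξ^t + u_i ∂_u ξ^t with u_i arbitrary, both derivatives vanish.
-/
lemma time_component_of_criterion (hn : 0 < n) (he : e ∈ atlas (E n) M)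
    (hV : ContMDiff (𝓡 n) 𝓘(ℝ, ℝ) ∞ V) (hI : IsOpen I) (hJ : IsOpen J)
    (hξ : ContDiffOn ℝ ∞ ξ (chartDomain I e ×ˢ J)) (hη : ContDiffOn ℝ ∞ η (chartDomain I e ×ˢ J))
    (hc : SymmetryCriterion ξ η (schrodinger g V e) (chartDomain I e ×ˢ J))
    {w : Jet0 (Option (Fin n))} (hw : w ∈ chartDomain I e ×ˢ J) :
    (∀ i : Fin n, fderiv ℝ (fun w => ξ w none) w (baseVec (some i)) = 0) ∧
      derivU (fun w => ξ w none) w = 0 := by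
  obtain ⟨z, u⟩ := w
  have hy : spacePart z ∈ e.target := hw.1.2
  have hD : IsOpen (chartDomain I e ×ˢ J) := (isOpen_chartDomain hI e).prod hJ
  have hξ2 : ∀ k, ContDiffAt ℝ 2 (fun w => ξ w k) (z, u) := fun k =>
    ((contDiffAt_pi.mp (hξ.contDiffAt (hD.mem_nhds hw))) k).of_le two_le_infty
  have hη2 : ContDiffAt ℝ 2 η (z, u) := (hη.contDiffAt (hD.mem_nhds hw)).of_le two_le_infty
  have hG := fun i k => differentiableAt_of_contDiffOn (g.contDiffOn_inv he i k) e.open_target hy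
  have hΓ := fun i => differentiableAt_of_contDiffOn (g.contDiffOn_contractedChristoffel he i)
    e.open_target hy
  have hVd := differentiableAt_of_contDiffOn (contDiffOn_comp_symm he hV) e.open_target hy
  have key : ∀ (P : Fin n → ℝ) (i : Fin n),
      totalDeriv0 (fun w => ξ w none) (some i) (jetWith g V e z u P 0 0).toJet1 = 0 := by
    intro P
    set θ : Fin n → ℝ := fun i =>
      totalDeriv0 (fun w => ξ w none) (some i) (jetWith g V e z u P 0 0).toJet1 with hθ
    have hR : ∀ c, prolongApply ξ η (schrodinger g V e) (jetWith g V e z u P 0 c) = 0 := fun c =>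
      hc _ hw (jetWith_symm g V e fun _ _ => rfl) (schrodinger_jetWith g V e z u P 0 c)
    have hp2 : ∀ c i k, prolong2 ξ η (some i) (some k) (jetWith g V e z u P 0 c)
        = prolong2 ξ η (some i) (some k) (jetWith g V e z u P 0 0) - (c k * θ i + c i * θ k) := by
      intro c i k
      rw [prolong2_eq (j := jetWith g V e z u P 0 c) hξ2 hη2,
        prolong2_eq (j := jetWith g V e z u P 0 0) hξ2 hη2, Fintype.sum_option,
        Fintype.sum_option]
      simp only [hθ, jetWith, Jet2.toJet1, Jet2.base, Option.elim]
      simp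
      ring
    have hdiff : ∀ c : Fin n → ℝ, (∑ i, ∑ k, g.inv e (spacePart z) i k * (c k * θ i + c i * θ k))
        = 0 := by
      intro c
      have h1 := hR c
      have h0 := hR 0
      rw [prolongApply_schrodinger g V e (jetWith g V e z u P 0 c) hG hΓ hVd] at h1
      rw [prolongApply_schrodinger g V e (jetWith g V e z u P 0 0) hG hΓ hVd] at h0
      simp only [hp2 c, mul_sub, ← add_sub_assoc, Finset.sum_sub_distrib] at h1
      have h2 : (jetWith g V e z u P 0 c).toJet1 = (jetWith g V e z u P 0 0).toJet1 := rfl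
      rw [h2] at h1
      exact sub_eq_zero.mp (by simpa [jetWith, Jet2.base] using congrArg₂ (· - ·) h0 h1)
    -- For c the m-th basis vector the sum is twice the m-th entry of g⁻¹ θ.
    have hθ0 : (g.inv e (spacePart z)).mulVec θ = 0 := by
      funext m
      have h1 := hdiff (Pi.single m 1)
      simp only [Pi.single_apply, mul_add, ite_mul, mul_ite, one_mul, zero_mul, mul_zero,
        Finset.sum_add_distrib, Finset.sum_ite_eq', Finset.mem_univ, if_true,
        Finset.sum_ite_irrel, Finset.sum_const_zero] at h1
      simp only [g.inv_symm e _ _ m] at h1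
      simp only [Matrix.mulVec, dotProduct, Pi.zero_apply]
      linarith
    have h2 := congrArg (g.comp e (spacePart z)).mulVec hθ0
    rw [Matrix.mulVec_mulVec, g.comp_mul_inv he hy, Matrix.one_mulVec, Matrix.mulVec_zero] at h2
    exact fun i => congrFun h2 i
  -- The choice P = 0 isolates ∂_i ξ^t. Afterwards P = 1 isolates ∂_u ξ^t, for which one spatial
  -- index must exist.
  have k0 : ∀ i : Fin n, fderiv ℝ (fun w => ξ w none) (z, u) (baseVec (some i)) = 0 := fun i => by
    have := key 0 i
    rw [totalDeriv0_eq] at this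
    simpa [jetWith, Jet2.toJet1] using this
  refine ⟨k0, ?_⟩
  have := key 1 ⟨0, hn⟩
  rw [totalDeriv0_eq] at this
  simpa [jetWith, Jet2.toJet1, k0] using this

/-- If the time component depends on the time only, then the symmetry condition on solution jets
splits into its second and lower order parts. -/
lemma prolongApply_eq_of_time_component (he : e ∈ atlas (E n) M)
    (hV : ContMDiff (𝓡 n) 𝓘(ℝ, ℝ) ∞ V) (hI : IsOpen I) (hJ : IsOpen J)
    (hξ : ContDiffOn ℝ ∞ ξ (chartDomain I e ×ˢ J)) (hη : ContDiffOn ℝ ∞ η (chartDomain I e ×ˢ J))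
    (ht : ∀ w ∈ chartDomain I e ×ˢ J,
      (∀ i : Fin n, fderiv ℝ (fun w => ξ w none) w (baseVec (some i)) = 0) ∧
      derivU (fun w => ξ w none) w = 0)
    (j : Jet2 (Option (Fin n))) (hj : j.base ∈ chartDomain I e ×ˢ J)
    (hs : ∀ i l, j.2.2.2 i l = j.2.2.2 l i) (hH : schrodinger g V e j = 0) :
    prolongApply ξ η (schrodinger g V e) j =
      (∑ i, ∑ k, j.2.2.2 (some i) (some k) *
        (fderiv ℝ (fun y => g.inv e y i k) (spacePart j.1) (spacePart (ξ j.base))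
          + fderiv ℝ (fun w => ξ w none) j.base (baseVec none) * g.inv e (spacePart j.1) i k
          - 2 * ∑ l, g.inv e (spacePart j.1) i l *
            totalDeriv0 (fun w => ξ w (some k)) (some l) j.toJet1))
      + lowerOrderPart g V e ξ η j.toJet1 := by
  have hy : spacePart j.1 ∈ e.target := hj.1.2
  have hD : IsOpen (chartDomain I e ×ˢ J) := (isOpen_chartDomain hI e).prod hJ
  have hξ2 : ∀ k, ContDiffAt ℝ 2 (fun w => ξ w k) j.base := fun k =>
    ((contDiffAt_pi.mp (hξ.contDiffAt (hD.mem_nhds hj))) k).of_le two_le_infty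
  have hη2 : ContDiffAt ℝ 2 η j.base := (hη.contDiffAt (hD.mem_nhds hj)).of_le two_le_infty
  refine prolongApply_schrodinger_of_eq_zero g V e j
    (fun i k => differentiableAt_of_contDiffOn (g.contDiffOn_inv he i k) e.open_target hy)
    (fun i => differentiableAt_of_contDiffOn (g.contDiffOn_contractedChristoffel he i)
      e.open_target hy)
    (differentiableAt_of_contDiffOn (contDiffOn_comp_symm he hV) e.open_target hy)
    hξ2 hη2 hs (fun i k => g.inv_symm e _ i k) hH (ht _ hj).1 (ht _ hj).2 fun i k => ?_
  have h1 : ∀ a, ∀ i : Fin n, fderiv ℝ (fderiv ℝ fun w => ξ w none) j.base a (baseVec (some i)) = 0 :=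
    fun a i => fderiv_fderiv_apply_eq_zero (hξ2 none)
      (by filter_upwards [hD.mem_nhds hj] with w hw using (ht w hw).1 i) a
  have h2 : ∀ a, fderiv ℝ (fderiv ℝ fun w => ξ w none) j.base a fibreVec = 0 :=
    fun a => fderiv_fderiv_apply_eq_zero (hξ2 none)
      (by filter_upwards [hD.mem_nhds hj] with w hw using (ht w hw).2) a
  simp only [Jet2.base] at h1 h2
  rw [hess_eq]
  simp [Jet2.toJet1, h1, h2]

/-- Vary the symmetric matrix Q of spatial second derivatives and let u_t compensate for it. The
coefficient B P of Q must be antisymmetric for every value P of u_i. At P = 0 this is the claim on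
`quadraticCoeff`, and the dependence on P gives ∂_u ξ^m = 0. -/
lemma space_component_of_criterion (he : e ∈ atlas (E n) M)
    (hV : ContMDiff (𝓡 n) 𝓘(ℝ, ℝ) ∞ V) (hI : IsOpen I) (hJ : IsOpen J)
    (hξ : ContDiffOn ℝ ∞ ξ (chartDomain I e ×ˢ J)) (hη : ContDiffOn ℝ ∞ η (chartDomain I e ×ˢ J))
    (ht : ∀ w ∈ chartDomain I e ×ˢ J,
      (∀ i : Fin n, fderiv ℝ (fun w => ξ w none) w (baseVec (some i)) = 0) ∧
      derivU (fun w => ξ w none) w = 0)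
    (hc : SymmetryCriterion ξ η (schrodinger g V e) (chartDomain I e ×ˢ J))
    {w : Jet0 (Option (Fin n))} (hw : w ∈ chartDomain I e ×ˢ J) :
    (∀ m : Fin n, derivU (fun w => ξ w (some m)) w = 0) ∧
      ∀ i k, quadraticCoeff g e ξ w i k + quadraticCoeff g e ξ w k i = 0 := by
  obtain ⟨z, u⟩ := w
  have hy : spacePart z ∈ e.target := hw.1.2
  have hR : ∀ P Q, (∀ i k, Q i k = Q k i) →
      prolongApply ξ η (schrodinger g V e) (jetWith g V e z u P Q 0) = 0 := fun P Q hQ =>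
    hc _ hw (jetWith_symm g V e hQ) (schrodinger_jetWith g V e z u P Q 0)
  set B : (Fin n → ℝ) → Fin n → Fin n → ℝ := fun P i k =>
    (fderiv ℝ (fun y => g.inv e y i k) (spacePart z) (spacePart (ξ (z, u)))
      + fderiv ℝ (fun w => ξ w none) (z, u) (baseVec none) * g.inv e (spacePart z) i k
      - 2 * ∑ l, g.inv e (spacePart z) i l *
        (fderiv ℝ (fun w => ξ w (some k)) (z, u) (baseVec (some l))
          + P l * derivU (fun w => ξ w (some k)) (z, u))) with hB
  have hpair : ∀ (P : Fin n → ℝ) (Q : Fin n → Fin n → ℝ), (∀ i k, Q i k = Q k i) → ∑ i, ∑ k, Q i k * B P i k = 0 := by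
    intro P Q hQ
    have h1 := hR P Q hQ
    have h0 := hR P 0 fun _ _ => rfl
    rw [prolongApply_eq_of_time_component he hV hI hJ hξ hη ht (jetWith g V e z u P Q 0) hw
      (jetWith_symm g V e hQ) (schrodinger_jetWith g V e z u P Q 0)] at h1
    rw [prolongApply_eq_of_time_component he hV hI hJ hξ hη ht (jetWith g V e z u P 0 0) hw
      (jetWith_symm g V e fun _ _ => rfl) (schrodinger_jetWith g V e z u P 0 0)] at h0
    -- The jets for Q and for 0 differ also in u_t, but the lower order part sees only the spatial
    -- first derivatives.
    have h2 : lowerOrderPart g V e ξ η (jetWith g V e z u P Q 0).toJet1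
      = lowerOrderPart g V e ξ η (jetWith g V e z u P 0 0).toJet1 := by
      simp only [lowerOrderPart, hess_eq, totalDeriv0_eq, jetWith, Jet2.toJet1, Option.elim]
    have h3 : lowerOrderPart g V e ξ η (jetWith g V e z u P 0 0).toJet1 = 0 := by
      simpa [jetWith] using h0
    rw [h2, h3, add_zero] at h1
    rw [← h1]
    simp only [totalDeriv0_eq]
    rfl
  refine ⟨fun m => ?_, fun i k => ?_⟩
  swap
  · simpa [hB, quadraticCoeff] using add_swap_eq_zero_of_pairing (hpair 0) i k
  have hd : ∀ P, B P m m = 0 := fun P => by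
    have := add_swap_eq_zero_of_pairing (hpair P) m m
    linarith
  have h1 := hd 0
  -- With P the m-th column of g_ij one has g^ml P_l = 1, so the diagonal entry B_mm differs from
  -- its value at P = 0 by -2 ∂_u ξ^m.
  have h2 := hd ((g.comp e (spacePart z)).mulVec (Pi.single m 1))
  have h3 : ∑ l, g.inv e (spacePart z) m l
      * (g.comp e (spacePart z)).mulVec (Pi.single m 1) l = 1 := by
    change (g.inv e (spacePart z)).mulVec ((g.comp e (spacePart z)).mulVec (Pi.single m 1)) m = 1
    rw [Matrix.mulVec_mulVec, g.inv_mul_comp he hy, Matrix.one_mulVec, Pi.single_eq_same]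
  simp only [hB, mul_add, Finset.sum_add_distrib, ← mul_assoc, ← Finset.sum_mul, h3,
    Pi.zero_apply, mul_zero, zero_mul, Finset.sum_const_zero, add_zero] at h1 h2
  linarith

/-- With all spatial and mixed second derivatives set to zero, the criterion is a polynomial
identity of degree two in u_i, and the coefficients can be compared. -/
lemma fibre_component_of_criterion (hn : 0 < n) (he : e ∈ atlas (E n) M)
    (hV : ContMDiff (𝓡 n) 𝓘(ℝ, ℝ) ∞ V) (hI : IsOpen I) (hJ : IsOpen J)
    (hξ : ContDiffOn ℝ ∞ ξ (chartDomain I e ×ˢ J)) (hη : ContDiffOn ℝ ∞ η (chartDomain I e ×ˢ J))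
    (ht : ∀ w ∈ chartDomain I e ×ˢ J,
      (∀ i : Fin n, fderiv ℝ (fun w => ξ w none) w (baseVec (some i)) = 0) ∧
      derivU (fun w => ξ w none) w = 0)
    (hx : ∀ w ∈ chartDomain I e ×ˢ J, ∀ m : Fin n, derivU (fun w => ξ w (some m)) w = 0)
    (hc : SymmetryCriterion ξ η (schrodinger g V e) (chartDomain I e ×ˢ J))
    {w : Jet0 (Option (Fin n))} (hw : w ∈ chartDomain I e ×ˢ J) :
    fderiv ℝ (fderiv ℝ η) w fibreVec fibreVec = 0
      ∧ (∀ m, linearCoeff g e ξ η w m = 0) ∧ constantCoeff g V e ξ η w = 0 := by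
  obtain ⟨z, u⟩ := w
  have hy : spacePart z ∈ e.target := hw.1.2
  have hD : IsOpen (chartDomain I e ×ˢ J) := (isOpen_chartDomain hI e).prod hJ
  have hξ2 : ∀ k, ContDiffAt ℝ 2 (fun w => ξ w k) (z, u) := fun k =>
    ((contDiffAt_pi.mp (hξ.contDiffAt (hD.mem_nhds hw))) k).of_le two_le_infty
  have hη2 : ContDiffAt ℝ 2 η (z, u) := (hη.contDiffAt (hD.mem_nhds hw)).of_le two_le_infty
  have h := quadratic_eq_zero (c := fderiv ℝ (fderiv ℝ η) (z, u) fibreVec fibreVec)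
    (K := constantCoeff g V e ξ η (z, u)) (G := g.inv e (spacePart z))
    (L := linearCoeff g e ξ η (z, u)) (g.inv_symm e _) fun P => by
      have h0 := hc (jetWith g V e z u P 0 0) hw (jetWith_symm g V e fun _ _ => rfl)
        (schrodinger_jetWith g V e z u P 0 0)
      rw [prolongApply_eq_of_time_component he hV hI hJ hξ hη ht (jetWith g V e z u P 0 0) hw
        (jetWith_symm g V e fun _ _ => rfl) (schrodinger_jetWith g V e z u P 0 0),
        lowerOrderPart_eq g V e _ hξ2 hη2
          (by filter_upwards [hD.mem_nhds hw] with w hw using hx w hw)] at h0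
      simpa [jetWith, Jet2.toJet1] using h0
  refine ⟨?_, h.2⟩
  -- The comparison only yields η_uu g^ik = 0. One diagonal entry of g⁻¹ g = 1 shows that the g^ik
  -- do not all vanish; it exists because n > 0.
  have h1 := congrFun (congrFun (g.inv_mul_comp he hy) ⟨0, hn⟩) ⟨0, hn⟩
  rw [Matrix.mul_apply, Matrix.one_apply_eq] at h1
  rw [← mul_one (fderiv ℝ (fderiv ℝ η) (z, u) fibreVec fibreVec), ← h1, Finset.mul_sum]
  simp only [← mul_assoc, h.1, zero_mul, Finset.sum_const_zero]

/-- The determining equations. -/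
lemma criterion_iff (hn : 0 < n) (he : e ∈ atlas (E n) M)
    (hV : ContMDiff (𝓡 n) 𝓘(ℝ, ℝ) ∞ V) (hI : IsOpen I) (hJ : IsOpen J)
    (hξ : ContDiffOn ℝ ∞ ξ (chartDomain I e ×ˢ J)) (hη : ContDiffOn ℝ ∞ η (chartDomain I e ×ˢ J))
    (ht : ∀ w ∈ chartDomain I e ×ˢ J,
      (∀ i : Fin n, fderiv ℝ (fun w => ξ w none) w (baseVec (some i)) = 0) ∧
      derivU (fun w => ξ w none) w = 0)
    (hx : ∀ w ∈ chartDomain I e ×ˢ J, ∀ m : Fin n, derivU (fun w => ξ w (some m)) w = 0) :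
    SymmetryCriterion ξ η (schrodinger g V e) (chartDomain I e ×ˢ J) ↔
      ∀ w ∈ chartDomain I e ×ˢ J,
        (∀ i k, quadraticCoeff g e ξ w i k + quadraticCoeff g e ξ w k i = 0) ∧
        fderiv ℝ (fderiv ℝ η) w fibreVec fibreVec = 0 ∧
        (∀ m, linearCoeff g e ξ η w m = 0) ∧ constantCoeff g V e ξ η w = 0 := by
  refine ⟨fun hc w hw => ⟨(space_component_of_criterion he hV hI hJ hξ hη ht hc hw).2,
    fibre_component_of_criterion hn he hV hI hJ hξ hη ht hx hc hw⟩, fun h j hj hs hH => ?_⟩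
  obtain ⟨h1, h2, h3, h4⟩ := h _ hj
  have hD : IsOpen (chartDomain I e ×ˢ J) := (isOpen_chartDomain hI e).prod hJ
  have hξ2 : ∀ k, ContDiffAt ℝ 2 (fun w => ξ w k) j.base := fun k =>
    ((contDiffAt_pi.mp (hξ.contDiffAt (hD.mem_nhds hj))) k).of_le two_le_infty
  have hη2 : ContDiffAt ℝ 2 η j.base := (hη.contDiffAt (hD.mem_nhds hj)).of_le two_le_infty
  have hlow : lowerOrderPart g V e ξ η j.toJet1 = 0 := by
    rw [lowerOrderPart_eq g V e _ hξ2 hη2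
      (by filter_upwards [hD.mem_nhds hj] with w hw using hx w hw)]
    have h2' : fderiv ℝ (fderiv ℝ η) (j.toJet1.1, j.toJet1.2.1) fibreVec fibreVec = 0 := h2
    have h3' : ∀ m, linearCoeff g e ξ η (j.toJet1.1, j.toJet1.2.1) m = 0 := h3
    have h4' : constantCoeff g V e ξ η (j.toJet1.1, j.toJet1.2.1) = 0 := h4
    simp only [h2', h3', h4', zero_mul, mul_zero, Finset.sum_const_zero, add_zero]
  rw [prolongApply_eq_of_time_component he hV hI hJ hξ hη ht j hj hs hH, hlow, add_zero]
  have hq : ∀ i k : Fin n, (fderiv ℝ (fun y => g.inv e y i k) (spacePart j.1) (spacePart (ξ j.base))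
          + fderiv ℝ (fun w => ξ w none) j.base (baseVec none) * g.inv e (spacePart j.1) i k
          - 2 * ∑ l, g.inv e (spacePart j.1) i l *
            totalDeriv0 (fun w => ξ w (some k)) (some l) j.toJet1)
      = quadraticCoeff g e ξ j.base i k := fun i k => by
    have := hx _ hj k
    simp only [Jet2.base] at this
    simp [totalDeriv0_eq, quadraticCoeff, Jet2.toJet1, Jet2.base, this]
  simp only [hq]
  -- Symmetry of u_ik allows the coefficient to be replaced by its transpose, so vanishing of the
  -- symmetrized coefficient is enough.
  have h5 : (∑ i : Fin n, ∑ k : Fin n,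
        j.2.2.2 (some i) (some k) * quadraticCoeff g e ξ j.base i k)
      = ∑ i : Fin n, ∑ k : Fin n,
        j.2.2.2 (some i) (some k) * quadraticCoeff g e ξ j.base k i := by
    rw [Finset.sum_comm]
    exact Finset.sum_congr rfl fun i _ => Finset.sum_congr rfl fun k _ => by rw [hs]
  have h6 : (∑ i : Fin n, ∑ k : Fin n,
        j.2.2.2 (some i) (some k) * quadraticCoeff g e ξ j.base i k)
      + (∑ i : Fin n, ∑ k : Fin n,
        j.2.2.2 (some i) (some k) * quadraticCoeff g e ξ j.base k i) = 0 := by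
    simp only [← Finset.sum_add_distrib, ← mul_add, h1, mul_zero, Finset.sum_const_zero]
  linarith

end Criterion

end Determining

/-! ### Locality of the symmetry criterion -/

section CriterionCongr

variable {ι : Type*} [Fintype ι] [DecidableEq ι]

/-- The prolongation uses only derivatives of the coefficients, so agreement on an open set
suffices. This matters since `HasForm` constrains X on I × M × J only. -/
lemma symmetryCriterion_congr {D : Set (Jet0 ι)} (hD : IsOpen D) {ξ ξ' : Jet0 ι → ι → ℝ}
    {η η' : Jet0 ι → ℝ} (hξ : EqOn ξ ξ' D) (hη : EqOn η η' D) (H : Jet2 ι → ℝ) :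
    SymmetryCriterion ξ η H D ↔ SymmetryCriterion ξ' η' H D := by
  have h0 : ∀ (f f' : Jet0 ι → ℝ), EqOn f f' D → ∀ (i : ι) (j : Jet1 ι), (j.1, j.2.1) ∈ D →
      totalDeriv0 f i j = totalDeriv0 f' i j := fun f f' hf i j hj => by
    rw [totalDeriv0, totalDeriv0, (hf.eventuallyEq_of_mem (hD.mem_nhds hj)).fderiv_eq]
  have hk : ∀ k, EqOn (fun w => ξ w k) (fun w => ξ' w k) D := fun k w hw =>
    congrFun (hξ hw) k
  have h1 : ∀ (i : ι) (j : Jet1 ι), (j.1, j.2.1) ∈ D → prolong1 ξ η i j = prolong1 ξ' η' i j :=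
    fun i j hj => by
      rw [prolong1, prolong1, h0 _ _ hη i j hj]
      simp only [h0 _ _ (hk _) i j hj]
  have h2 : ∀ (i l : ι) (j : Jet2 ι), j.base ∈ D → prolong2 ξ η i l j = prolong2 ξ' η' i l j :=
    fun i l j hj => by
      have hmem : {j : Jet1 ι | (j.1, j.2.1) ∈ D} ∈ 𝓝 j.toJet1 :=
        (hD.preimage (by fun_prop : Continuous fun j : Jet1 ι => (j.1, j.2.1))).mem_nhds hj
      have he : prolong1 ξ η i =ᶠ[𝓝 j.toJet1] prolong1 ξ' η' i := by
        filter_upwards [hmem] with j hj using h1 i j hj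
      rw [prolong2, prolong2, totalDeriv1, totalDeriv1, he.fderiv_eq]
      simp only [h0 _ _ (hk _) l j.toJet1 hj]
  have h3 : ∀ j : Jet2 ι, j.base ∈ D → prolongApply ξ η H j = prolongApply ξ' η' H j :=
    fun j hj => by
      simp only [prolongApply, hξ hj, hη hj, h1 _ j.toJet1 hj, h2 _ _ j hj]
  exact forall_congr' fun j => forall_congr' fun hj => by rw [h3 j hj]

end CriterionCongr

/-! ### Restriction to fixed time or fixed position -/

section Slices

variable {n : ℕ}

/-- The point `(t, y)` of the space of independent variables. -/
def timeSpace (t : ℝ) (y : E n) : Option (Fin n) → ℝ := fun o => o.elim t y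

@[simp] lemma timeSpace_none (t : ℝ) (y : E n) : timeSpace t y none = t := rfl

@[simp] lemma spacePart_timeSpace (t : ℝ) (y : E n) : spacePart (timeSpace t y) = y := rfl

lemma timeSpace_eta (z : Option (Fin n) → ℝ) : timeSpace (z none) (spacePart z) = z := by
  funext o
  cases o <;> rfl

lemma hasFDerivAt_timeSpace_right (t : ℝ) (y : E n) :
    ∃ L : E n →L[ℝ] (Option (Fin n) → ℝ), HasFDerivAt (fun y : E n => timeSpace t y) L y ∧
      ∀ i, L (EuclideanSpace.single i 1) = Pi.single (some i) 1 := by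
  refine ⟨ContinuousLinearMap.pi fun o => o.elim 0 fun i => EuclideanSpace.proj i, ?_, ?_⟩
  · refine hasFDerivAt_pi.mpr fun o => ?_
    cases o with
    | none => exact hasFDerivAt_const t y
    | some i => exact (EuclideanSpace.proj i : E n →L[ℝ] ℝ).hasFDerivAt
  · intro i
    funext o
    cases o with
    | none => simp
    | some k => simp [Pi.single_apply]

lemma hasDerivAt_timeSpace_left (t : ℝ) (y : E n) :
    HasDerivAt (fun s => timeSpace s y) (Pi.single none 1) t := by
  refine hasDerivAt_pi.mpr fun o => ?_
  cases o with
  | none => exact (hasDerivAt_id t).congr_deriv (by simp)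
  | some i => simpa [timeSpace] using hasDerivAt_const t (y i)

lemma contDiff_timeSpace_right (t : ℝ) : ContDiff ℝ ∞ fun y : E n => timeSpace t y := by
  refine contDiff_pi.mpr fun o => ?_
  cases o with
  | none => exact contDiff_const
  | some i => exact (EuclideanSpace.proj i : E n →L[ℝ] ℝ).contDiff

lemma contDiff_timeSpace_left (y : E n) : ContDiff ℝ ∞ fun s : ℝ => timeSpace s y := by
  refine contDiff_pi.mpr fun o => ?_
  cases o with
  | none => exact contDiff_id
  | some i => exact contDiff_const

lemma pd_slice {f : (Option (Fin n) → ℝ) → ℝ} {t : ℝ} {y : E n}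
    (hf : DifferentiableAt ℝ f (timeSpace t y)) (i : Fin n) :
    pd i (fun y => f (timeSpace t y)) y = fderiv ℝ f (timeSpace t y) (Pi.single (some i) 1) := by
  obtain ⟨L, hL, hLi⟩ := hasFDerivAt_timeSpace_right t y
  have := (HasFDerivAt.comp (g := f) y hf.hasFDerivAt hL).fderiv
  change fderiv ℝ (f ∘ fun y => timeSpace t y) y _ = _
  rw [this, ContinuousLinearMap.comp_apply, hLi]

lemma deriv_slice {f : (Option (Fin n) → ℝ) → ℝ} {t : ℝ} {y : E n}
    (hf : DifferentiableAt ℝ f (timeSpace t y)) :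
    HasDerivAt (fun s => f (timeSpace s y)) (fderiv ℝ f (timeSpace t y) (Pi.single none 1)) t :=
  HasFDerivAt.comp_hasDerivAt (l := f) t hf.hasFDerivAt (hasDerivAt_timeSpace_left t y)

variable {M : Type*} [TopologicalSpace M] [ChartedSpace (E n) M]
  {e : OpenPartialHomeomorph M (E n)} {I : Set ℝ}

omit [ChartedSpace (E n) M] in
lemma timeSpace_mem {t : ℝ} {y : E n} (ht : t ∈ I) (hy : y ∈ e.target) :
    timeSpace t y ∈ chartDomain I e := ⟨ht, hy⟩

omit [ChartedSpace (E n) M] in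
lemma contDiffOn_slice {f : (Option (Fin n) → ℝ) → ℝ} (hf : ContDiffOn ℝ ∞ f (chartDomain I e))
    {t : ℝ} (ht : t ∈ I) : ContDiffOn ℝ ∞ (fun y => f (timeSpace t y)) e.target :=
  hf.comp (contDiff_timeSpace_right t).contDiffOn fun _ hy => timeSpace_mem ht hy

omit [ChartedSpace (E n) M] in
lemma contDiffOn_slice_time {f : (Option (Fin n) → ℝ) → ℝ}
    (hf : ContDiffOn ℝ ∞ f (chartDomain I e)) {y : E n} (hy : y ∈ e.target) :
    ContDiffOn ℝ ∞ (fun t => f (timeSpace t y)) I :=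
  hf.comp (contDiff_timeSpace_left y).contDiffOn fun _ ht => timeSpace_mem ht hy

lemma contDiffOn_fderiv_apply {F : Type*} [NormedAddCommGroup F] [NormedSpace ℝ F] {f : F → ℝ}
    {D : Set F} (hD : IsOpen D) (hf : ContDiffOn ℝ ∞ f D) (v : F) :
    ContDiffOn ℝ ∞ (fun x => fderiv ℝ f x v) D :=
  (hf.fderiv_of_isOpen hD (by simp)).clm_apply contDiffOn_const

omit [ChartedSpace (E n) M] in
lemma pd_pd_slice {f : (Option (Fin n) → ℝ) → ℝ} (hI : IsOpen I)
    (hf : ContDiffOn ℝ ∞ f (chartDomain I e))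
    {t : ℝ} {y : E n} (ht : t ∈ I) (hy : y ∈ e.target) (i k : Fin n) :
    pd i (pd k fun y => f (timeSpace t y)) y
      = fderiv ℝ (fun z => fderiv ℝ f z (Pi.single (some k) 1)) (timeSpace t y)
          (Pi.single (some i) 1) := by
  have hD := isOpen_chartDomain hI e
  have h1 : EqOn (pd k fun y => f (timeSpace t y))
      (fun y => fderiv ℝ f (timeSpace t y) (Pi.single (some k) 1)) e.target := fun y hy =>
    pd_slice (differentiableAt_of_contDiffOn hf hD (timeSpace_mem ht hy)) k
  rw [pd_congr e.open_target h1 hy, pd_slice (f := fun z => fderiv ℝ f z (Pi.single (some k) 1))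
    (differentiableAt_of_contDiffOn (contDiffOn_fderiv_apply hD hf _) hD (timeSpace_mem ht hy))]

end Slices

/-! ### Derivatives of functions affine in u -/

section FormDerivatives

lemma fderiv_fderiv_eq {F : Type*} [NormedAddCommGroup F] [NormedSpace ℝ F]
    {f : F → ℝ} {w : F} (hf : ContDiffAt ℝ 2 f w) (a b : F) :
    fderiv ℝ (fderiv ℝ f) w a b = fderiv ℝ (fun x => fderiv ℝ f x b) w a := by
  have h1 := ((differentiableAt_fderiv_of_contDiffAt hf).hasFDerivAt.clm_apply
    (hasFDerivAt_const b w)).fderiv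
  rw [h1]
  simp

variable {A : Type*} [NormedAddCommGroup A] [NormedSpace ℝ A]

lemma fderiv_affine {α β : A → ℝ} {w : A × ℝ} (hα : DifferentiableAt ℝ α w.1)
    (hβ : DifferentiableAt ℝ β w.1) (v : A × ℝ) :
    fderiv ℝ (fun w : A × ℝ => α w.1 * w.2 + β w.1) w v
      = fderiv ℝ α w.1 v.1 * w.2 + α w.1 * v.2 + fderiv ℝ β w.1 v.1 := by
  have h1 : HasFDerivAt (fun w : A × ℝ => α w.1) ((fderiv ℝ α w.1).comp
      (ContinuousLinearMap.fst ℝ A ℝ)) w := HasFDerivAt.comp w hα.hasFDerivAt hasFDerivAt_fst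
  have h2 : HasFDerivAt (fun w : A × ℝ => β w.1) ((fderiv ℝ β w.1).comp
      (ContinuousLinearMap.fst ℝ A ℝ)) w := HasFDerivAt.comp w hβ.hasFDerivAt hasFDerivAt_fst
  rw [((h1.fun_mul hasFDerivAt_snd).fun_add h2).fderiv]
  simp
  ring

lemma fderiv_comp_fst {α : A → ℝ} {w : A × ℝ} (hα : DifferentiableAt ℝ α w.1) (v : A × ℝ) :
    fderiv ℝ (fun w : A × ℝ => α w.1) w v = fderiv ℝ α w.1 v.1 := by
  have h1 : HasFDerivAt (fun w : A × ℝ => α w.1) ((fderiv ℝ α w.1).comp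
      (ContinuousLinearMap.fst ℝ A ℝ)) w := HasFDerivAt.comp w hα.hasFDerivAt hasFDerivAt_fst
  rw [h1.fderiv]
  simp

variable {D : Set A} {α β : A → ℝ}

lemma fderiv_fderiv_affine_base (hD : IsOpen D) (hα : ContDiffOn ℝ ∞ α D)
    (hβ : ContDiffOn ℝ ∞ β D) {w : A × ℝ} (hw : w.1 ∈ D) (v : A × ℝ) (b : A) :
    fderiv ℝ (fderiv ℝ fun w : A × ℝ => α w.1 * w.2 + β w.1) w v (b, 0)
      = fderiv ℝ (fun x => fderiv ℝ α x b) w.1 v.1 * w.2 + fderiv ℝ α w.1 b * v.2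
        + fderiv ℝ (fun x => fderiv ℝ β x b) w.1 v.1 := by
  have hα' : ContDiffAt ℝ 2 (fun w : A × ℝ => α w.1) w :=
    ((hα.contDiffAt (hD.mem_nhds hw)).comp w contDiffAt_fst).of_le two_le_infty
  have hβ' : ContDiffAt ℝ 2 (fun w : A × ℝ => β w.1) w :=
    ((hβ.contDiffAt (hD.mem_nhds hw)).comp w contDiffAt_fst).of_le two_le_infty
  rw [fderiv_fderiv_eq ((hα'.mul contDiffAt_snd).add hβ')]
  have h : (fun w : A × ℝ => fderiv ℝ (fun w : A × ℝ => α w.1 * w.2 + β w.1) w (b, 0))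
      =ᶠ[𝓝 w] fun w => fderiv ℝ α w.1 b * w.2 + fderiv ℝ β w.1 b := by
    filter_upwards [(hD.preimage continuous_fst).mem_nhds hw] with w hw
    rw [fderiv_affine (differentiableAt_of_contDiffOn hα hD hw)
      (differentiableAt_of_contDiffOn hβ hD hw)]
    simp
  rw [h.fderiv_eq, fderiv_affine (α := fun x => fderiv ℝ α x b) (β := fun x => fderiv ℝ β x b)
    (differentiableAt_of_contDiffOn (contDiffOn_fderiv_apply hD hα b) hD hw)
    (differentiableAt_of_contDiffOn (contDiffOn_fderiv_apply hD hβ b) hD hw)]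

lemma fderiv_fderiv_affine_fibre (hD : IsOpen D) (hα : ContDiffOn ℝ ∞ α D)
    (hβ : ContDiffOn ℝ ∞ β D) {w : A × ℝ} (hw : w.1 ∈ D) (v : A × ℝ) :
    fderiv ℝ (fderiv ℝ fun w : A × ℝ => α w.1 * w.2 + β w.1) w v (0, 1) = fderiv ℝ α w.1 v.1 := by
  have hα' : ContDiffAt ℝ 2 (fun w : A × ℝ => α w.1) w :=
    ((hα.contDiffAt (hD.mem_nhds hw)).comp w contDiffAt_fst).of_le two_le_infty
  have hβ' : ContDiffAt ℝ 2 (fun w : A × ℝ => β w.1) w :=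
    ((hβ.contDiffAt (hD.mem_nhds hw)).comp w contDiffAt_fst).of_le two_le_infty
  rw [fderiv_fderiv_eq ((hα'.mul contDiffAt_snd).add hβ')]
  have h : (fun w : A × ℝ => fderiv ℝ (fun w : A × ℝ => α w.1 * w.2 + β w.1) w (0, 1))
      =ᶠ[𝓝 w] fun w => α w.1 := by
    filter_upwards [(hD.preimage continuous_fst).mem_nhds hw] with w hw
    rw [fderiv_affine (differentiableAt_of_contDiffOn hα hD hw)
      (differentiableAt_of_contDiffOn hβ hD hw)]
    simp
  rw [h.fderiv_eq, fderiv_comp_fst (differentiableAt_of_contDiffOn hα hD hw)]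

lemma fderiv_fderiv_comp_fst (hD : IsOpen D) (hα : ContDiffOn ℝ ∞ α D)
    {w : A × ℝ} (hw : w.1 ∈ D) (v b : A × ℝ) :
    fderiv ℝ (fderiv ℝ fun w : A × ℝ => α w.1) w v b
      = fderiv ℝ (fun x => fderiv ℝ α x b.1) w.1 v.1 := by
  have hα' : ContDiffAt ℝ 2 (fun w : A × ℝ => α w.1) w :=
    ((hα.contDiffAt (hD.mem_nhds hw)).comp w contDiffAt_fst).of_le two_le_infty
  rw [fderiv_fderiv_eq hα']
  have h : (fun w : A × ℝ => fderiv ℝ (fun w : A × ℝ => α w.1) w b)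
      =ᶠ[𝓝 w] fun w => fderiv ℝ α w.1 b.1 := by
    filter_upwards [(hD.preimage continuous_fst).mem_nhds hw] with w hw
    rw [fderiv_comp_fst (differentiableAt_of_contDiffOn hα hD hw)]
  rw [h.fderiv_eq, fderiv_comp_fst (α := fun x => fderiv ℝ α x b.1)
    (differentiableAt_of_contDiffOn (contDiffOn_fderiv_apply hD hα b.1) hD hw)]

end FormDerivatives

/-! ### Determining equations for a field affine in u -/

section Form

variable {n : ℕ}

/-- The base components of a field `τ(t) ∂_t + ζ^m(t, x) ∂_m + η ∂_u`. -/
def formBase (τ : ℝ → ℝ) (ζ : Fin n → (Option (Fin n) → ℝ) → ℝ) (w : Jet0 (Option (Fin n))) :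
    Option (Fin n) → ℝ := fun o => o.elim (τ (w.1 none)) fun m => ζ m w.1

/-- The fibre component `α(t, x) u + β(t, x)`. -/
def formFibre (α β : (Option (Fin n) → ℝ) → ℝ) (w : Jet0 (Option (Fin n))) : ℝ :=
  α w.1 * w.2 + β w.1

lemma fderiv_comp_time {τ : ℝ → ℝ} {z : Option (Fin n) → ℝ}
    (hτ : DifferentiableAt ℝ τ (z none)) (v : Option (Fin n) → ℝ) :
    fderiv ℝ (fun z : Option (Fin n) → ℝ => τ (z none)) z v = v none * deriv τ (z none) := by
  let L : (Option (Fin n) → ℝ) →L[ℝ] ℝ := ContinuousLinearMap.proj none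
  have h : HasFDerivAt (fun z : Option (Fin n) → ℝ => τ (L z)) ((fderiv ℝ τ (z none)).comp L) z :=
    HasFDerivAt.comp (g := τ) z hτ.hasFDerivAt L.hasFDerivAt
  change fderiv ℝ (fun z : Option (Fin n) → ℝ => τ (L z)) z v = _
  rw [h.fderiv]
  simp [L, fderiv_eq_smul_deriv]

variable {M : Type*} [TopologicalSpace M] [ChartedSpace (E n) M] [IsManifold (𝓡 n) ∞ M]
  {g : Metric n M} {V : M → ℝ} {e : OpenPartialHomeomorph M (E n)} {I J : Set ℝ}
  {τ : ℝ → ℝ} {ζ : Fin n → (Option (Fin n) → ℝ) → ℝ} {α β : (Option (Fin n) → ℝ) → ℝ}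

omit [ChartedSpace (E n) M] [IsManifold (𝓡 n) ∞ M] in
lemma contDiffOn_comp_time (hτ : ContDiffOn ℝ ∞ τ I) :
    ContDiffOn ℝ ∞ (fun z : Option (Fin n) → ℝ => τ (z none)) (chartDomain I e) :=
  hτ.comp (contDiff_apply ℝ ℝ none).contDiffOn fun _ hz => hz.1

omit [ChartedSpace (E n) M] [IsManifold (𝓡 n) ∞ M] in
lemma contDiffOn_formBase (hτ : ContDiffOn ℝ ∞ τ I)
    (hζ : ∀ m, ContDiffOn ℝ ∞ (ζ m) (chartDomain I e)) :
    ContDiffOn ℝ ∞ (formBase τ ζ) (chartDomain I e ×ˢ J) := by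
  refine contDiffOn_pi.mpr fun o => ?_
  cases o with
  | none => exact (contDiffOn_comp_time hτ).comp contDiffOn_fst fun w hw => hw.1
  | some m => exact (hζ m).comp contDiffOn_fst fun w hw => hw.1

omit [ChartedSpace (E n) M] [IsManifold (𝓡 n) ∞ M] in
lemma contDiffOn_formFibre (hα : ContDiffOn ℝ ∞ α (chartDomain I e))
    (hβ : ContDiffOn ℝ ∞ β (chartDomain I e)) :
    ContDiffOn ℝ ∞ (formFibre α β) (chartDomain I e ×ˢ J) :=
  ((hα.comp contDiffOn_fst fun _ hw => hw.1).mul contDiffOn_snd).add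
    (hβ.comp contDiffOn_fst fun _ hw => hw.1)

omit [ChartedSpace (E n) M] [IsManifold (𝓡 n) ∞ M] in
lemma fderiv_formBase_none (hI : IsOpen I) (hτ : ContDiffOn ℝ ∞ τ I)
    {w : Jet0 (Option (Fin n))} (hw : w.1 none ∈ I) (v : Jet0 (Option (Fin n))) :
    fderiv ℝ (fun w => formBase τ ζ w none) w v = v.1 none * deriv τ (w.1 none) := by
  have hd : DifferentiableAt ℝ τ (w.1 none) := differentiableAt_of_contDiffOn hτ hI hw
  have hd' : DifferentiableAt ℝ (fun z : Option (Fin n) → ℝ => τ (z none)) w.1 :=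
    DifferentiableAt.comp (g := τ) w.1 hd (differentiableAt_apply none w.1)
  exact (fderiv_comp_fst (α := fun z : Option (Fin n) → ℝ => τ (z none)) hd' v).trans
    (fderiv_comp_time hd _)

omit [ChartedSpace (E n) M] [IsManifold (𝓡 n) ∞ M] in
lemma fderiv_formBase_some (hI : IsOpen I) (hζ : ∀ m, ContDiffOn ℝ ∞ (ζ m) (chartDomain I e))
    {w : Jet0 (Option (Fin n))} (hw : w.1 ∈ chartDomain I e) (m : Fin n)
    (v : Jet0 (Option (Fin n))) :
    fderiv ℝ (fun w => formBase τ ζ w (some m)) w v = fderiv ℝ (ζ m) w.1 v.1 :=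
  fderiv_comp_fst (differentiableAt_of_contDiffOn (hζ m) (isOpen_chartDomain hI e) hw) v

/-- The remainder of the determining equation for `a`. -/
def potentialEq (g : Metric n M) (V : M → ℝ) (e : OpenPartialHomeomorph M (E n)) (τ : ℝ → ℝ)
    (ζ : Fin n → (Option (Fin n) → ℝ) → ℝ) (α : (Option (Fin n) → ℝ) → ℝ) (t : ℝ) (y : E n) : ℝ :=
  (∑ i, ∑ k, g.inv e y i k * pd i (pd k fun y => α (timeSpace t y)) y)
    - (∑ i, g.contractedChristoffel e y i * pd i (fun y => α (timeSpace t y)) y)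
    - deriv (fun s => α (timeSpace s y)) t
    - fderiv ℝ (fun y => V (e.symm y)) y (Metric.vecOf (fun m y => ζ m (timeSpace t y)) y)
    - deriv τ t * V (e.symm y)

omit [IsManifold (𝓡 n) ∞ M] in
-- The term α V u from V η cancels against the one that eliminating u_t produces with η_u = α. What
-- is left is affine in u, with the equation for β as its constant term.
lemma constantCoeff_form (hI : IsOpen I) (hτ : ContDiffOn ℝ ∞ τ I)
    (hα : ContDiffOn ℝ ∞ α (chartDomain I e)) (hβ : ContDiffOn ℝ ∞ β (chartDomain I e))
    {t : ℝ} {y : E n} (ht : t ∈ I) (hy : y ∈ e.target) (u : ℝ) :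
    constantCoeff g V e (formBase τ ζ) (formFibre α β) (timeSpace t y, u)
      = potentialEq g V e τ ζ α t y * u + schrodinger g V e (jetOf β (timeSpace t y)) := by
  have hD := isOpen_chartDomain hI e
  have hz : timeSpace t y ∈ chartDomain I e := timeSpace_mem ht hy
  have hαd := differentiableAt_of_contDiffOn hα hD hz
  have hβd := differentiableAt_of_contDiffOn hβ hD hz
  have h2 : ∀ i k : Fin n, fderiv ℝ (fderiv ℝ (formFibre α β)) (timeSpace t y, u)
      (baseVec (some i)) (baseVec (some k)) = pd i (pd k fun y => α (timeSpace t y)) y * u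
        + fderiv ℝ (fun z => fderiv ℝ β z (Pi.single (some k) 1)) (timeSpace t y)
          (Pi.single (some i) 1) := fun i k => by
    rw [pd_pd_slice hI hα ht hy]
    refine (fderiv_fderiv_affine_base hD hα hβ (w := (timeSpace t y, u)) hz _ _).trans ?_
    simp
  have h1 : ∀ o, fderiv ℝ (formFibre α β) (timeSpace t y, u) (baseVec o)
      = fderiv ℝ α (timeSpace t y) (Pi.single o 1) * u
        + fderiv ℝ β (timeSpace t y) (Pi.single o 1) := fun o => by
    refine (fderiv_affine (w := (timeSpace t y, u)) hαd hβd _).trans ?_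
    simp
  have hu : derivU (formFibre α β) (timeSpace t y, u) = α (timeSpace t y) := by
    refine (fderiv_affine (w := (timeSpace t y, u)) hαd hβd _).trans ?_
    simp
  have hs : (∑ i : Fin n, ∑ k : Fin n, g.inv e y i k *
        fderiv ℝ (fun z => fderiv ℝ β z (Pi.single (some i) 1)) (timeSpace t y)
          (Pi.single (some k) 1))
      = ∑ i : Fin n, ∑ k : Fin n, g.inv e y i k *
        fderiv ℝ (fun z => fderiv ℝ β z (Pi.single (some k) 1)) (timeSpace t y)
          (Pi.single (some i) 1) := by
    rw [Finset.sum_comm]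
    exact Finset.sum_congr rfl fun i _ => Finset.sum_congr rfl fun k _ => by rw [g.inv_symm]
  unfold constantCoeff potentialEq schrodinger jetOf
  simp only [h2, h1, hu, spacePart_timeSpace, hs, pd_slice hαd, (deriv_slice hαd).deriv,
    fderiv_formBase_none (ζ := ζ) hI hτ (w := (timeSpace t y, u)) ht]
  simp only [timeSpace_none, Pi.single_eq_same, formFibre, mul_add, Finset.sum_add_distrib,
    ← mul_assoc, ← Finset.sum_mul]
  have hv : spacePart (formBase τ ζ (timeSpace t y, u))
      = Metric.vecOf (fun m y => ζ m (timeSpace t y)) y := rfl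
  rw [hv]
  ring

/-- All terms with spatial derivatives of ζ or with Γ form the contracted invariance identity of the
connection, with factor c = τ_t, and cancel. That identity involves derivatives of the metric
equation, so `hL` is needed on the whole chart. -/
lemma linearCoeff_form (he : e ∈ atlas (E n) M) (hI : IsOpen I) (hτ : ContDiffOn ℝ ∞ τ I)
    (hζ : ∀ m, ContDiffOn ℝ ∞ (ζ m) (chartDomain I e))
    (hα : ContDiffOn ℝ ∞ α (chartDomain I e)) (hβ : ContDiffOn ℝ ∞ β (chartDomain I e))
    {t : ℝ} {y : E n} (ht : t ∈ I) (hy : y ∈ e.target) (u : ℝ)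
    (hL : ∀ y ∈ e.target, ∀ i j,
      g.lieForm e (fun m y => ζ m (timeSpace t y)) y i j = deriv τ t * g.comp e y i j) (m : Fin n) :
    linearCoeff g e (formBase τ ζ) (formFibre α β) (timeSpace t y, u) m
      = deriv (fun s => ζ m (timeSpace s y)) t
        + 2 * ∑ k, g.inv e y m k * pd k (fun y => α (timeSpace t y)) y := by
  have hD := isOpen_chartDomain hI e
  have hz : timeSpace t y ∈ chartDomain I e := timeSpace_mem ht hy
  have hαd := differentiableAt_of_contDiffOn hα hD hz
  have hζd := differentiableAt_of_contDiffOn (hζ m) hD hz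
  have h1 : ∀ k : Fin n, fderiv ℝ (fderiv ℝ (formFibre α β)) (timeSpace t y, u)
      fibreVec (baseVec (some k)) = pd k (fun y => α (timeSpace t y)) y := fun k => by
    rw [pd_slice hαd]
    refine (fderiv_fderiv_affine_base hD hα hβ (w := (timeSpace t y, u)) hz _ _).trans ?_
    simp
  have h2 : ∀ i k : Fin n, fderiv ℝ (fderiv ℝ fun w => formBase τ ζ w (some m)) (timeSpace t y, u)
      (baseVec (some i)) (baseVec (some k)) = pd i (pd k fun y => ζ m (timeSpace t y)) y :=
    fun i k => by
      rw [pd_pd_slice hI (hζ m) ht hy]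
      exact fderiv_fderiv_comp_fst hD (hζ m) (w := (timeSpace t y, u)) hz _ _
  have hv : spacePart (formBase τ ζ (timeSpace t y, u))
      = Metric.vecOf (fun m y => ζ m (timeSpace t y)) y := rfl
  have key := g.lieDeriv_contractedChristoffel he (fun m => contDiffOn_slice (hζ m) ht) hL hy m
  unfold linearCoeff
  simp only [h1, h2, spacePart_timeSpace, hv,
    fderiv_formBase_none (ζ := ζ) hI hτ (w := (timeSpace t y, u)) ht,
    fderiv_formBase_some (τ := τ) hI hζ (w := (timeSpace t y, u)) hz, ← pd_slice hζd,
    (deriv_slice hζd).deriv, timeSpace_none, Pi.single_eq_same]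
  linarith

/-- The symmetrized coefficient is twice the difference of the two sides of the inverse-metric
equation in `lieForm_eq_iff`, with c = τ_t. -/
lemma quadraticCoeff_form_iff (he : e ∈ atlas (E n) M) (hI : IsOpen I) (hτ : ContDiffOn ℝ ∞ τ I)
    (hζ : ∀ m, ContDiffOn ℝ ∞ (ζ m) (chartDomain I e))
    {t : ℝ} {y : E n} (ht : t ∈ I) (hy : y ∈ e.target) (u : ℝ) :
    (∀ i k, quadraticCoeff g e (formBase τ ζ) (timeSpace t y, u) i k
      + quadraticCoeff g e (formBase τ ζ) (timeSpace t y, u) k i = 0) ↔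
    ∀ i j, g.lieForm e (fun m y => ζ m (timeSpace t y)) y i j = deriv τ t * g.comp e y i j := by
  have hD := isOpen_chartDomain hI e
  have hz : timeSpace t y ∈ chartDomain I e := timeSpace_mem ht hy
  rw [g.lieForm_eq_iff he hy, ← Matrix.ext_iff]
  refine forall_congr' fun i => forall_congr' fun k => ?_
  have hv : spacePart (formBase τ ζ (timeSpace t y, u))
      = Metric.vecOf (fun m y => ζ m (timeSpace t y)) y := rfl
  have hs : (fun y => g.inv e y k i) = fun y => g.inv e y i k := funext fun y => g.inv_symm e y k i
  have hd : ∀ m l : Fin n, fderiv ℝ (ζ m) (timeSpace t y) (Pi.single (some l) 1)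
      = pd l (fun y => ζ m (timeSpace t y)) y := fun m l =>
    (pd_slice (differentiableAt_of_contDiffOn (hζ m) hD hz) l).symm
  unfold quadraticCoeff
  simp only [spacePart_timeSpace, hv, hs, g.inv_symm e y k i,
    fderiv_formBase_none (ζ := ζ) hI hτ (w := (timeSpace t y, u)) ht,
    fderiv_formBase_some (τ := τ) hI hζ (w := (timeSpace t y, u)) hz, hd,
    timeSpace_none, Pi.single_eq_same, Matrix.add_apply, Matrix.smul_apply, Matrix.of_apply,
    Matrix.mul_apply, Matrix.transpose_apply, Metric.jacobian, smul_eq_mul, one_mul]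
  have h1 : (∑ l, pd l (fun y => ζ i (timeSpace t y)) y * g.inv e y l k)
      = ∑ l, g.inv e y k l * pd l (fun y => ζ i (timeSpace t y)) y :=
    Finset.sum_congr rfl fun l _ => by rw [g.inv_symm e y l k, mul_comm]
  rw [h1]
  constructor <;> intro h <;> linarith

/-- The symmetry criterion, in a chart, for a field `τ ∂_t + ζ^m ∂_m + (α u + β) ∂_u`. -/
lemma criterion_form_iff (hn : 0 < n) (he : e ∈ atlas (E n) M)
    (hV : ContMDiff (𝓡 n) 𝓘(ℝ, ℝ) ∞ V) (hI : IsOpen I) (hJ : IsOpen J) (hJ'' : J.Nonempty)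
    (hτ : ContDiffOn ℝ ∞ τ I) (hζ : ∀ m, ContDiffOn ℝ ∞ (ζ m) (chartDomain I e))
    (hα : ContDiffOn ℝ ∞ α (chartDomain I e)) (hβ : ContDiffOn ℝ ∞ β (chartDomain I e)) :
    SymmetryCriterion (formBase τ ζ) (formFibre α β) (schrodinger g V e) (chartDomain I e ×ˢ J) ↔
      ∀ t ∈ I, ∀ y ∈ e.target,
        (∀ i j, g.lieForm e (fun m y => ζ m (timeSpace t y)) y i j
          = deriv τ t * g.comp e y i j) ∧
        (∀ m, deriv (fun s => ζ m (timeSpace s y)) t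
          + 2 * ∑ k, g.inv e y m k * pd k (fun y => α (timeSpace t y)) y = 0) ∧
        potentialEq g V e τ ζ α t y = 0 ∧
        schrodinger g V e (jetOf β (timeSpace t y)) = 0 := by
  have hD := isOpen_chartDomain hI e
  rw [criterion_iff hn he hV hI hJ (contDiffOn_formBase hτ hζ) (contDiffOn_formFibre hα hβ)
    (fun w hw => ⟨fun i => by simp [fderiv_formBase_none hI hτ hw.1.1],
      by simp [derivU, fderiv_formBase_none hI hτ hw.1.1]⟩)
    (fun w hw m => by simp [derivU, fderiv_formBase_some hI hζ hw.1])]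
  constructor
  · intro h t ht y hy
    obtain ⟨u, hu⟩ := hJ''
    -- An affine function of u is determined by two values, and a nonempty open set J has more than
    -- one point.
    obtain ⟨u', hu', hne⟩ : ∃ u' ∈ J, u' ≠ u := by
      have : (𝓝[≠] u).NeBot := inferInstance
      obtain ⟨u', h1, h2⟩ := (Filter.nonempty_of_mem
        (inter_mem (mem_nhdsWithin_of_mem_nhds (hJ.mem_nhds hu)) self_mem_nhdsWithin) :
        (J ∩ {u}ᶜ).Nonempty)
      exact ⟨u', h1, h2⟩
    have hL : ∀ y ∈ e.target, ∀ i j, g.lieForm e (fun m y => ζ m (timeSpace t y)) y i j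
          = deriv τ t * g.comp e y i j := fun y hy =>
      (quadraticCoeff_form_iff he hI hτ hζ ht hy u).mp (h (timeSpace t y, u)
        ⟨timeSpace_mem ht hy, hu⟩).1
    have h1 := h (timeSpace t y, u) ⟨timeSpace_mem ht hy, hu⟩
    have h2 := h (timeSpace t y, u') ⟨timeSpace_mem ht hy, hu'⟩
    have c1 := h1.2.2.2
    have c2 := h2.2.2.2
    rw [constantCoeff_form hI hτ hα hβ ht hy] at c1 c2
    have hp : potentialEq g V e τ ζ α t y = 0 := by
      have : potentialEq g V e τ ζ α t y * (u' - u) = 0 := by linarith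
      exact (mul_eq_zero.mp this).resolve_right (sub_ne_zero.mpr hne)
    refine ⟨hL y hy, fun m => ?_, hp, by simpa [hp] using c1⟩
    rw [← linearCoeff_form he hI hτ hζ hα hβ ht hy u hL m]
    exact h1.2.2.1 m
  · rintro h ⟨z, u⟩ ⟨hz, hu⟩
    obtain ⟨t, y, rfl⟩ : ∃ t y, z = timeSpace t y := ⟨_, _, (timeSpace_eta z).symm⟩
    have ht : t ∈ I := hz.1
    have hy : y ∈ e.target := hz.2
    refine ⟨(quadraticCoeff_form_iff he hI hτ hζ ht hy u).mpr (h t ht y hy).1, ?_, fun m => ?_, ?_⟩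
    · refine (fderiv_fderiv_affine_fibre hD hα hβ (w := (timeSpace t y, u)) hz _).trans ?_
      simp
    · rw [linearCoeff_form he hI hτ hζ hα hβ ht hy u (fun y hy => (h t ht y hy).1) m]
      exact (h t ht y hy).2.1 m
    · rw [constantCoeff_form hI hτ hα hβ ht hy, (h t ht y hy).2.2.1, (h t ht y hy).2.2.2]
      simp

end Form

/-! ### From charts to the manifold -/

section Global

variable {n : ℕ} {M : Type*} [TopologicalSpace M] [ChartedSpace (E n) M]

/-- A function on a connected manifold whose partial derivatives vanish is constant. -/
lemma eq_of_pd_eq_zero [PreconnectedSpace M] {f : M → ℝ}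
    (hf : ∀ e ∈ atlas (E n) M, ∀ y ∈ e.target, DifferentiableAt ℝ (fun y => f (e.symm y)) y)
    (h0 : ∀ e ∈ atlas (E n) M, ∀ y ∈ e.target, ∀ i, pd i (fun y => f (e.symm y)) y = 0)
    (x x' : M) : f x = f x' := by
  refine IsLocallyConstant.apply_eq_of_preconnectedSpace
    ((IsLocallyConstant.iff_eventually_eq f).mpr fun x => ?_) x x'
  set e := chartAt (E n) x
  have he : e ∈ atlas (E n) M := chart_mem_atlas _ x
  have hx : e x ∈ e.target := mem_chart_target _ x
  -- The target of a chart need not be connected, so the comparison is made on a ball inside it.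
  obtain ⟨r, hr, hball⟩ := Metric.isOpen_iff.mp e.open_target _ hx
  have hpre := e.continuousAt (mem_chart_source (E n) x) (Metric.ball_mem_nhds (e x) hr)
  filter_upwards [hpre, e.open_source.mem_nhds (mem_chart_source (E n) x)] with x' hx' hs
  have key := Metric.isOpen_ball.is_const_of_fderiv_eq_zero (𝕜 := ℝ)
    (convex_ball (e x) r).isPreconnected (f := fun y => f (e.symm y))
    (fun y hy => (hf e he y (hball hy)).differentiableWithinAt)
    (fun y hy => by
      ext v
      rw [fderiv_eq_sum_pd]
      simp [h0 e he y (hball hy)])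
    hx' (Metric.mem_ball_self hr)
  simpa [e.left_inv hs, e.left_inv (mem_chart_source (E n) x)] using key

section TimeDerivatives

variable [IsManifold (𝓡 n) ∞ M] {g : Metric n M} {V : M → ℝ}
  {e : OpenPartialHomeomorph M (E n)} {I J : Set ℝ}
  {τ : ℝ → ℝ} {Z : ℝ → VField n M} {a : ℝ → M → ℝ}

/-- The components of a time dependent vector field in a chart. -/
def chartField (e : OpenPartialHomeomorph M (E n)) (Z : ℝ → VField n M) (m : Fin n) :
    (Option (Fin n) → ℝ) → ℝ := inChart e fun t x => vecComp e x (Z t x) m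

lemma hasDerivAt_val (he : e ∈ atlas (E n) M) (hI : IsOpen I) (hZ : SmoothVField I Z) {t : ℝ}
    (ht : t ∈ I) {y : E n} (hy : y ∈ e.target) (v : TangentSpace (𝓡 n) (e.symm y)) :
    HasDerivAt (fun s => g.val (e.symm y) (Z s (e.symm y)) v)
      (∑ k, vecComp e (e.symm y) v k * ∑ j, g.comp e y j k
        * deriv (fun s => chartField e Z j (timeSpace s y)) t) t := by
  have hd : ∀ j, HasDerivAt (fun s => chartField e Z j (timeSpace s y))
      (deriv (fun s => chartField e Z j (timeSpace s y)) t) t := fun j =>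
    (differentiableAt_of_contDiffOn (contDiffOn_slice_time (hZ e he j) hy) hI ht).hasDerivAt
  have hv : (fun s => g.val (e.symm y) (Z s (e.symm y)) v) = fun s =>
      ∑ k, vecComp e (e.symm y) v k * ∑ j, g.comp e y j k * chartField e Z j (timeSpace s y) := by
    funext s
    conv_lhs => rw [vec_eq_sum he hy v]
    rw [map_sum]
    refine Finset.sum_congr rfl fun k _ => ?_
    rw [map_smul, g.val_coordVec he hy, smul_eq_mul]
    rfl
  rw [hv]
  exact HasDerivAt.fun_sum fun k _ => (HasDerivAt.fun_sum fun j _ => (hd j).const_mul _).const_mul _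

lemma mdifferentiableAt_of_smoothFun (ha : SmoothFun n I a) {t : ℝ} (ht : t ∈ I) (x : M) :
    MDifferentiableAt (𝓡 n) 𝓘(ℝ, ℝ) (a t) x :=
  (contMDiff_of_contDiffOn fun e he => contDiffOn_slice (ha e he) ht).mdifferentiableAt (by simp)

/-- Lowering the index with g_ij; the lowered form can be paired with tangent vectors and so loses
its dependence on the chart. -/
lemma gradient_iff (he : e ∈ atlas (E n) M) {t : ℝ} {y : E n} (hy : y ∈ e.target) :
    (∀ m, deriv (fun s => chartField e Z m (timeSpace s y)) t
      + 2 * ∑ k, g.inv e y m k * pd k (fun y => inChart e a (timeSpace t y)) y = 0) ↔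
    ∀ k, ∑ j, g.comp e y j k * deriv (fun s => chartField e Z j (timeSpace s y)) t
      = -2 * pd k (fun y => inChart e a (timeSpace t y)) y := by
  set W : Fin n → ℝ := fun m => deriv (fun s => chartField e Z m (timeSpace s y)) t
  set A : Fin n → ℝ := fun k => pd k (fun y => inChart e a (timeSpace t y)) y
  have h1 : (∀ m, W m + 2 * ∑ k, g.inv e y m k * A k = 0) ↔
      W = (-2 : ℝ) • (g.inv e y).mulVec A := by
    rw [funext_iff]
    refine forall_congr' fun m => ?_
    simp only [Pi.smul_apply, Matrix.mulVec, dotProduct, smul_eq_mul]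
    constructor <;> intro h <;> linarith
  have h2 : (∀ k, ∑ j, g.comp e y j k * W j = -2 * A k) ↔
      (g.comp e y).mulVec W = (-2 : ℝ) • A := by
    rw [funext_iff]
    refine forall_congr' fun k => ?_
    simp only [Pi.smul_apply, Matrix.mulVec, dotProduct, smul_eq_mul, g.comp_symm e y k]
  refine (h1.trans ?_).trans h2.symm
  constructor
  · intro h
    rw [h, Matrix.mulVec_smul, Matrix.mulVec_mulVec, g.comp_mul_inv he hy, Matrix.one_mulVec]
  · intro h
    have h3 := congrArg (g.inv e y).mulVec h
    rwa [Matrix.mulVec_smul, Matrix.mulVec_mulVec, g.inv_mul_comp he hy,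
      Matrix.one_mulVec] at h3

lemma gradient_iff_deriv_val (he : e ∈ atlas (E n) M) (hI : IsOpen I) (hZ : SmoothVField I Z)
    (ha : SmoothFun n I a) {t : ℝ} (ht : t ∈ I) {y : E n} (hy : y ∈ e.target) :
    (∀ k, ∑ j, g.comp e y j k * deriv (fun s => chartField e Z j (timeSpace s y)) t
      = -2 * pd k (fun y => inChart e a (timeSpace t y)) y) ↔
    ∀ v, deriv (fun s => g.val (e.symm y) (Z s (e.symm y)) v) t
      = -2 * dirDeriv (a t) (e.symm y) v := by
  have hd := fun v => dirDeriv_eq_sum he hy (mdifferentiableAt_of_smoothFun ha ht (e.symm y)) v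
  simp only [fun v => (hasDerivAt_val (g := g) he hI hZ ht hy v).deriv, hd]
  constructor
  · intro h v
    simp only [h, Finset.mul_sum]
    exact Finset.sum_congr rfl fun k _ => by rw [mul_left_comm]; rfl
  · intro h k
    have := h (coordVec e y k)
    simp only [vecComp_coordVec he hy, ite_mul, one_mul, zero_mul, Finset.sum_ite_eq',
      Finset.mem_univ, if_true] at this
    exact this

omit [IsManifold (𝓡 n) ∞ M] in
-- L_Z g is linear in Z, the metric does not depend on t, and ∂_t commutes with ∂_i on smooth
-- functions. Hence the homothety equation for Z may be differentiated in time.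
lemma hasDerivAt_lieForm (hI : IsOpen I) {ζ : Fin n → (Option (Fin n) → ℝ) → ℝ}
    (hζ : ∀ m, ContDiffOn ℝ ∞ (ζ m) (chartDomain I e)) {t : ℝ} (ht : t ∈ I) {y : E n}
    (hy : y ∈ e.target) (i j : Fin n) :
    HasDerivAt (fun t => g.lieForm e (fun m y => ζ m (timeSpace t y)) y i j)
      (g.lieForm e (fun m y => deriv (fun s => ζ m (timeSpace s y)) t) y i j) t := by
  have hD := isOpen_chartDomain hI e
  have hd : ∀ m, HasDerivAt (fun s => ζ m (timeSpace s y))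
      (deriv (fun s => ζ m (timeSpace s y)) t) t := fun j =>
    (differentiableAt_of_contDiffOn (contDiffOn_slice_time (hζ j) hy) hI ht).hasDerivAt
  have hp : ∀ m i, HasDerivAt (fun s => pd i (fun y => ζ m (timeSpace s y)) y)
      (pd i (fun y => deriv (fun s => ζ m (timeSpace s y)) t) y) t := fun m i => by
    have hz := timeSpace_mem ht hy
    have hc : ContDiffAt ℝ 2 (ζ m) (timeSpace t y) :=
      ((hζ m).contDiffAt (hD.mem_nhds hz)).of_le two_le_infty
    have h1 := deriv_slice (f := fun z => fderiv ℝ (ζ m) z (Pi.single (some i) 1))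
      (differentiableAt_of_contDiffOn (contDiffOn_fderiv_apply hD (hζ m) _) hD hz)
    have h2 : EqOn (fun y => deriv (fun s => ζ m (timeSpace s y)) t)
        (fun y => fderiv ℝ (ζ m) (timeSpace t y) (Pi.single none 1)) e.target := fun y hy =>
      (deriv_slice (differentiableAt_of_contDiffOn (hζ m) hD (timeSpace_mem ht hy))).deriv
    rw [pd_congr e.open_target h2 hy,
      pd_slice (f := fun z => fderiv ℝ (ζ m) z (Pi.single none 1))
        (differentiableAt_of_contDiffOn (contDiffOn_fderiv_apply hD (hζ m) _) hD hz),
      ← fderiv_fderiv_eq hc, fderiv_fderiv_comm hc, fderiv_fderiv_eq hc]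
    refine h1.congr_of_eventuallyEq ?_
    filter_upwards [hI.mem_nhds ht] with s hs
    exact pd_slice (differentiableAt_of_contDiffOn (hζ m) hD (timeSpace_mem hs hy)) i
  exact HasDerivAt.fun_sum fun k _ =>
    (((hd k).mul_const _).add ((hp k i).const_mul _)).add ((hp k j).const_mul _)

/-- The determining equation for `a`, once the Laplacian of `a` is expressed through `τ`. -/
lemma potentialEq_eq (he : e ∈ atlas (E n) M) (hV : ContMDiff (𝓡 n) 𝓘(ℝ, ℝ) ∞ V)
    (hI : IsOpen I) (hτ : ContDiffOn ℝ ∞ τ I) (hZ : SmoothVField I Z) (ha : SmoothFun n I a)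
    (hL : ∀ t ∈ I, ∀ y ∈ e.target, ∀ i j,
      g.lieForm e (fun m y => chartField e Z m (timeSpace t y)) y i j
        = deriv τ t * g.comp e y i j)
    (hgrad : ∀ t ∈ I, ∀ y ∈ e.target,
      ∀ k, ∑ j, g.comp e y j k * deriv (fun s => chartField e Z j (timeSpace s y)) t
        = -2 * pd k (fun y => inChart e a (timeSpace t y)) y)
    {t : ℝ} (ht : t ∈ I) {y : E n} (hy : y ∈ e.target) :
    potentialEq g V e τ (chartField e Z) (inChart e a) t y
      = -(deriv (fun s => a s (e.symm y)) t + n / 4 * deriv (deriv τ) t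
            + dirDeriv V (e.symm y) (Z t (e.symm y)) + deriv τ t * V (e.symm y)) := by
  have hD := isOpen_chartDomain hI e
  have hW : ∀ m, ContDiffOn ℝ ∞ (fun y => deriv (fun s => chartField e Z m (timeSpace s y)) t)
      e.target := fun m => by
    refine (contDiffOn_slice (contDiffOn_fderiv_apply hD (hZ e he m) (Pi.single none 1))
      ht).congr fun y hy => ?_
    exact (deriv_slice (differentiableAt_of_contDiffOn (hZ e he m) hD
      (timeSpace_mem ht hy))).deriv
  have hτ' : DifferentiableAt ℝ (deriv τ) t :=
    differentiableAt_of_contDiffOn (((contDiffOn_infty_iff_deriv_of_isOpen hI).mp hτ).2) hI ht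
  have hLW : ∀ i j, g.lieForm e (fun m y => deriv (fun s => chartField e Z m (timeSpace s y)) t)
      y i j = deriv (deriv τ) t * g.comp e y i j := fun i j => by
    have h1 := hasDerivAt_lieForm (g := g) hI (hZ e he) ht hy i j
    refine h1.unique ((hτ'.hasDerivAt.mul_const (g.comp e y i j)).congr_of_eventuallyEq ?_)
    filter_upwards [hI.mem_nhds ht] with s hs using hL s hs y hy i j
  -- Applied to the field ∂_t Z = -2 ∇a, whose Lie derivative of g is τ_tt g by `hLW`; this is the
  -- origin of the term (n/4) τ_tt.
  have key := g.laplacian_of_gradient he hW (contDiffOn_slice (ha e he) ht) (hgrad t ht) hy hLW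
  have hVd : MDifferentiableAt (𝓡 n) 𝓘(ℝ, ℝ) V (e.symm y) := hV.mdifferentiableAt (by simp)
  have hv : fderiv ℝ (fun y => V (e.symm y)) y
      (Metric.vecOf (fun m y => chartField e Z m (timeSpace t y)) y)
      = dirDeriv V (e.symm y) (Z t (e.symm y)) := by
    rw [Metric.fderiv_vecOf, dirDeriv_eq_sum he hy hVd]
    rfl
  have ha' : deriv (fun s => inChart e a (timeSpace s y)) t
      = deriv (fun s => a s (e.symm y)) t := rfl
  rw [potentialEq, key, hv, ha']
  ring

end TimeDerivatives

/-! ### The general form of a symmetry -/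

section Characterization

variable [IsManifold (𝓡 n) ∞ M] {g : Metric n M} {V : M → ℝ} {I J : Set ℝ}
  {τ : ℝ → ℝ} {Z : ℝ → VField n M} {a b : ℝ → M → ℝ} {X : PointField n M}

omit [IsManifold (𝓡 n) ∞ M] in
lemma PointField.HasForm.eqOn_baseComp (h : X.HasForm I J τ Z a b)
    (e : OpenPartialHomeomorph M (E n)) :
    EqOn (X.baseComp e) (formBase τ (chartField e Z)) (chartDomain I e ×ˢ J) := by
  intro w hw
  obtain ⟨h1, h2, -⟩ := h _ hw.1.1 (e.symm (spacePart w.1)) _ hw.2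
  funext o
  cases o with
  | none => exact h1
  | some m => exact congrArg (fun v => vecComp e (e.symm (spacePart w.1)) v m) h2

omit [IsManifold (𝓡 n) ∞ M] in
lemma PointField.HasForm.eqOn_fibreComp (h : X.HasForm I J τ Z a b)
    (e : OpenPartialHomeomorph M (E n)) :
    EqOn (X.fibreComp e) (formFibre (inChart e a) (inChart e b)) (chartDomain I e ×ˢ J) :=
  fun w hw => (h _ hw.1.1 (e.symm (spacePart w.1)) _ hw.2).2.2

/-- For a field of the form given by smooth `τ`, `Z`, `a`, `b`, being a Lie symmetry amounts to
the determining equations. -/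
lemma isLieSymmetry_iff_of_hasForm (hn : 0 < n) (hV : ContMDiff (𝓡 n) 𝓘(ℝ, ℝ) ∞ V)
    (hI : IsOpen I) (hJ : IsOpen J) (hJ'' : J.Nonempty) (hX : X.HasForm I J τ Z a b)
    (hτ : ContDiffOn ℝ ∞ τ I) (hZ : SmoothVField I Z) (ha : SmoothFun n I a)
    (hb : SmoothFun n I b) :
    X.IsLieSymmetry g V I J ↔
      (∀ t ∈ I, g.IsHomothetic (Z t) (deriv τ t / 2)) ∧
        (∀ t ∈ I, ∀ x v,
          deriv (fun s => g.val x (Z s x) v) t = -2 * dirDeriv (a t) x v) ∧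
        (∀ t ∈ I, ∀ x,
          deriv (fun s => a s x) t + n / 4 * deriv (deriv τ) t
            + dirDeriv V x (Z t x) + deriv τ t * V x = 0) ∧
        IsSolution g V I b := by
  have hsm : ∀ e ∈ atlas (E n) M, ContDiffOn ℝ ∞ (X.baseComp e) (chartDomain I e ×ˢ J) ∧
      ContDiffOn ℝ ∞ (X.fibreComp e) (chartDomain I e ×ˢ J) := fun e he =>
    ⟨(contDiffOn_formBase hτ (hZ e he)).congr (hX.eqOn_baseComp e),
      (contDiffOn_formFibre (ha e he) (hb e he)).congr (hX.eqOn_fibreComp e)⟩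
  have hcrit : ∀ e ∈ atlas (E n) M, (SymmetryCriterion (X.baseComp e) (X.fibreComp e)
      (schrodinger g V e) (chartDomain I e ×ˢ J) ↔ _) := fun e he =>
    (symmetryCriterion_congr ((isOpen_chartDomain hI e).prod hJ) (hX.eqOn_baseComp e)
      (hX.eqOn_fibreComp e) _).trans
    (criterion_form_iff hn he hV hI hJ hJ'' hτ (hZ e he) (ha e he) (hb e he))
  have hlie : ∀ e t y i j, g.lieDeriv e (Z t) y i j
      = g.lieForm e (fun m y => chartField e Z m (timeSpace t y)) y i j := fun _ _ _ _ _ => rfl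
  constructor
  · intro h
    have hc := fun e he => (hcrit e he).mp (h e he).2.2
    have hgr : ∀ e ∈ atlas (E n) M, ∀ t ∈ I, ∀ y ∈ e.target,
        ∀ k, ∑ j, g.comp e y j k * deriv (fun s => chartField e Z j (timeSpace s y)) t
          = -2 * pd k (fun y => inChart e a (timeSpace t y)) y := fun e he t ht y hy =>
      (gradient_iff he hy).mp (hc e he t ht y hy).2.1
    refine ⟨fun t ht => ⟨fun e he i => contDiffOn_slice (hZ e he i) ht,
      fun e he y hy i j => ?_⟩, fun t ht x => ?_, fun t ht x => ?_, hb, fun e he z hz => ?_⟩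
    · rw [hlie, (hc e he t ht y hy).1 i j]; ring
    · obtain ⟨e, he, y, hy, rfl⟩ := exists_mem_chart_target (n := n) x
      exact (gradient_iff_deriv_val he hI hZ ha ht hy).mp (hgr e he t ht y hy)
    · obtain ⟨e, he, y, hy, rfl⟩ := exists_mem_chart_target (n := n) x
      have := potentialEq_eq he hV hI hτ hZ ha (fun t ht y hy => (hc e he t ht y hy).1)
        (hgr e he) ht hy
      rw [(hc e he t ht y hy).2.2.1] at this
      linarith
    · rw [← timeSpace_eta z]
      exact (hc e he (z none) hz.1 (spacePart z) hz.2).2.2.2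
  · rintro ⟨h1, h2, h3, h4⟩ e he
    refine ⟨(hsm e he).1, (hsm e he).2, (hcrit e he).mpr ?_⟩
    have hL : ∀ t ∈ I, ∀ y ∈ e.target, ∀ i j,
      g.lieForm e (fun m y => chartField e Z m (timeSpace t y)) y i j
        = deriv τ t * g.comp e y i j := fun t ht y hy i j => by
      rw [← hlie, (h1 t ht).2 e he y hy i j]; ring
    have hgr : ∀ t ∈ I, ∀ y ∈ e.target,
        ∀ k, ∑ j, g.comp e y j k * deriv (fun s => chartField e Z j (timeSpace s y)) t
          = -2 * pd k (fun y => inChart e a (timeSpace t y)) y := fun t ht y hy =>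
      (gradient_iff_deriv_val he hI hZ ha ht hy).mpr (h2 t ht (e.symm y))
    refine fun t ht y hy => ⟨hL t ht y hy, (gradient_iff he hy).mpr (hgr t ht y hy),
      ?_, h4.2 e he _ (timeSpace_mem ht hy)⟩
    rw [potentialEq_eq he hV hI hτ hZ ha hL hgr ht hy, h3 t ht (e.symm y), neg_zero]

lemma hasDerivAt_fibre {f : Jet0 (Option (Fin n)) → ℝ} {z : Option (Fin n) → ℝ} {u : ℝ}
    (hf : DifferentiableAt ℝ f (z, u)) : HasDerivAt (fun u => f (z, u)) (derivU f (z, u)) u :=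
  HasFDerivAt.comp_hasDerivAt (l := f) u hf.hasFDerivAt
    ((hasDerivAt_const u z).prodMk (hasDerivAt_id u))

/-- A Lie symmetry has the form `τ(t) ∂_t + Z^i(t, x) ∂_i + (a(t, x) u + b(t, x)) ∂_u`. -/
lemma exists_hasForm_of_isLieSymmetry [ConnectedSpace M] (hn : 0 < n)
    (hV : ContMDiff (𝓡 n) 𝓘(ℝ, ℝ) ∞ V) (hI : IsOpen I) (hJ : IsOpen J) (hJ' : IsPreconnected J)
    (hJ'' : J.Nonempty) (h : X.IsLieSymmetry g V I J) :
    ∃ (τ : ℝ → ℝ) (Z : ℝ → VField n M) (a b : ℝ → M → ℝ), X.HasForm I J τ Z a b ∧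
      ContDiffOn ℝ ∞ τ I ∧ SmoothVField I Z ∧ SmoothFun n I a ∧ SmoothFun n I b := by
  obtain ⟨u₀, hu₀⟩ := hJ''
  obtain ⟨x₀⟩ := (inferInstance : Nonempty M)
  have hD : ∀ e : OpenPartialHomeomorph M (E n), IsOpen (chartDomain I e ×ˢ J) := fun e =>
    (isOpen_chartDomain hI e).prod hJ
  have hbase : ∀ e ∈ atlas (E n) M, ∀ o, ContDiffOn ℝ ∞ (fun w => X.baseComp e w o)
      (chartDomain I e ×ˢ J) := fun e he => contDiffOn_pi.mp (h e he).1
  have htime : ∀ e ∈ atlas (E n) M, ∀ w ∈ chartDomain I e ×ˢ J,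
      (∀ i : Fin n, fderiv ℝ (fun w => X.baseComp e w none) w (baseVec (some i)) = 0) ∧
      derivU (fun w => X.baseComp e w none) w = 0 := fun e he w hw =>
    time_component_of_criterion hn he hV hI hJ (h e he).1 (h e he).2.1 (h e he).2.2 hw
  have hspace : ∀ e ∈ atlas (E n) M, ∀ w ∈ chartDomain I e ×ˢ J, ∀ m : Fin n,
      derivU (fun w => X.baseComp e w (some m)) w = 0 := fun e he w hw =>
    (space_component_of_criterion he hV hI hJ (h e he).1 (h e he).2.1 (htime e he) (h e he).2.2
      hw).1
  have hfib : ∀ e ∈ atlas (E n) M, ∀ w ∈ chartDomain I e ×ˢ J,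
      fderiv ℝ (fderiv ℝ (X.fibreComp e)) w fibreVec fibreVec = 0 := fun e he w hw =>
    (fibre_component_of_criterion hn he hV hI hJ (h e he).1 (h e he).2.1 (htime e he)
      (hspace e he) (h e he).2.2 hw).1
  have hconst : ∀ e ∈ atlas (E n) M, ∀ f : Jet0 (Option (Fin n)) → ℝ,
      ContDiffOn ℝ ∞ f (chartDomain I e ×ˢ J) → (∀ w ∈ chartDomain I e ×ˢ J, derivU f w = 0) →
      ∀ z ∈ chartDomain I e, ∀ u ∈ J, f (z, u) = f (z, u₀) := by
    intro e he f hf h0 z hz u hu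
    have hd : ∀ u ∈ J, HasDerivAt (fun u => f (z, u)) (derivU f (z, u)) u := fun u hu =>
      hasDerivAt_fibre (differentiableAt_of_contDiffOn hf (hD e) ⟨hz, hu⟩)
    exact hJ.is_const_of_deriv_eq_zero hJ'
      (fun u hu => (hd u hu).differentiableAt.differentiableWithinAt)
      (fun u hu => by rw [(hd u hu).deriv, h0 _ ⟨hz, hu⟩]; rfl) hu hu₀
  have hslice : ∀ e : OpenPartialHomeomorph M (E n), ∀ f : Jet0 (Option (Fin n)) → ℝ,
      ContDiffOn ℝ ∞ f (chartDomain I e ×ˢ J) →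
      ContDiffOn ℝ ∞ (fun z => f (z, u₀)) (chartDomain I e) := fun e f hf =>
    hf.comp (contDiff_id.prodMk contDiff_const).contDiffOn fun z hz => ⟨hz, hu₀⟩
  -- The spatial derivatives of ξ^t vanish in every chart, and M is connected, so the value may be
  -- read at the fixed point x₀.
  have hτ : ∀ t ∈ I, ∀ x, X.ξt t x u₀ = X.ξt t x₀ u₀ := by
    intro t ht x
    have hsm : ∀ e ∈ atlas (E n) M, ContDiffOn ℝ ∞ (fun z => X.baseComp e (z, u₀) none)
        (chartDomain I e) := fun e he => hslice e _ (hbase e he none)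
    refine eq_of_pd_eq_zero (n := n) (f := fun x => X.ξt t x u₀) (fun e he y hy => ?_)
      (fun e he y hy i => ?_) x x₀
    · exact differentiableAt_of_contDiffOn (contDiffOn_slice (hsm e he) ht) e.open_target hy
    · have hz : timeSpace t y ∈ chartDomain I e := timeSpace_mem ht hy
      have h1 := pd_slice (differentiableAt_of_contDiffOn (hsm e he)
        (isOpen_chartDomain hI e) hz) i
      refine h1.trans ?_
      have h2 := (htime e he (timeSpace t y, u₀) ⟨hz, hu₀⟩).1 i
      have h3 : HasFDerivAt (fun z => X.baseComp e (z, u₀) none) _ (timeSpace t y) :=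
        HasFDerivAt.comp (g := fun w => X.baseComp e w none) (timeSpace t y)
        (differentiableAt_of_contDiffOn (hbase e he none) (hD e)
          (show (timeSpace t y, u₀) ∈ _ from ⟨hz, hu₀⟩)).hasFDerivAt
        ((hasFDerivAt_id (timeSpace t y)).prodMk (hasFDerivAt_const u₀ (timeSpace t y)))
      rw [h3.fderiv]
      simpa using h2
  have hdU : ∀ e ∈ atlas (E n) M, ContDiffOn ℝ ∞ (derivU (X.fibreComp e))
      (chartDomain I e ×ˢ J) := fun e he => contDiffOn_fderiv_apply (hD e) (h e he).2.1 _
  -- As η_uu = 0, the derivative η_u is constant along the interval J, and η - η_u u has derivative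
  -- zero there.
  have hη : ∀ e ∈ atlas (E n) M, ∀ z ∈ chartDomain I e, ∀ u ∈ J, X.fibreComp e (z, u)
      = derivU (X.fibreComp e) (z, u₀) * u
        + (X.fibreComp e (z, u₀) - derivU (X.fibreComp e) (z, u₀) * u₀) := by
    intro e he z hz u hu
    have hc1 := hconst e he _ (hdU e he) (fun w hw => by
      have hc : ContDiffAt ℝ 2 (X.fibreComp e) w :=
        ((h e he).2.1.contDiffAt ((hD e).mem_nhds hw)).of_le two_le_infty
      exact (fderiv_fderiv_eq hc _ _).symm.trans (hfib e he w hw)) z hz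
    have hd : ∀ u ∈ J, HasDerivAt (fun u => X.fibreComp e (z, u)
        - derivU (X.fibreComp e) (z, u₀) * u) 0 u := fun u hu => by
      have h1 := hasDerivAt_fibre (differentiableAt_of_contDiffOn (h e he).2.1 (hD e)
        (show (z, u) ∈ _ from ⟨hz, hu⟩))
      rw [hc1 u hu] at h1
      exact (h1.fun_sub ((hasDerivAt_id u).const_mul _)).congr_deriv (by simp)
    have h2 := hJ.is_const_of_deriv_eq_zero hJ'
      (fun u hu => (hd u hu).differentiableAt.differentiableWithinAt)
      (fun u hu => (hd u hu).deriv) hu hu₀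
    linarith
  set a : ℝ → M → ℝ := fun t x => deriv (fun u => X.η t x u) u₀ with ha
  have haU : ∀ e ∈ atlas (E n) M, EqOn (inChart e a)
      (fun z => derivU (X.fibreComp e) (z, u₀)) (chartDomain I e) := fun e he z hz =>
    (hasDerivAt_fibre (differentiableAt_of_contDiffOn (h e he).2.1 (hD e)
      (show (z, u₀) ∈ _ from ⟨hz, hu₀⟩))).deriv
  have hasm : SmoothFun n I a := fun e he => (hslice e _ (hdU e he)).congr (haU e he)
  -- Coefficients independent of u are read at the fixed value u₀, and b is the intercept of the
  -- affine function u ↦ η, computed at u₀.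
  refine ⟨fun t => X.ξt t x₀ u₀, fun t x => X.ξ t x u₀, a, fun t x => X.η t x u₀ - a t x * u₀,
    fun t ht x u hu => ?_, ?_, fun e he i => hslice e _ (hbase e he (some i)), hasm, fun e he =>
      (hslice e _ (h e he).2.1).sub ((hasm e he).mul contDiffOn_const)⟩
  · obtain ⟨e, he, y, hy, rfl⟩ := exists_mem_chart_target (n := n) x
    have hz : timeSpace t y ∈ chartDomain I e := timeSpace_mem ht hy
    refine ⟨?_, ?_, ?_⟩
    · refine Eq.trans ?_ (hτ t ht (e.symm y))
      exact hconst e he _ (hbase e he none) (fun w hw => (htime e he w hw).2) _ hz u hu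
    · exact vec_ext he hy fun m =>
        hconst e he _ (hbase e he (some m)) (fun w hw => hspace e he w hw m) _ hz u hu
    · have h1 := hη e he _ hz u hu
      have haz : derivU (X.fibreComp e) (timeSpace t y, u₀) = a t (e.symm y) := (haU e he hz).symm
      rw [haz] at h1
      exact h1
  · obtain ⟨e, he, y, hy, hxy⟩ := exists_mem_chart_target (n := n) x₀
    have := contDiffOn_slice_time (hslice e _ (hbase e he none)) hy
    subst hxy
    exact this

end Characterization

end Global

/-! ### Time-dependent multiples of one homothetic vector -/

section Multiples

variable {n : ℕ} {M : Type*} [TopologicalSpace M] [ChartedSpace (E n) M]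
  [IsManifold (𝓡 n) ∞ M] {g : Metric n M} {V S : M → ℝ} {I J : Set ℝ}
  {Y : VField n M} {Z : ℝ → VField n M} {T : ℝ → ℝ} {ψ ψ' : ℝ} {a : ℝ → M → ℝ}

omit [IsManifold (𝓡 n) ∞ M] in
lemma dirDeriv_smul (f : M → ℝ) (x : M) (c : ℝ) (v : TangentSpace (𝓡 n) x) :
    dirDeriv f x (c • v) = c * dirDeriv f x v := by
  rw [dirDeriv, map_smul]; rfl

omit [IsManifold (𝓡 n) ∞ M] in
lemma dirDeriv_mul_add {f : M → ℝ} {x : M} (hf : MDifferentiableAt (𝓡 n) 𝓘(ℝ, ℝ) f x) (c d : ℝ)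
    (v : TangentSpace (𝓡 n) x) :
    dirDeriv (fun x => c * f x + d) x v = c * dirDeriv f x v := by
  have h : HasMFDerivAt (𝓡 n) 𝓘(ℝ, ℝ) (fun x => c * f x + d) x
      ((c • (1 : ℝ →L[ℝ] ℝ)).comp (mfderiv (𝓡 n) 𝓘(ℝ, ℝ) f x)) := by
    have h1 : HasFDerivAt (fun r : ℝ => c * r + d) (c • (1 : ℝ →L[ℝ] ℝ)) (f x) :=
      ((hasFDerivAt_id (f x)).const_mul c).add_const d
    exact h1.hasMFDerivAt.comp x hf.hasMFDerivAt
  rw [dirDeriv, h.mfderiv]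
  rfl

omit [IsManifold (𝓡 n) ∞ M] in
lemma Metric.IsHomothetic.smul (h : g.IsHomothetic Y ψ) (c : ℝ) :
    g.IsHomothetic (fun x => c • Y x) (c * ψ) := by
  refine ⟨fun e he i => ?_, fun e he y hy i j => ?_⟩
  · simp only [vecComp_smul]
    exact contDiffOn_const.mul (h.1 e he i)
  · have hd := fun k => differentiableAt_of_contDiffOn (h.1 e he k) e.open_target hy
    have h1 := h.2 e he y hy i j
    simp only [lieDeriv, vecComp_smul] at h1 ⊢
    simp only [pd_const_mul c (hd _)]
    rw [show 2 * (c * ψ) * g.comp e y i j = c * (2 * ψ * g.comp e y i j) by ring, ← h1,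
      Finset.mul_sum]
    exact Finset.sum_congr rfl fun k _ => by ring

/-- Two factors would make a nonzero multiple of g vanish, against nondegeneracy. For n = 0 every
factor would do. -/
lemma Metric.IsHomothetic.factor_unique [Nonempty M] (hn : 0 < n) (h : g.IsHomothetic Y ψ)
    (h' : g.IsHomothetic Y ψ') : ψ = ψ' := by
  obtain ⟨x⟩ := (inferInstance : Nonempty M)
  obtain ⟨e, he, y, hy, rfl⟩ := exists_mem_chart_target (n := n) x
  by_contra hne
  have h0 : g.comp e y = 0 := Matrix.ext fun i j => by
    have := (h.2 e he y hy i j).symm.trans (h'.2 e he y hy i j)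
    have h2 : (ψ - ψ') * g.comp e y i j = 0 := by linarith
    exact (mul_eq_zero.mp h2).resolve_left (sub_ne_zero.mpr hne)
  have hu := g.isUnit_det_comp he hy
  have : Nonempty (Fin n) := ⟨⟨0, hn⟩⟩
  rw [h0, Matrix.det_zero] at hu
  exact not_isUnit_zero hu

/-- No regularity of T is assumed. At a point where some component of Y is nonzero, T is the
quotient of that component of Z by a constant. -/
lemma contDiffOn_of_multiple (hZ : SmoothVField I Z) (hT : ∀ t ∈ I, ∀ x, Z t x = T t • Y x)
    (hY : ∃ x, Y x ≠ 0) : ContDiffOn ℝ ∞ T I := by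
  obtain ⟨x, hx⟩ := hY
  obtain ⟨e, he, y, hy, rfl⟩ := exists_mem_chart_target (n := n) x
  obtain ⟨i, hi⟩ : ∃ i, vecComp e (e.symm y) (Y (e.symm y)) i ≠ 0 := by
    by_contra! h
    refine hx (vec_ext he hy fun i => ?_)
    rw [h i, vecComp, map_zero]
    rfl
  refine ((contDiffOn_slice_time (hZ e he i) hy).div_const
    (vecComp e (e.symm y) (Y (e.symm y)) i)).congr fun t ht => ?_
  refine (mul_div_cancel_right₀ (T t) hi).symm.trans ?_
  rw [← vecComp_smul, ← hT t ht]
  rfl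

omit [IsManifold (𝓡 n) ∞ M] in
lemma smoothVField_multiple (hT : ContDiffOn ℝ ∞ T I) (hY : g.IsHomothetic Y ψ) :
    SmoothVField I fun t x => T t • Y x := by
  intro e he i
  have h1 : ContDiffOn ℝ ∞ (fun z : Option (Fin n) → ℝ => vecComp e (e.symm (spacePart z))
      (Y (e.symm (spacePart z))) i) (chartDomain I e) :=
    (hY.1 e he i).comp (spacePartL n).contDiff.contDiffOn fun z hz => hz.2
  refine ((contDiffOn_comp_time hT).mul h1).congr fun z _ => ?_
  simp only [inChart, vecComp_smul]

omit [IsManifold (𝓡 n) ∞ M] in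
lemma deriv_val_multiple (hI : IsOpen I) (hTd : ContDiffOn ℝ ∞ T I)
    (hT : ∀ t ∈ I, ∀ x, Z t x = T t • Y x) {t : ℝ} (ht : t ∈ I) (x : M)
    (v : TangentSpace (𝓡 n) x) :
    deriv (fun s => g.val x (Z s x) v) t = deriv T t * g.val x (Y x) v := by
  have h : (fun s => g.val x (Z s x) v) =ᶠ[𝓝 t] fun s => T s * g.val x (Y x) v := by
    filter_upwards [hI.mem_nhds ht] with s hs
    rw [hT s hs, map_smul, smul_apply, smul_eq_mul]
  rw [h.deriv_eq, deriv_mul_const (differentiableAt_of_contDiffOn hTd hI ht)]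

lemma eq_of_dirDeriv_eq_zero [PreconnectedSpace M] {f : M → ℝ}
    (hf : ContMDiff (𝓡 n) 𝓘(ℝ, ℝ) ∞ f)
    (h0 : ∀ x (v : TangentSpace (𝓡 n) x), dirDeriv f x v = 0) (x x' : M) : f x = f x' :=
  eq_of_pd_eq_zero (n := n)
    (fun _ he _ hy => differentiableAt_of_contDiffOn (contDiffOn_comp_symm he hf)
      (OpenPartialHomeomorph.open_target _) hy)
    (fun _ he _ hy i => (pd_comp_symm he hy (hf.mdifferentiableAt (by simp)) i).trans (h0 _ _)) x x'

lemma contMDiff_slice (ha : SmoothFun n I a) {t : ℝ} (ht : t ∈ I) :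
    ContMDiff (𝓡 n) 𝓘(ℝ, ℝ) ∞ (a t) :=
  contMDiff_of_contDiffOn fun e he => contDiffOn_slice (ha e he) ht

omit [IsManifold (𝓡 n) ∞ M] in
lemma differentiableAt_time (hI : IsOpen I) (ha : SmoothFun n I a) {t : ℝ} (ht : t ∈ I) (x : M) :
    DifferentiableAt ℝ (fun s => a s x) t := by
  obtain ⟨e, he, y, hy, rfl⟩ := exists_mem_chart_target (n := n) x
  exact differentiableAt_of_contDiffOn (contDiffOn_slice_time (ha e he) hy) hI ht

lemma deriv_deriv_of_eqOn {τ : ℝ → ℝ} {c : ℝ} (hI : IsOpen I) (hT : ContDiffOn ℝ ∞ T I)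
    (h : ∀ t ∈ I, deriv τ t = c * T t) {t : ℝ} (ht : t ∈ I) :
    deriv (deriv τ) t = c * deriv T t := by
  have h1 : deriv τ =ᶠ[𝓝 t] fun s => c * T s := by
    filter_upwards [hI.mem_nhds ht] with s hs using h s hs
  rw [h1.deriv_eq, deriv_const_mul _ (differentiableAt_of_contDiffOn hT hI ht)]

lemma exists_eq_add_const {f h f' : ℝ → ℝ} (hI : IsOpen I) (hI' : IsPreconnected I)
    (hI'' : I.Nonempty) (hf : ∀ t ∈ I, HasDerivAt f (f' t) t)
    (hh : ∀ t ∈ I, HasDerivAt h (f' t) t) : ∃ c, ∀ t ∈ I, f t = h t + c := by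
  obtain ⟨t₀, ht₀⟩ := hI''
  refine ⟨f t₀ - h t₀, fun t ht => ?_⟩
  have hd : ∀ t ∈ I, HasDerivAt (fun t => f t - h t) 0 t := fun t ht =>
    ((hf t ht).fun_sub (hh t ht)).congr_deriv (sub_self _)
  have := hI.is_const_of_deriv_eq_zero hI'
    (fun t ht => (hd t ht).differentiableAt.differentiableWithinAt)
    (fun t ht => (hd t ht).deriv) ht ht₀
  linarith

lemma exists_primitive (hI : IsOpen I) (hI' : IsPreconnected I) (hI'' : I.Nonempty)
    (hT : ContDiffOn ℝ ∞ T I) : ∃ P : ℝ → ℝ, ∀ t ∈ I, HasDerivAt P (T t) t := by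
  obtain ⟨t₀, ht₀⟩ := hI''
  refine ⟨fun t => ∫ s in t₀..t, T s, fun t ht => ?_⟩
  have hsub : uIcc t₀ t ⊆ I := hI'.ordConnected.uIcc_subset ht₀ ht
  exact intervalIntegral.integral_hasDerivAt_right
    ((hT.continuousOn.mono hsub).intervalIntegrable)
    (hT.continuousOn.stronglyMeasurableAtFilter hI t ht)
    (hT.continuousOn.continuousAt (hI.mem_nhds ht))

lemma contDiffOn_of_hasDerivAt {f f' : ℝ → ℝ} (hI : IsOpen I)
    (hf : ∀ t ∈ I, HasDerivAt f (f' t) t) (hf' : ContDiffOn ℝ ∞ f' I) : ContDiffOn ℝ ∞ f I :=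
  (contDiffOn_infty_iff_deriv_of_isOpen hI).mpr
    ⟨fun t ht => (hf t ht).differentiableAt.differentiableWithinAt,
      hf'.congr fun t ht => (hf t ht).deriv⟩

lemma contDiffOn_deriv (hI : IsOpen I) (hT : ContDiffOn ℝ ∞ T I) : ContDiffOn ℝ ∞ (deriv T) I :=
  ((contDiffOn_infty_iff_deriv_of_isOpen hI).mp hT).2

lemma smoothFun_affine {A F : ℝ → ℝ} (hA : ContDiffOn ℝ ∞ A I) (hF : ContDiffOn ℝ ∞ F I)
    (hS : ContMDiff (𝓡 n) 𝓘(ℝ, ℝ) ∞ S) : SmoothFun n I fun t x => A t * S x + F t := by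
  intro e he
  have h1 : ContDiffOn ℝ ∞ (fun z : Option (Fin n) → ℝ => S (e.symm (spacePart z)))
      (chartDomain I e) :=
    (contDiffOn_comp_symm he hS).comp (spacePartL n).contDiff.contDiffOn fun z hz => hz.2
  exact ((contDiffOn_comp_time hA).mul h1).add (contDiffOn_comp_time hF)

end Multiples

/-! ### The symmetries that come from one homothetic vector -/

section Symmetries

variable {n : ℕ} {M : Type*} [TopologicalSpace M] [ChartedSpace (E n) M]
  [IsManifold (𝓡 n) ∞ M] [ConnectedSpace M] {g : Metric n M} {V : M → ℝ} {I J : Set ℝ}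
  {X : PointField n M}

lemma isLieSymmetry_iff (hn : 0 < n) (hV : ContMDiff (𝓡 n) 𝓘(ℝ, ℝ) ∞ V)
    (hI : IsOpen I) (hJ : IsOpen J) (hJ' : IsPreconnected J) (hJ'' : J.Nonempty) :
    X.IsLieSymmetry g V I J ↔
      ∃ (τ : ℝ → ℝ) (Z : ℝ → VField n M) (a b : ℝ → M → ℝ),
        X.HasForm I J τ Z a b ∧
        ContDiffOn ℝ ∞ τ I ∧ SmoothVField I Z ∧ SmoothFun n I a ∧
        (∀ t ∈ I, g.IsHomothetic (Z t) (deriv τ t / 2)) ∧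
        (∀ t ∈ I, ∀ x v,
          deriv (fun s => g.val x (Z s x) v) t = -2 * dirDeriv (a t) x v) ∧
        (∀ t ∈ I, ∀ x,
          deriv (fun s => a s x) t + n / 4 * deriv (deriv τ) t
            + dirDeriv V x (Z t x) + deriv τ t * V x = 0) ∧
        IsSolution g V I b := by
  constructor
  · intro h
    obtain ⟨τ, Z, a, b, hX, hτ, hZ, ha, hb⟩ :=
      exists_hasForm_of_isLieSymmetry hn hV hI hJ hJ' hJ'' h
    exact ⟨τ, Z, a, b, hX, hτ, hZ, ha,
      (isLieSymmetry_iff_of_hasForm hn hV hI hJ hJ'' hX hτ hZ ha hb).mp h⟩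
  · rintro ⟨τ, Z, a, b, hX, hτ, hZ, ha, h⟩
    exact (isLieSymmetry_iff_of_hasForm hn hV hI hJ hJ'' hX hτ hZ ha h.2.2.2.1).mpr h

variable {Y : VField n M} {ψ : ℝ} {T : ℝ → ℝ}

/-- The determining equations for a symmetry along a multiple of a fixed homothetic vector. -/
lemma exists_form_of_multiple (hn : 0 < n) (hV : ContMDiff (𝓡 n) 𝓘(ℝ, ℝ) ∞ V)
    (hI : IsOpen I) (hJ : IsOpen J) (hJ' : IsPreconnected J) (hJ'' : J.Nonempty)
    (hY : g.IsHomothetic Y ψ) (hY0 : ∃ x, Y x ≠ 0) (h : X.IsLieSymmetry g V I J)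
    (hT : ∀ t ∈ I, ∀ x : M, ∀ u ∈ J, X.ξ t x u = T t • Y x) :
    ContDiffOn ℝ ∞ T I ∧ ∃ (τ : ℝ → ℝ) (a b : ℝ → M → ℝ),
      X.HasForm I J τ (fun t x => T t • Y x) a b ∧ SmoothFun n I a ∧ IsSolution g V I b ∧
      (∀ t ∈ I, HasDerivAt τ (2 * ψ * T t) t) ∧
      (∀ t ∈ I, ∀ x v, deriv T t * g.val x (Y x) v = -2 * dirDeriv (a t) x v) ∧
      (∀ t ∈ I, ∀ x, deriv (fun s => a s x) t + n / 2 * ψ * deriv T t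
            + T t * (dirDeriv V x (Y x) + 2 * ψ * V x) = 0) := by
  obtain ⟨τ, Z, a, b, hX, hτ, hZ, ha, h1, h2, h3, hb⟩ :=
    (isLieSymmetry_iff hn hV hI hJ hJ' hJ'').mp h
  obtain ⟨u₀, hu₀⟩ := hJ''
  have hZT : ∀ t ∈ I, ∀ x, Z t x = T t • Y x := fun t ht x => by
    rw [← hT t ht x u₀ hu₀, (hX t ht x u₀ hu₀).2.1]
  have hTs := contDiffOn_of_multiple hZ hZT hY0
  -- The field T(t) Y has the factor τ_t/2 by the symmetry condition and T(t) ψ by scaling.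
  have hτ' : ∀ t ∈ I, deriv τ t = 2 * ψ * T t := fun t ht => by
    have e1 := h1 t ht
    rw [show Z t = fun x => T t • Y x from funext fun x => hZT t ht x] at e1
    have := e1.factor_unique hn (hY.smul (T t))
    linarith
  refine ⟨hTs, τ, a, b, fun t ht x u hu => ⟨(hX t ht x u hu).1, hT t ht x u hu,
    (hX t ht x u hu).2.2⟩, ha, hb, fun t ht => ?_, fun t ht x v => ?_, fun t ht x => ?_⟩
  · rw [← hτ' t ht]
    exact (differentiableAt_of_contDiffOn hτ hI ht).hasDerivAt
  · rw [← h2 t ht x v, deriv_val_multiple hI hTs hZT ht]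
  · rw [← h3 t ht x, deriv_deriv_of_eqOn hI hTs hτ' ht, hτ' t ht, hZT t ht x, dirDeriv_smul]
    ring

/-- Converse of `exists_form_of_multiple`. -/
lemma isLieSymmetry_of_multiple (hn : 0 < n) (hV : ContMDiff (𝓡 n) 𝓘(ℝ, ℝ) ∞ V)
    (hI : IsOpen I) (hJ : IsOpen J) (hJ' : IsPreconnected J) (hJ'' : J.Nonempty)
    (hY : g.IsHomothetic Y ψ) (hT : ContDiffOn ℝ ∞ T I) {τ : ℝ → ℝ} {a b : ℝ → M → ℝ}
    (hX : X.HasForm I J τ (fun t x => T t • Y x) a b) (ha : SmoothFun n I a)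
    (hb : IsSolution g V I b) (hτ : ∀ t ∈ I, HasDerivAt τ (2 * ψ * T t) t)
    (h2 : ∀ t ∈ I, ∀ x v, deriv T t * g.val x (Y x) v = -2 * dirDeriv (a t) x v)
    (h3 : ∀ t ∈ I, ∀ x, deriv (fun s => a s x) t + n / 2 * ψ * deriv T t
            + T t * (dirDeriv V x (Y x) + 2 * ψ * V x) = 0) :
    X.IsLieSymmetry g V I J := by
  have hτ' : ∀ t ∈ I, deriv τ t = 2 * ψ * T t := fun t ht => (hτ t ht).deriv
  refine (isLieSymmetry_iff hn hV hI hJ hJ' hJ'').mpr ⟨τ, _, a, b, hX,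
    contDiffOn_of_hasDerivAt hI hτ (contDiffOn_const.mul hT), smoothVField_multiple hT hY, ha,
    fun t ht => ?_, fun t ht x v => ?_, fun t ht x => ?_, hb⟩
  · have : deriv τ t / 2 = T t * ψ := by rw [hτ' t ht]; ring
    rw [this]
    exact hY.smul (T t)
  · rw [← h2 t ht x v, deriv_val_multiple hI hT (fun _ _ _ => rfl) ht]
  · rw [← h3 t ht x, deriv_deriv_of_eqOn hI hT hτ' ht, hτ' t ht, dirDeriv_smul]
    ring

/-- The condition T_t Y = -2 ∇a would make Y a gradient at any time with T_t ≠ 0. So T is a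
constant, a depends on t only, and the last determining equation says that a_t is constant as well.
-/
lemma isLieSymmetry_nongradient_iff (hn : 0 < n) (hV : ContMDiff (𝓡 n) 𝓘(ℝ, ℝ) ∞ V)
    (hI : IsOpen I) (hI' : IsPreconnected I) (hI'' : I.Nonempty)
    (hJ : IsOpen J) (hJ' : IsPreconnected J) (hJ'' : J.Nonempty)
    (hY : g.IsHomothetic Y ψ) (hgrad : ¬ ∃ S, g.IsGradientOf Y S) :
    (X.IsLieSymmetry g V I J ∧
      ∃ T : ℝ → ℝ, ∀ t ∈ I, ∀ x : M, ∀ u ∈ J, X.ξ t x u = T t • Y x) ↔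
    ∃ (c c₁ a₀ a₁ : ℝ) (b : ℝ → M → ℝ),
      X.HasForm I J (fun t => 2 * c * ψ * t + c₁) (fun _ x => c • Y x)
        (fun t _ => a₀ * t + a₁) b ∧
      IsSolution g V I b ∧
      ∀ x, c * dirDeriv V x (Y x) + 2 * ψ * c * V x + a₀ = 0 := by
  have hconst : ∀ (c : ℝ) x (v : TangentSpace (𝓡 n) x), dirDeriv (fun _ : M => c) x v = 0 :=
    fun c x v => by
      rw [dirDeriv, mfderiv_const]
      rfl
  constructor
  · rintro ⟨h, T, hT⟩
    -- The zero field is the gradient of a constant, hence excluded.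
    have hY0 : ∃ x, Y x ≠ 0 := by
      by_contra! h0
      refine hgrad ⟨fun _ => 0, contMDiff_const, fun x v => ?_⟩
      rw [hconst, h0 x, map_zero]
      rfl
    obtain ⟨hTs, τ, a, b, hX, ha, hb, hτ, h2, h3⟩ :=
      exists_form_of_multiple hn hV hI hJ hJ' hJ'' hY hY0 h hT
    have hT' : ∀ t ∈ I, deriv T t = 0 := by
      intro t ht
      by_contra hne
      -- The potential is -2a/T_t at the fixed time t; the summand 0 only matches
      -- `dirDeriv_mul_add`.
      refine hgrad ⟨fun x => -2 / deriv T t * a t x + 0, ?_, fun x v => ?_⟩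
      · exact (contMDiff_const.mul (contMDiff_slice ha ht)).add contMDiff_const
      · rw [dirDeriv_mul_add ((contMDiff_slice ha ht).mdifferentiableAt (by simp)), div_mul_eq_mul_div,
          ← h2 t ht x v, mul_div_cancel_left₀ _ hne]
    obtain ⟨t₀, ht₀⟩ := hI''
    obtain ⟨x₀⟩ := (inferInstance : Nonempty M)
    have hTc : ∀ t ∈ I, T t = T t₀ := fun t ht =>
      hI.is_const_of_deriv_eq_zero hI' (hTs.differentiableOn (by simp)) hT' ht ht₀
    have hax : ∀ t ∈ I, ∀ x, a t x = a t x₀ := fun t ht x =>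
      eq_of_dirDeriv_eq_zero (contMDiff_slice ha ht) (fun x v => by
        have := h2 t ht x v
        rw [hT' t ht] at this
        linarith) x x₀
    have hadx : ∀ t ∈ I, ∀ x, deriv (fun s => a s x) t = deriv (fun s => a s x₀) t :=
      fun t ht x => by
        have : (fun s => a s x) =ᶠ[𝓝 t] fun s => a s x₀ := by
          filter_upwards [hI.mem_nhds ht] with s hs using hax s hs x
        rw [this.deriv_eq]
    set a₀ := deriv (fun s => a s x₀) t₀ with ha₀
    have h4 : ∀ x, T t₀ * dirDeriv V x (Y x) + 2 * ψ * T t₀ * V x + a₀ = 0 := fun x => by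
      have := h3 t₀ ht₀ x
      rw [hadx t₀ ht₀ x, hT' t₀ ht₀] at this
      linarith
    -- At x₀ the potential terms do not depend on t, so a_t equals its value at t₀ throughout I.
    have had : ∀ t ∈ I, HasDerivAt (fun s => a s x₀) a₀ t := fun t ht => by
      have h5 := h3 t ht x₀
      rw [hT' t ht, hTc t ht] at h5
      have h6 : deriv (fun s => a s x₀) t = a₀ := by linarith [h4 x₀]
      rw [← h6]
      exact (differentiableAt_time hI ha ht x₀).hasDerivAt
    obtain ⟨c₁, hc₁⟩ := exists_eq_add_const (h := fun t => 2 * T t₀ * ψ * t) hI hI' ⟨t₀, ht₀⟩ hτ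
      fun t ht => ((hasDerivAt_id t).const_mul (2 * T t₀ * ψ)).congr_deriv (by
        rw [hTc t ht]; ring)
    obtain ⟨a₁, ha₁⟩ := exists_eq_add_const (h := fun t => a₀ * t) hI hI' ⟨t₀, ht₀⟩ had
      fun t ht => ((hasDerivAt_id t).const_mul a₀).congr_deriv (mul_one _)
    refine ⟨T t₀, c₁, a₀, a₁, b, fun t ht x u hu => ?_, hb, h4⟩
    obtain ⟨e1, e2, e3⟩ := hX t ht x u hu
    exact ⟨e1.trans (hc₁ t ht), e2.trans (congrArg (fun r : ℝ => r • Y x) (hTc t ht)),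
      e3.trans (by rw [hax t ht x, ha₁ t ht])⟩
  · rintro ⟨c, c₁, a₀, a₁, b, hX, hb, h⟩
    refine ⟨isLieSymmetry_of_multiple hn hV hI hJ hJ' hJ'' hY (T := fun _ => c) contDiffOn_const hX
      ?_ hb (fun t _ => ?_) (fun t _ x v => ?_) (fun t _ x => ?_),
      fun _ => c, fun t ht x u hu => (hX t ht x u hu).2.1⟩
    · intro e he
      have h1 : ContDiffOn ℝ ∞ (fun t : ℝ => a₀ * t + a₁) I := by fun_prop
      exact contDiffOn_comp_time h1
    · exact (((hasDerivAt_id t).const_mul (2 * c * ψ)).add_const c₁).congr_deriv (by ring)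
    · rw [hconst]; simp
    · have h1 : deriv (fun s : ℝ => a₀ * s + a₁) t = a₀ :=
        ((((hasDerivAt_id t).const_mul a₀).add_const a₁).congr_deriv (mul_one _)).deriv
      rw [h1, deriv_const]
      linear_combination h x

/-- Integrating T_t ∇S = -2 ∇a over the connected M gives a = -T_t S/2 + F(t). The remaining
equation is then affine in S with coefficients depending on t, and it separates because S is not
constant. The separation constant κ may have either sign. -/
lemma isLieSymmetry_gradient_iff (hn : 0 < n) (hV : ContMDiff (𝓡 n) 𝓘(ℝ, ℝ) ∞ V)
    (hI : IsOpen I) (hI' : IsPreconnected I) (hI'' : I.Nonempty)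
    (hJ : IsOpen J) (hJ' : IsPreconnected J) (hJ'' : J.Nonempty) {S : M → ℝ}
    (hY : g.IsHomothetic Y ψ) (hS : g.IsGradientOf Y S) (hY0 : ∃ x, Y x ≠ 0) :
    (X.IsLieSymmetry g V I J ∧
      ∃ T : ℝ → ℝ, (∃ t ∈ I, T t ≠ 0) ∧
        ∀ t ∈ I, ∀ x : M, ∀ u ∈ J, X.ξ t x u = T t • Y x) ↔
    ∃ (T P F : ℝ → ℝ) (b : ℝ → M → ℝ) (κ d : ℝ),
      (∃ t ∈ I, T t ≠ 0) ∧
      ContDiffOn ℝ ∞ T I ∧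
      (∀ t ∈ I, HasDerivAt P (T t) t) ∧
      (∃ c₁ : ℝ, X.HasForm I J (fun t => 2 * ψ * P t + c₁) (fun t x => T t • Y x)
        (fun t x => -(1 / 2) * deriv T t * S x + F t) b) ∧
      IsSolution g V I b ∧
      (∀ x, dirDeriv V x (Y x) + 2 * ψ * V x - 1 / 2 * κ * S x + d = 0) ∧
      (∀ t ∈ I, deriv (deriv T) t = κ * T t) ∧
      (∀ t ∈ I, HasDerivAt F (T t * d - n / 2 * ψ * deriv T t) t) := by
  have hSd : ∀ x, MDifferentiableAt (𝓡 n) 𝓘(ℝ, ℝ) S x := fun x =>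
    hS.1.mdifferentiableAt (by simp)
  constructor
  · rintro ⟨h, T, ⟨t₁, ht₁, hT₁⟩, hT⟩
    obtain ⟨hTs, τ, a, b, hX, ha, hb, hτ, h2, h3⟩ :=
      exists_form_of_multiple hn hV hI hJ hJ' hJ'' hY hY0 h hT
    obtain ⟨P, hP⟩ := exists_primitive hI hI' hI'' hTs
    obtain ⟨c₁, hc₁⟩ := exists_eq_add_const (h := fun t => 2 * ψ * P t) hI hI' hI'' hτ
      fun t ht => (hP t ht).const_mul (2 * ψ)
    obtain ⟨x₀⟩ := (inferInstance : Nonempty M)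
    set F : ℝ → ℝ := fun t => 1 / 2 * deriv T t * S x₀ + a t x₀ with hF
    have hTd : ∀ t ∈ I, HasDerivAt (deriv T) (deriv (deriv T) t) t := fun t ht =>
      (differentiableAt_of_contDiffOn (contDiffOn_deriv hI hTs) hI ht).hasDerivAt
    -- The function T_t S/2 + a has vanishing gradient at each time, so it equals its value at x₀,
    -- which is F.
    have hax : ∀ t ∈ I, ∀ x, a t x = -(1 / 2) * deriv T t * S x + F t := fun t ht x => by
      have hsm := contMDiff_slice ha ht
      have hadd : ContMDiff (𝓡 n) 𝓘(ℝ, ℝ) ∞ fun x => (1 / 2 * deriv T t) * S x + a t x :=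
        (contMDiff_const.mul hS.1).add hsm
      have := eq_of_dirDeriv_eq_zero hadd (fun x v => by
        obtain ⟨e, he, y, hy, rfl⟩ := exists_mem_chart_target (n := n) x
        have h4 := h2 t ht (e.symm y) v
        rw [← hS.2] at h4
        rw [dirDeriv_eq_sum he hy (hSd _), dirDeriv_eq_sum he hy
          (hsm.mdifferentiableAt (by simp))] at h4
        rw [dirDeriv_eq_sum he hy (hadd.mdifferentiableAt (by simp))]
        have d1 := differentiableAt_of_contDiffOn (contDiffOn_comp_symm he hS.1) e.open_target hy
        have d2 := differentiableAt_of_contDiffOn (contDiffOn_comp_symm he hsm) e.open_target hy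
        simp only [pd_add (d1.const_mul _) d2, pd_const_mul _ d1, mul_add, Finset.sum_add_distrib,
          mul_left_comm _ (1 / 2 * deriv T t), ← Finset.mul_sum]
        linarith) x x₀
      simp only [hF]
      linarith
    have hFd : ∀ t ∈ I, HasDerivAt F (deriv F t) t := fun t ht =>
      ((((hTd t ht).const_mul (1 / 2)).mul_const (S x₀)).add
        (differentiableAt_time hI ha ht x₀).hasDerivAt).differentiableAt.hasDerivAt
    have had : ∀ t ∈ I, ∀ x, deriv (fun s => a s x) t
        = -(1 / 2) * deriv (deriv T) t * S x + deriv F t := fun t ht x => by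
      have h4 : (fun s => a s x) =ᶠ[𝓝 t] fun s => -(1 / 2) * deriv T s * S x + F s := by
        filter_upwards [hI.mem_nhds ht] with s hs using hax s hs x
      rw [h4.deriv_eq]
      exact ((((hTd t ht).const_mul (-(1 / 2))).mul_const (S x)).add (hFd t ht)).deriv
    -- The separation constants are read off from the determining equation at the single time t₁,
    -- where T does not vanish.
    set κ := deriv (deriv T) t₁ / T t₁ with hκ
    set d := (deriv F t₁ + n / 2 * ψ * deriv T t₁) / T t₁ with hd
    have hW : ∀ x, dirDeriv V x (Y x) + 2 * ψ * V x - 1 / 2 * κ * S x + d = 0 := fun x => by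
      have h4 := h3 t₁ ht₁ x
      rw [had t₁ ht₁ x] at h4
      have h5 : deriv (deriv T) t₁ = κ * T t₁ := (div_mul_cancel₀ _ hT₁).symm
      have h6 : deriv F t₁ + n / 2 * ψ * deriv T t₁ = d * T t₁ := (div_mul_cancel₀ _ hT₁).symm
      rw [h5] at h4
      have h7 : T t₁ * (dirDeriv V x (Y x) + 2 * ψ * V x - 1 / 2 * κ * S x + d) = 0 := by
        linear_combination h4 - h6
      exact (mul_eq_zero.mp h7).resolve_left hT₁
    -- If S were constant, nondegeneracy of g would give Y = 0.
    obtain ⟨x₁, hx₁⟩ : ∃ x₁, S x₁ ≠ S x₀ := by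
      by_contra! h0
      obtain ⟨x, hx⟩ := hY0
      refine hx (g.nondegenerate x (Y x) fun v => ?_)
      rw [← hS.2, show S = fun _ => S x₀ from funext h0, dirDeriv, mfderiv_const]
      rfl
    have hsep : ∀ t ∈ I, deriv (deriv T) t = κ * T t ∧
        deriv F t = T t * d - n / 2 * ψ * deriv T t := fun t ht => by
      -- The equation at time t minus T(t) times the one for V: it contains x only through S, so
      -- evaluating it at x₀ and x₁ makes both coefficients vanish.
      have e : ∀ x, -(1 / 2) * (deriv (deriv T) t - κ * T t) * S x
          + (deriv F t + n / 2 * ψ * deriv T t - T t * d) = 0 := fun x => by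
        have h4 := h3 t ht x
        rw [had t ht x] at h4
        linear_combination h4 - T t * hW x
      have h5 : (deriv (deriv T) t - κ * T t) * (S x₁ - S x₀) = 0 := by
        linear_combination -2 * e x₁ + 2 * e x₀
      have h6 : deriv (deriv T) t - κ * T t = 0 :=
        (mul_eq_zero.mp h5).resolve_right (sub_ne_zero.mpr hx₁)
      have h7 := e x₀
      rw [h6] at h7
      exact ⟨sub_eq_zero.mp h6, by linarith⟩
    refine ⟨T, P, F, b, κ, d, ⟨t₁, ht₁, hT₁⟩, hTs, hP, ⟨c₁, fun t ht x u hu => ?_⟩, hb, hW,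
      fun t ht => (hsep t ht).1, fun t ht => by rw [← (hsep t ht).2]; exact hFd t ht⟩
    obtain ⟨e1, e2, e3⟩ := hX t ht x u hu
    exact ⟨e1.trans (hc₁ t ht), e2, e3.trans (by rw [hax t ht x])⟩
  · rintro ⟨T, P, F, b, κ, d, hT0, hTs, hP, ⟨c₁, hX⟩, hb, hW, hT2, hFd⟩
    have hTs' := contDiffOn_deriv hI hTs
    -- F is only assumed differentiable; its smoothness follows from the equation for its
    -- derivative.
    have hFs : ContDiffOn ℝ ∞ F I := contDiffOn_of_hasDerivAt hI hFd
      ((hTs.mul contDiffOn_const).sub (contDiffOn_const.mul hTs'))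
    refine ⟨isLieSymmetry_of_multiple hn hV hI hJ hJ' hJ'' hY hTs hX
      (smoothFun_affine (contDiffOn_const.mul hTs') hFs hS.1) hb
      (fun t ht => ((hP t ht).const_mul (2 * ψ)).add_const c₁) (fun t ht x v => ?_)
      (fun t ht x => ?_), T, hT0, fun t ht x u hu => (hX t ht x u hu).2.1⟩
    · rw [dirDeriv_mul_add (hSd x), hS.2]
      ring
    · have hTd : HasDerivAt (deriv T) (κ * T t) t := by
        rw [← hT2 t ht]
        exact (differentiableAt_of_contDiffOn hTs' hI ht).hasDerivAt
      have h1 : deriv (fun s => -(1 / 2) * deriv T s * S x + F s) t = _ :=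
        (((hTd.const_mul (-(1 / 2))).mul_const (S x)).add (hFd t ht)).deriv
      rw [h1]
      linear_combination T t * hW x

end Symmetries

end

end LieSym

theorem proposition1 {n : ℕ} (hn : 0 < n) {M : Type*} [TopologicalSpace M]
    [ChartedSpace (LieSym.E n) M] [IsManifold (𝓡 n) ∞ M] [ConnectedSpace M]
    (g : LieSym.Metric n M) (V : M → ℝ) (hV : ContMDiff (𝓡 n) 𝓘(ℝ, ℝ) ∞ V)
    {I J : Set ℝ} (hI : IsOpen I) (hI' : IsPreconnected I) (hI'' : I.Nonempty)
    (hJ : IsOpen J) (hJ' : IsPreconnected J) (hJ'' : J.Nonempty) :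
    -- the symmetries are generated by the homothetic algebra
    (∀ X : LieSym.PointField n M, X.IsLieSymmetry g V I J ↔
      ∃ (τ : ℝ → ℝ) (Z : ℝ → LieSym.VField n M) (a b : ℝ → M → ℝ),
        X.HasForm I J τ Z a b ∧
        ContDiffOn ℝ ∞ τ I ∧ LieSym.SmoothVField I Z ∧ LieSym.SmoothFun n I a ∧
        (∀ t ∈ I, g.IsHomothetic (Z t) (deriv τ t / 2)) ∧
        (∀ t ∈ I, ∀ x v,
          deriv (fun s => g.val x (Z s x) v) t = -2 * LieSym.dirDeriv (a t) x v) ∧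
        (∀ t ∈ I, ∀ x,
          deriv (fun s => a s x) t + n / 4 * deriv (deriv τ) t
            + LieSym.dirDeriv V x (Z t x) + deriv τ t * V x = 0) ∧
        LieSym.IsSolution g V I b) ∧
    -- (a) the symmetries that come from a non-gradient HV/KV `Y`
    (∀ (Y : LieSym.VField n M) (ψ : ℝ), g.IsHomothetic Y ψ → (¬ ∃ S, g.IsGradientOf Y S) →
      ∀ X : LieSym.PointField n M,
        (X.IsLieSymmetry g V I J ∧
          ∃ T : ℝ → ℝ, ∀ t ∈ I, ∀ x : M, ∀ u ∈ J, X.ξ t x u = T t • Y x) ↔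
        ∃ (c c₁ a₀ a₁ : ℝ) (b : ℝ → M → ℝ),
          X.HasForm I J (fun t => 2 * c * ψ * t + c₁) (fun _ x => c • Y x)
            (fun t _ => a₀ * t + a₁) b ∧
          LieSym.IsSolution g V I b ∧
          ∀ x, c * LieSym.dirDeriv V x (Y x) + 2 * ψ * c * V x + a₀ = 0) ∧
    -- (b) the symmetries that come from a non-zero gradient HV/KV `Y = ∇S`; `κ` stands for `c²`
    (∀ (Y : LieSym.VField n M) (ψ : ℝ) (S : M → ℝ), g.IsHomothetic Y ψ → g.IsGradientOf Y S →
      (∃ x, Y x ≠ 0) →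
      ∀ X : LieSym.PointField n M,
        (X.IsLieSymmetry g V I J ∧
          ∃ T : ℝ → ℝ, (∃ t ∈ I, T t ≠ 0) ∧
            ∀ t ∈ I, ∀ x : M, ∀ u ∈ J, X.ξ t x u = T t • Y x) ↔
        ∃ (T P F : ℝ → ℝ) (b : ℝ → M → ℝ) (κ d : ℝ),
          (∃ t ∈ I, T t ≠ 0) ∧
          ContDiffOn ℝ ∞ T I ∧
          (∀ t ∈ I, HasDerivAt P (T t) t) ∧
          (∃ c₁ : ℝ, X.HasForm I J (fun t => 2 * ψ * P t + c₁) (fun t x => T t • Y x)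
            (fun t x => -(1 / 2) * deriv T t * S x + F t) b) ∧
          LieSym.IsSolution g V I b ∧
          (∀ x, LieSym.dirDeriv V x (Y x) + 2 * ψ * V x - 1 / 2 * κ * S x + d = 0) ∧
          (∀ t ∈ I, deriv (deriv T) t = κ * T t) ∧
          (∀ t ∈ I, HasDerivAt F (T t * d - n / 2 * ψ * deriv T t) t)) := by
  exact ⟨fun _ => LieSym.isLieSymmetry_iff hn hV hI hJ hJ' hJ'',
    fun _ _ hY hgrad _ => LieSym.isLieSymmetry_nongradient_iff hn hV hI hI' hI'' hJ hJ' hJ'' hY hgrad,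
    fun _ _ _ hY hS hY0 _ =>
      LieSym.isLieSymmetry_gradient_iff hn hV hI hI' hI'' hJ hJ' hJ'' hY hS hY0⟩
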